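/- Let $(\mathcal X,d)$ be a locally compact metric space, $m$ a Radon measure on $\mathcal X$ with full support, $B(x,r)$ the open ball, $V(x,r)=m(B(x,r))$, and let $X=(X_t,\mathbb P_x)$ be a Hunt process on $\mathcal X$ (possibly of finite lifetime, with a cemetery $\partial$ added to $\mathcal X$ as a one-point compactification; functions on $\mathcal X$ are extended by $0$ to $\partial$), with first exit times $\tau_U=\inf\{t\ge 0: X_t\notin U\}$. Let $\phi:[0,\infty)\to[0,\infty)$ be strictly increasing with $\phi(0)=0$, $\phi(1)=1$. Suppose that, for some constants $C_{V}>1$, $\lambda_0\ge 2$, $C_{RV}>1$, $c_\phi\ge 1$, $\beta>0$, $a,b>1$, $c_1,c_2>0$, $C_{EP}>0$ and some $r_0\in(0,\infty]$: (VD) $V(x,2r)\le C_{V}V(x,r)$ for all $x\in\mathcal X$, $r>0$; (RVD) $V(x,\lambda_0 r)\ge C_{RV}V(x,r)$ for all $x\in\mathcal X$, $0<r\le \mathrm{diam}(\mathcal X)/\lambda_0$; (growth of $\phi$) $\phi(R)/\phi(r)\le c_\phi (R/r)^\beta$ for all $0<r\le R<\infty$; (reverse doubling of $\phi$) $\phi(ar)\ge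 b\,\phi(r)$ for all $r>0$; ($\mathbf J_\phi$) there is a measurable kernel $J(x,y)\geq 0$ such that $(J(x,y)m(dy),t)$ is a Lévy system of $X$, i.e. $\mathbb E_x\sum_{s\le T}f(s,X_{s-},X_s)=\mathbb E_x\int_0^T\int_{\mathcal X} f(s,X_s,y)J(X_s,y)\,m(dy)\,ds$ for every $x\in\mathcal X$, every stopping time $T$ of the minimal augmented filtration of $X$ and every Borel $f\ge 0$ on $[0,\infty)\times\mathcal X\times\mathcal X$ vanishing on the diagonal of $\mathcal X\times\mathcal X$, and $$\frac{c_1}{V(x,d(x,y))\,\phi(d(x,y))}\le J(x,y)\le \frac{c_2}{V(x,d(x,y))\,\phi(d(x,y))}\quad\text{for all } x\neq y\in\mathcal X;$$ ($\mathbf{(EP)}_{\phi,r_0,\le}$) $\mathbb P_x(\tau_{B(x,r)}<t)\le C_{EP}\,t/\phi(r)$ for all $t>0$, $x\in\mathcal X$, $r\in(0,r_0)$. Then the uniform boundary Harnack principle holds with radius $R:=\frac{\mathrm{diam}(\mathcal X)}{2\lambda_0}\wedge r_0$: for every $\kappa\in(0,2)$ there is a constant $C\in(1,\infty)$ depending only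 on $\kappa$ and $C_V,\lambda_0,C_{RV},c_\phi,\beta,a,b,c_1,c_2,C_{EP}$ such that, for every proper open set $D\subset\mathcal X$, every $r\in(0,R)$, every $\xi\in\partial D$ and any two non-negative functions $h_1,h_2$ on $\mathcal X$ that vanish on $B(\xi,2r)\setminus D$ and are regular harmonic with respect to $X$ in $U:=D\cap B(\xi,2r)$ (that is, $\mathbb E_x[|h_i(X_{\tau_U})|;\tau_U<\infty]<\infty$ and $h_i(x)=\mathbb E_x[h_i(X_{\tau_U});\tau_U<\infty]$ for every $x\in U$), $$h_1(x)h_2(y)\le C\,h_1(y)h_2(x)\qquad\text{for all } x,y\in D\cap B(\xi,\kappa r).$$ -/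

import Mathlib

open MeasureTheory ProbabilityTheory Filter Topology Set
open scoped NNReal ENNReal

noncomputable section

namespace UniformBHP

/-! ### Hunt processes

The state space is a metric space `𝒳`; the cemetery `∂` is the point `∞` of the one-point
compactification `OnePoint 𝒳` (an isolated point if `𝒳` is compact). -/

instance instMeasurableSpaceOnePoint {𝒳 : Type*} [TopologicalSpace 𝒳] :
    MeasurableSpace (OnePoint 𝒳) := borel _

instance instBorelSpaceOnePoint {𝒳 : Type*} [TopologicalSpace 𝒳] :
    BorelSpace (OnePoint 𝒳) := ⟨rfl⟩

/-- `σ(X_s : s ≤ t)`. -/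
abbrev naturalSigma {𝒳 Ω : Type*} [TopologicalSpace 𝒳] (X : ℝ≥0 → Ω → OnePoint 𝒳) (t : ℝ≥0) :
    MeasurableSpace Ω :=
  ⨆ s : ℝ≥0, ⨆ _ : s ≤ t, MeasurableSpace.comap (X s) inferInstance

/-- The intersection, over all initial distributions `μ`, of the augmentations of the
σ-algebra `𝓕` by the null sets of `P_μ = ∫ P_x μ(dx)`. -/
abbrev augment {𝒳 Ω : Type*} [TopologicalSpace 𝒳] {mΩ : MeasurableSpace Ω}
    (P : Kernel (OnePoint 𝒳) Ω) (𝓕 : MeasurableSpace Ω) : MeasurableSpace Ω :=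
  ⨅ μ : ProbabilityMeasure (OnePoint 𝒳),
    eventuallyMeasurableSpace 𝓕 (ae ((μ : Measure (OnePoint 𝒳)).bind P))

theorem augment_mono {𝒳 Ω : Type*} [TopologicalSpace 𝒳] {mΩ : MeasurableSpace Ω}
    (P : Kernel (OnePoint 𝒳) Ω) {𝓕 𝓖 : MeasurableSpace Ω} (h : 𝓕 ≤ 𝓖) :
    augment P 𝓕 ≤ augment P 𝓖 := by
  refine iInf_mono fun μ s hs => ?_
  obtain ⟨t, ht, hst⟩ := hs
  exact ⟨t, h t ht, hst⟩

/-- The minimal augmented admissible filtration `(𝒢_t)` of the process. -/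
def augmentedFiltration {𝒳 Ω : Type*} [TopologicalSpace 𝒳] [MeasurableSpace Ω]
    (X : ℝ≥0 → Ω → OnePoint 𝒳) (P : Kernel (OnePoint 𝒳) Ω) :
    Filtration ℝ≥0 (augment P (⨆ t, naturalSigma X t)) where
  seq t := augment P (naturalSigma X t)
  mono' _ _ h := augment_mono P (iSup_mono fun _ => iSup_mono' fun hs => ⟨hs.trans h, le_rfl⟩)
  le' t := augment_mono P (le_iSup (naturalSigma X) t)

/-- A Hunt process on `𝒳`, realised on the sample space `Ω`. -/
structure HuntProcess (𝒳 Ω : Type*) [TopologicalSpace 𝒳] [mΩ : MeasurableSpace Ω] where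
  /-- The position `X_t` at time `t`. -/
  X : ℝ≥0 → Ω → OnePoint 𝒳
  /-- The law `P_x` of the process started at `x`; it depends measurably on `x`. -/
  P : Kernel (OnePoint 𝒳) Ω
  /-- The shift operators `θ_t`. -/
  shift : ℝ≥0 → Ω → Ω
  /-- The σ-algebra on which the laws `P_x` live is the one generated by the process.
  (Completions are taken in `augmentedFiltration`.) -/
  sigma_eq : mΩ = ⨆ t, naturalSigma X t
  isMarkovKernel : IsMarkovKernel P
  start : ∀ x : OnePoint 𝒳, ∀ᵐ ω ∂(P x), X 0 ω = x
  shift_eq : ∀ (s t : ℝ≥0) (ω : Ω), X s (shift t ω) = X (s + t) ω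
  /-- The cemetery is a trap. -/
  cemetery : ∀ (s t : ℝ≥0) (ω : Ω), s ≤ t → X s ω = OnePoint.infty → X t ω = OnePoint.infty
  /-- The paths are right continuous. -/
  right_continuous : ∀ (ω : Ω) (t : ℝ≥0), ContinuousWithinAt (fun s => X s ω) (Ici t) t
  /-- The paths have left limits in `OnePoint 𝒳`. -/
  left_limits : ∀ (ω : Ω) (t : ℝ≥0), ∃ y : OnePoint 𝒳, Tendsto (fun s => X s ω) (𝓝[<] t) (𝓝 y)
  /-- The filtration is right continuous. -/
  filtration_right_continuous : (augmentedFiltration X P).IsRightContinuous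
  /-- The strong Markov property: `E_μ[Y ∘ θ_T | 𝒢_T] = E_{X_T}[Y]` on `{T < ∞}`. -/
  strong_markov : ∀ (T : Ω → WithTop ℝ≥0) (hT : IsStoppingTime (augmentedFiltration X P) T)
    (μ : ProbabilityMeasure (OnePoint 𝒳)) (Y : Ω → ℝ≥0∞), Measurable Y →
    ∀ A : Set Ω, MeasurableSet[hT.measurableSpace] A →
      ∫⁻ ω in A ∩ {ω | T ω < ⊤}, Y (shift ((T ω).untopD 0) ω)
          ∂((μ : Measure (OnePoint 𝒳)).bind P) =
        ∫⁻ ω in A ∩ {ω | T ω < ⊤}, (∫⁻ ω', Y ω' ∂(P (X ((T ω).untopD 0) ω)))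
          ∂((μ : Measure (OnePoint 𝒳)).bind P)
  /-- Quasi-left continuity on `(0, ∞)`. -/
  quasi_left_continuous : ∀ (T : ℕ → Ω → WithTop ℝ≥0) (S : Ω → WithTop ℝ≥0),
    (∀ n, IsStoppingTime (augmentedFiltration X P) (T n)) →
    (∀ ω, Monotone fun n => T n ω) → (∀ ω, IsLUB (range fun n => T n ω) (S ω)) →
    ∀ μ : ProbabilityMeasure (OnePoint 𝒳), ∀ᵐ ω ∂((μ : Measure (OnePoint 𝒳)).bind P), S ω < ⊤ →
      Tendsto (fun n => X ((T n ω).untopD 0) ω) atTop (𝓝 (X ((S ω).untopD 0) ω))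

namespace HuntProcess

variable {𝒳 Ω : Type*} [TopologicalSpace 𝒳] [MeasurableSpace Ω]

/-- `τ_U = inf {t ≥ 0 : X_t ∉ U}`, with `inf ∅ = ∞`; the cemetery is outside every `U ⊆ 𝒳`. -/
def exitTime (Z : HuntProcess 𝒳 Ω) (U : Set 𝒳) : Ω → WithTop ℝ≥0 :=
  hittingAfter Z.X (((↑) : 𝒳 → OnePoint 𝒳) '' U)ᶜ 0

/-- `h(X_{τ_U}) 1_{τ_U < ∞}`, where `h(∂) = 0`. -/
def exitValue (Z : HuntProcess 𝒳 Ω) (h : 𝒳 → ℝ) (U : Set 𝒳) (ω : Ω) : ℝ :=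
  {ω | Z.exitTime U ω < ⊤}.indicator
    (fun ω => (Z.X ((Z.exitTime U ω).untopD 0) ω).elim 0 h) ω

/-- `h` is regular harmonic in `U` with respect to the process:
`E_x[|h(X_{τ_U})|; τ_U < ∞] < ∞` and `h(x) = E_x[h(X_{τ_U}); τ_U < ∞]` for every `x ∈ U`. -/
def IsRegularHarmonic (Z : HuntProcess 𝒳 Ω) (h : 𝒳 → ℝ) (U : Set 𝒳) : Prop :=
  ∀ x ∈ U, Integrable (Z.exitValue h U) (Z.P x) ∧ h x = ∫ ω, Z.exitValue h U ω ∂(Z.P x)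

/-- `(J(x, dy), t)` is a Lévy system: for all Borel `f ≥ 0` on `[0, ∞) × 𝒳 × 𝒳` vanishing on the
diagonal, all stopping times `T` and all `x`,
`E_x ∑_{s ≤ T} f(s, X_{s-}, X_s) = E_x ∫_0^T ∫ f(s, X_s, y) J(X_s, dy) ds`,
where `f(s, ·, ·)` is `0` as soon as one of its arguments is the cemetery. -/
def IsLevySystem [MeasurableSpace 𝒳] (Z : HuntProcess 𝒳 Ω) (J : 𝒳 → Measure 𝒳) : Prop :=
  ∀ f : ℝ≥0 → 𝒳 → 𝒳 → ℝ≥0∞, Measurable (fun p : ℝ≥0 × 𝒳 × 𝒳 => f p.1 p.2.1 p.2.2) →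
    (∀ s a, f s a a = 0) →
    ∀ T : Ω → WithTop ℝ≥0, IsStoppingTime (augmentedFiltration Z.X Z.P) T → ∀ x : 𝒳,
      ∫⁻ ω, ∑' s : {s : ℝ≥0 // (s : WithTop ℝ≥0) ≤ T ω},
          (Function.leftLim (fun t => Z.X t ω) (s : ℝ≥0)).elim 0
            (fun a => (Z.X s ω).elim 0 (fun b => f s a b)) ∂(Z.P x) =
        ∫⁻ ω, (∫⁻ s in {s : ℝ | 0 ≤ s ∧ ((s.toNNReal : ℝ≥0) : WithTop ℝ≥0) ≤ T ω},
          (Z.X s.toNNReal ω).elim 0 (fun a => ∫⁻ y, f s.toNNReal a y ∂(J a))) ∂(Z.P x)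

end HuntProcess

/-! ### Volume growth, scale functions, and the conditions on the process -/

/-- Volume doubling with constant `C`. -/
def VolumeDoubling {𝒳 : Type*} [MetricSpace 𝒳] [MeasurableSpace 𝒳] (m : Measure 𝒳)
    (C : ℝ) : Prop :=
  ∀ (x : 𝒳) (r : ℝ), 0 < r → m (Metric.ball x (2 * r)) ≤ ENNReal.ofReal C * m (Metric.ball x r)

/-- Reverse volume doubling with constants `l` and `C`. -/
def ReverseVolumeDoubling {𝒳 : Type*} [MetricSpace 𝒳] [MeasurableSpace 𝒳] (m : Measure 𝒳)
    (l C : ℝ) : Prop :=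
  ∀ (x : 𝒳) (r : ℝ), 0 < r →
    ENNReal.ofReal r ≤ Metric.ediam (univ : Set 𝒳) / ENNReal.ofReal l →
    ENNReal.ofReal C * m (Metric.ball x r) ≤ m (Metric.ball x (l * r))

/-- `φ` (only its values on `[0, ∞)` matter) is strictly increasing with `φ 0 = 0`, `φ 1 = 1`, and
`φ R / φ r ≤ c (R / r) ^ β` for `0 < r ≤ R`. -/
structure IsScaleFunction (φ : ℝ → ℝ) (c β : ℝ) : Prop where
  strictMonoOn : StrictMonoOn φ (Ici 0)
  map_zero : φ 0 = 0
  map_one : φ 1 = 1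
  doubling : ∀ r R : ℝ, 0 < r → r ≤ R → φ R / φ r ≤ c * (R / r) ^ β

/-- Reverse doubling of `φ` with constants `a` and `b`. -/
def ScaleReverseDoubling (φ : ℝ → ℝ) (a b : ℝ) : Prop :=
  ∀ r : ℝ, 0 < r → b * φ r ≤ φ (a * r)

/-- `J_φ` with constants `c₁` and `c₂`: the process has a Lévy system `(J(x, y) m(dy), t)` with
`c₁ / (V(x, d(x, y)) φ(d(x, y))) ≤ J(x, y) ≤ c₂ / (V(x, d(x, y)) φ(d(x, y)))` for `x ≠ y`. -/
def JumpKernelBounds {𝒳 Ω : Type*} [MetricSpace 𝒳] [MeasurableSpace 𝒳] [MeasurableSpace Ω]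
    (Z : HuntProcess 𝒳 Ω) (m : Measure 𝒳) (φ : ℝ → ℝ) (c₁ c₂ : ℝ) : Prop :=
  ∃ J : 𝒳 → 𝒳 → ℝ≥0∞, Measurable (fun p : 𝒳 × 𝒳 => J p.1 p.2) ∧
    Z.IsLevySystem (fun x => m.withDensity (J x)) ∧
    ∀ x y : 𝒳, x ≠ y →
      ENNReal.ofReal c₁ / (m (Metric.ball x (dist x y)) * ENNReal.ofReal (φ (dist x y))) ≤ J x y ∧
      J x y ≤ ENNReal.ofReal c₂ / (m (Metric.ball x (dist x y)) * ENNReal.ofReal (φ (dist x y)))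

/-- `(EP)_{φ, r₀, ≤}` with constant `C`: `P_x(τ_{B(x, r)} < t) ≤ C t / φ(r)` for all `t > 0`,
`x ∈ 𝒳` and `r ∈ (0, r₀)`. -/
def ExitProbabilityBound {𝒳 Ω : Type*} [MetricSpace 𝒳] [MeasurableSpace Ω]
    (Z : HuntProcess 𝒳 Ω) (φ : ℝ → ℝ) (r₀ : ℝ≥0∞) (C : ℝ) : Prop :=
  ∀ (t : ℝ≥0) (x : 𝒳) (r : ℝ), 0 < t → 0 < r → ENNReal.ofReal r < r₀ →
    Z.P x {ω | Z.exitTime (Metric.ball x r) ω < (t : WithTop ℝ≥0)} ≤ ENNReal.ofReal (C * t / φ r)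

/-- `h` is universally measurable (in particular every Borel or nearly Borel function is). -/
def UniversallyMeasurable {𝒳 : Type*} [MeasurableSpace 𝒳] (h : 𝒳 → ℝ) : Prop :=
  ∀ (ν : Measure 𝒳) [IsFiniteMeasure ν], AEMeasurable h ν

end UniformBHP

end

noncomputable section

namespace UniformBHP

/-! ### Topology of the one-point compactification -/

theorem secondCountableTopology_onePoint (𝒳 : Type*) [TopologicalSpace 𝒳] [T2Space 𝒳]
    [LocallyCompactSpace 𝒳] [SecondCountableTopology 𝒳] :
    SecondCountableTopology (OnePoint 𝒳) := by
  let K : CompactExhaustion 𝒳 := default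
  let B : Set (Set (OnePoint 𝒳)) :=
    ((fun s : Set 𝒳 => ((↑) '' s : Set (OnePoint 𝒳))) '' TopologicalSpace.countableBasis 𝒳) ∪
      range fun n => (((↑) '' K n : Set (OnePoint 𝒳)))ᶜ
  have hB : TopologicalSpace.IsTopologicalBasis B := by
    refine TopologicalSpace.isTopologicalBasis_of_isOpen_of_nhds ?_ ?_
    · rintro u (⟨s, hs, rfl⟩ | ⟨n, rfl⟩)
      · exact OnePoint.isOpen_image_coe.2 (TopologicalSpace.isOpen_of_mem_countableBasis hs)
      · exact OnePoint.isOpen_compl_image_coe.2 ⟨(K.isCompact n).isClosed, K.isCompact n⟩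
    · intro x u hx hu
      induction x using OnePoint.rec with
      | infty =>
        have hc := (OnePoint.isOpen_iff_of_mem hx).1 hu
        obtain ⟨n, hn⟩ := K.exists_superset_of_isCompact hc.2
        refine ⟨_, Or.inr ⟨n, rfl⟩, by simp, ?_⟩
        intro y hy
        induction y using OnePoint.rec with
        | infty => exact hx
        | coe y =>
          by_contra hyu
          exact hy ⟨y, hn hyu, rfl⟩
      | coe x =>
        have hu' : IsOpen ((↑) ⁻¹' u : Set 𝒳) := hu.preimage OnePoint.continuous_coe
        obtain ⟨s, hs, hxs, hsu⟩ :=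
          (TopologicalSpace.isBasis_countableBasis 𝒳).exists_subset_of_mem_open
            (show x ∈ ((↑) ⁻¹' u : Set 𝒳) from hx) hu'
        exact ⟨_, Or.inl ⟨s, hs, rfl⟩, ⟨x, hxs, rfl⟩, image_subset_iff.2 hsu⟩
  exact hB.secondCountableTopology
    (((TopologicalSpace.countable_countableBasis 𝒳).image _).union (countable_range _))

theorem metrizableSpace_onePoint (𝒳 : Type*) [TopologicalSpace 𝒳] [T2Space 𝒳]
    [LocallyCompactSpace 𝒳] [SecondCountableTopology 𝒳] :
    TopologicalSpace.MetrizableSpace (OnePoint 𝒳) :=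
  haveI := secondCountableTopology_onePoint 𝒳
  TopologicalSpace.metrizableSpace_of_t3_secondCountable _

/-- A closed set in a metrizable space is the intersection of the closures of a decreasing sequence
of open neighbourhoods. -/
theorem exists_antitone_open_nhds {E : Type*} [TopologicalSpace E]
    [TopologicalSpace.MetrizableSpace E] {F : Set E} (hF : IsClosed F) :
    ∃ G : ℕ → Set E, (∀ n, IsOpen (G n)) ∧ Antitone G ∧ (∀ n, F ⊆ G n) ∧
      (⋂ n, closure (G n)) ⊆ F := by
  let := TopologicalSpace.metrizableSpaceMetric E
  refine ⟨fun n => Metric.thickening (1 / ((n : ℝ) + 1)) F, fun n => Metric.isOpen_thickening,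
    fun i j hij => Metric.thickening_mono (Nat.one_div_le_one_div hij) _,
    fun n => Metric.self_subset_thickening Nat.one_div_pos_of_nat _, fun x hx => ?_⟩
  have h : x ∈ ⋂ δ ∈ {δ : ℝ | ∃ n : ℕ, δ = 1 / ((n : ℝ) + 1)}, Metric.cthickening δ F := by
    simp only [mem_iInter]
    rintro δ ⟨n, rfl⟩
    exact Metric.closure_thickening_subset_cthickening _ _ (mem_iInter.1 hx n)
  rw [← hF.closure_eq, Metric.closure_eq_iInter_cthickening' F
    {δ : ℝ | ∃ n : ℕ, δ = 1 / ((n : ℝ) + 1)}]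
  · exact h
  · intro ε hε
    obtain ⟨n, hn⟩ := exists_nat_one_div_lt hε
    exact ⟨_, ⟨n, rfl⟩, Nat.one_div_pos_of_nat, hn.le⟩

/-! ### Measurability of hitting times -/

namespace HuntProcess

variable {𝒳 Ω : Type*} [TopologicalSpace 𝒳] [mΩ : MeasurableSpace Ω] (Z : HuntProcess 𝒳 Ω)

theorem measurable_X (t : ℝ≥0) : Measurable (Z.X t) := by
  have h : MeasurableSpace.comap (Z.X t) inferInstance ≤ mΩ := by
    refine le_trans ?_ (le_of_eq Z.sigma_eq.symm)
    exact le_iSup_of_le t (le_iSup₂_of_le t le_rfl le_rfl)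
  exact measurable_iff_comap_le.2 h

theorem measurableSet_preimage_X {s t : ℝ≥0} (hst : s ≤ t) {G : Set (OnePoint 𝒳)}
    (hG : MeasurableSet G) : MeasurableSet[naturalSigma Z.X t] (Z.X s ⁻¹' G) := by
  have h : MeasurableSpace.comap (Z.X s) inferInstance ≤ naturalSigma Z.X t :=
    le_iSup₂_of_le s hst le_rfl
  exact h _ ⟨G, hG, rfl⟩

theorem naturalSigma_le_augmentedFiltration (t : ℝ≥0) :
    naturalSigma Z.X t ≤ augmentedFiltration Z.X Z.P t :=
  le_iInf fun _ => le_eventuallyMeasurableSpace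

/-- Before the hitting time of an open set, a right continuous path can be observed at countably
many times. -/
theorem hittingAfter_open_lt_iff {G : Set (OnePoint 𝒳)} (hG : IsOpen G) {D : Set ℝ≥0}
    (hD : Dense D) (ω : Ω) (t : ℝ≥0) :
    hittingAfter Z.X G 0 ω < t ↔ ∃ q ∈ D, q < t ∧ Z.X q ω ∈ G := by
  rw [hittingAfter_lt_iff]
  constructor
  · rintro ⟨j, hj, hjG⟩
    have h1 : ∀ᶠ s in 𝓝[≥] j, Z.X s ω ∈ G := (Z.right_continuous ω j) (hG.mem_nhds hjG)
    have h2 : ∀ᶠ s in 𝓝[>] j, Z.X s ω ∈ G := h1.filter_mono (nhdsWithin_mono _ Ioi_subset_Ici_self)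
    have h3 : ∀ᶠ s in 𝓝[>] j, s < t :=
      nhdsWithin_le_nhds (Iio_mem_nhds (show j < t by exact_mod_cast hj.2))
    obtain ⟨u, hju, hu⟩ := mem_nhdsGT_iff_exists_Ioo_subset.1 (h2.and h3)
    obtain ⟨q, hqD, hq⟩ := hD.exists_mem_open isOpen_Ioo (nonempty_Ioo.2 hju)
    exact ⟨q, hqD, (hu hq).2, (hu hq).1⟩
  · rintro ⟨q, -, hqt, hq⟩
    exact ⟨q, ⟨zero_le, by exact_mod_cast hqt⟩, hq⟩

theorem measurableSet_hittingAfter_open_lt {G : Set (OnePoint 𝒳)} (hG : IsOpen G) (t : ℝ≥0) :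
    MeasurableSet[naturalSigma Z.X t] {ω | hittingAfter Z.X G 0 ω < t} := by
  obtain ⟨D, hDc, hD⟩ := TopologicalSpace.exists_countable_dense ℝ≥0
  have : {ω | hittingAfter Z.X G 0 ω < t} = ⋃ q ∈ {q ∈ D | q < t}, Z.X q ⁻¹' G := by
    ext ω
    simp only [mem_ofPred_eq, mem_iUnion, mem_preimage, exists_prop]
    rw [Z.hittingAfter_open_lt_iff hG hD]
    simp only [and_assoc]
  rw [this]
  exact MeasurableSet.biUnion (hDc.mono fun q hq => hq.1)
    fun q hq => Z.measurableSet_preimage_X hq.2.le hG.measurableSet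

theorem isStoppingTime_hittingAfter_open {G : Set (OnePoint 𝒳)} (hG : IsOpen G) :
    IsStoppingTime (augmentedFiltration Z.X Z.P) (hittingAfter Z.X G 0) := by
  have := Z.filtration_right_continuous
  exact isStoppingTime_of_measurableSet_lt_of_isRightContinuous fun t =>
    Z.naturalSigma_le_augmentedFiltration t _ (Z.measurableSet_hittingAfter_open_lt hG t)

theorem naturalSigma_le (t : ℝ≥0) : naturalSigma Z.X t ≤ mΩ := by
  refine le_trans ?_ (le_of_eq Z.sigma_eq.symm)
  exact le_iSup (naturalSigma Z.X) t

theorem measurable_withTop_of_lt {T : Ω → WithTop ℝ≥0}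
    (h : ∀ t : ℝ≥0, MeasurableSet {ω | T ω < t}) : Measurable T := by
  refine measurable_of_Iio fun a => ?_
  induction a using WithTop.recTopCoe with
  | coe a => exact h a
  | top =>
    have : T ⁻¹' Iio ⊤ = ⋃ n : ℕ, {ω | T ω < ((n : ℝ≥0) : WithTop ℝ≥0)} := by
      ext ω
      simp only [mem_preimage, mem_Iio, mem_iUnion, mem_ofPred_eq]
      constructor
      · intro hω
        obtain ⟨a, ha⟩ := WithTop.ne_top_iff_exists.1 hω.ne
        obtain ⟨n, hn⟩ := exists_nat_gt a
        exact ⟨n, by rw [← ha]; exact_mod_cast hn⟩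
      · rintro ⟨n, hn⟩
        exact hn.trans (WithTop.coe_lt_top _)
    rw [this]
    exact MeasurableSet.iUnion fun n => h n

theorem measurable_hittingAfter_open {G : Set (OnePoint 𝒳)} (hG : IsOpen G) :
    Measurable (hittingAfter Z.X G 0) :=
  measurable_withTop_of_lt fun t =>
    Z.naturalSigma_le t _ (Z.measurableSet_hittingAfter_open_lt hG t)

/-- The position at the hitting time of a set lies in its closure. -/
theorem X_hittingAfter_mem_closure {G : Set (OnePoint 𝒳)} {ω : Ω}
    (h : hittingAfter Z.X G 0 ω < ⊤) :
    Z.X ((hittingAfter Z.X G 0 ω).untopD 0) ω ∈ closure G := by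
  obtain ⟨a, ha⟩ := WithTop.ne_top_iff_exists.1 h.ne
  rw [← ha, WithTop.untopD_coe]
  rw [mem_closure_iff_frequently]
  have hr : Tendsto (fun s => Z.X s ω) (𝓝[≥] a) (𝓝 (Z.X a ω)) := Z.right_continuous ω a
  refine hr.frequently ?_
  intro hev
  obtain ⟨u, hau, hu⟩ := mem_nhdsGE_iff_exists_Ico_subset.1 hev
  have hlt : hittingAfter Z.X G 0 ω < (u : WithTop ℝ≥0) := by
    rw [← ha]; exact_mod_cast hau
  obtain ⟨j, hj, hjG⟩ := hittingAfter_lt_iff.1 hlt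
  have haj : a ≤ j := by
    have := hittingAfter_le_of_mem (u := Z.X) (n := 0) (zero_le (a := j)) hjG
    rw [← ha] at this
    exact_mod_cast this
  exact hu ⟨haj, hj.2⟩ hjG

theorem measurable_X_countable (c : ℕ → ℝ≥0) {k : ℝ≥0 → ℕ} (hk : Measurable k) :
    Measurable fun p : ℝ≥0 × Ω => Z.X (c (k p.1)) p.2 := by
  have h1 : Measurable fun q : ℕ × Ω => Z.X (c q.1) q.2 :=
    measurable_from_prod_countable_right fun k => Z.measurable_X (c k)
  have h3 : Measurable fun p : ℝ≥0 × Ω => (k p.1, p.2) :=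
    (hk.comp measurable_fst).prodMk measurable_snd
  exact h1.comp h3

theorem measurable_uncurry_X [TopologicalSpace.PseudoMetrizableSpace (OnePoint 𝒳)] :
    Measurable fun p : ℝ≥0 × Ω => Z.X p.1 p.2 := by
  let c : ℕ → ℕ → ℝ≥0 := fun n k => ((k : ℝ≥0) + 1) / ((n : ℝ≥0) + 1)
  let fl : ℕ → ℝ≥0 → ℕ := fun n t => ⌊t * ((n : ℝ≥0) + 1)⌋₊
  let a : ℕ → ℝ≥0 → ℝ≥0 := fun n t => c n (fl n t)
  have ha : ∀ t, Tendsto (fun n => a n t) atTop (𝓝[≥] t) := by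
    intro t
    have hpos : ∀ n : ℕ, (0 : ℝ≥0) < (n : ℝ≥0) + 1 := fun n => by positivity
    have hge : ∀ n, t ≤ a n t := fun n => by
      rw [le_div_iff₀ (hpos n)]
      exact (Nat.lt_floor_add_one _).le
    refine tendsto_nhdsWithin_iff.2 ⟨?_, Eventually.of_forall hge⟩
    have hle : ∀ n, a n t ≤ t + 1 / ((n : ℝ≥0) + 1) := fun n => by
      have : (⌊t * (n + 1)⌋₊ : ℝ≥0) ≤ t * (n + 1) := Nat.floor_le zero_le
      rw [show t + 1 / ((n : ℝ≥0) + 1) = (t * (n + 1) + 1) / (n + 1) by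
        rw [add_div, mul_div_cancel_right₀ _ (hpos n).ne']]
      exact div_le_div_of_nonneg_right (add_le_add_left this 1) zero_le
    have h1 : Tendsto (fun n : ℕ => t + 1 / ((n : ℝ≥0) + 1)) atTop (𝓝 (t + 0)) :=
      tendsto_const_nhds.add tendsto_one_div_add_atTop_nhds_zero_nat
    rw [add_zero] at h1
    exact tendsto_of_tendsto_of_tendsto_of_le_of_le tendsto_const_nhds h1 hge hle
  refine measurable_of_tendsto_metrizable (f := fun n (p : ℝ≥0 × Ω) => Z.X (a n p.1) p.2) ?_ ?_
  · intro n
    have h2 : Measurable (fl n) := Nat.measurable_floor.comp (measurable_id.mul_const _)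
    exact Z.measurable_X_countable (c n) h2
  · rw [tendsto_pi_nhds]
    intro p
    exact (Z.right_continuous p.2 p.1).tendsto.comp (ha p.1)

theorem measurable_X_comp [TopologicalSpace.PseudoMetrizableSpace (OnePoint 𝒳)]
    {T : Ω → WithTop ℝ≥0} (hT : Measurable T) :
    Measurable fun ω => Z.X ((T ω).untopD 0) ω :=
  Z.measurable_uncurry_X.comp (hT.untopD 0 |>.prodMk measurable_id)

theorem dirac_bind (x : OnePoint 𝒳) : (Measure.dirac x).bind Z.P = Z.P x :=
  Measure.dirac_bind Z.P.measurable x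

/-- The hitting time of a closed set agrees, off a measurable set which is null for every starting
distribution, with a measurable stopping time; off that set the process is in the closed set at the
hitting time, and the closed set has been hit whenever it contains a left limit of the path. -/
theorem exists_hittingAfter_closed [TopologicalSpace.MetrizableSpace (OnePoint 𝒳)]
    {F : Set (OnePoint 𝒳)} (hF : IsClosed F) :
    ∃ (S : Ω → WithTop ℝ≥0) (N : Set Ω), Measurable S ∧
      IsStoppingTime (augmentedFiltration Z.X Z.P) S ∧ MeasurableSet N ∧
      (∀ x, Z.P x N = 0) ∧ (∀ ω ∉ N, hittingAfter Z.X F 0 ω = S ω) ∧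
      (∀ ω ∉ N, S ω < ⊤ → Z.X ((S ω).untopD 0) ω ∈ F) ∧
      (∀ ω ∉ N, ∀ (t : ℝ≥0), 0 < t → ∀ y ∈ F, Tendsto (fun s => Z.X s ω) (𝓝[<] t) (𝓝 y) →
        S ω ≤ t) := by
  obtain ⟨G, hGo, hGa, hFG, hGF⟩ := exists_antitone_open_nhds hF
  let T : ℕ → Ω → WithTop ℝ≥0 := fun n => hittingAfter Z.X (G n) 0
  let S : Ω → WithTop ℝ≥0 := fun ω => ⨆ n, T n ω
  have hTS : ∀ n ω, T n ω ≤ S ω := fun n ω => le_iSup (fun n => T n ω) n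
  have hTmono : ∀ ω, Monotone fun n => T n ω := fun ω i j hij =>
    hittingAfter_apply_anti Z.X 0 ω (hGa hij)
  have hS : Measurable S := Measurable.iSup fun n => Z.measurable_hittingAfter_open (hGo n)
  have hSst : IsStoppingTime (augmentedFiltration Z.X Z.P) S := by
    intro t
    have : {ω | S ω ≤ t} = ⋂ n, {ω | T n ω ≤ t} := by
      ext ω; simp only [mem_ofPred_eq, mem_iInter]; exact iSup_le_iff
    rw [this]
    exact MeasurableSet.iInter fun n => Z.isStoppingTime_hittingAfter_open (hGo n) t
  have hXS := Z.measurable_X_comp hS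
  let N : Set Ω := {ω | S ω < ⊤} ∩ {ω | Z.X ((S ω).untopD 0) ω ∈ F}ᶜ
  have hSle : ∀ ω, S ω ≤ hittingAfter Z.X F 0 ω := fun ω =>
    iSup_le fun n => hittingAfter_apply_anti Z.X 0 ω (hFG n)
  have hN : ∀ ω ∉ N, S ω < ⊤ → Z.X ((S ω).untopD 0) ω ∈ F := by
    intro ω hω h
    by_contra hc
    exact hω ⟨h, hc⟩
  refine ⟨S, N, hS, hSst, (hS measurableSet_Iio).inter (hXS hF.measurableSet).compl, ?_, ?_, hN, ?_⟩
  · intro x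
    have hq := Z.quasi_left_continuous T S (fun n => Z.isStoppingTime_hittingAfter_open (hGo n))
      hTmono (fun ω => isLUB_iSup) ⟨Measure.dirac x, inferInstance⟩
    simp only [ProbabilityMeasure.coe_mk, dirac_bind] at hq
    refine measure_mono_null ?_ (ae_iff.1 hq)
    rintro ω ⟨h1, h2⟩ h3
    refine h2 (hGF (mem_iInter.2 fun m => ?_))
    refine isClosed_closure.mem_of_tendsto (h3 h1) ?_
    filter_upwards [eventually_ge_atTop m] with n hn
    exact closure_mono (hGa hn) (Z.X_hittingAfter_mem_closure ((hTS n ω).trans_lt h1))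
  · intro ω hω
    refine le_antisymm ?_ (hSle ω)
    by_cases h : S ω < ⊤
    · obtain ⟨s, hs⟩ := WithTop.ne_top_iff_exists.1 h.ne
      have := hN ω hω h
      rw [← hs, WithTop.untopD_coe] at this
      rw [← hs]
      exact hittingAfter_le_of_mem zero_le this
    · rw [not_lt_top_iff.1 h]; exact le_top
  · intro ω _ t ht y hy hlim
    refine iSup_le fun n => ?_
    have : (𝓝[<] t).NeBot := nhdsLT_neBot_of_exists_lt ⟨0, ht⟩
    obtain ⟨s, hsG, hst⟩ := ((hlim.eventually ((hGo n).mem_nhds (hFG n hy))).and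
      (self_mem_nhdsWithin : Iio t ∈ 𝓝[<] t)).exists
    exact (hittingAfter_le_of_mem zero_le hsG).trans (by exact_mod_cast (show s ≤ t from le_of_lt hst))

end HuntProcess

instance instMetrizableSpaceOnePoint (𝒳 : Type*) [TopologicalSpace 𝒳] [T2Space 𝒳]
    [LocallyCompactSpace 𝒳] [SecondCountableTopology 𝒳] :
    TopologicalSpace.MetrizableSpace (OnePoint 𝒳) := metrizableSpace_onePoint 𝒳

theorem measurableEmbedding_coe_onePoint (𝒳 : Type*) [TopologicalSpace 𝒳] [MeasurableSpace 𝒳]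
    [BorelSpace 𝒳] : MeasurableEmbedding ((↑) : 𝒳 → OnePoint 𝒳) :=
  OnePoint.isOpenEmbedding_coe.measurableEmbedding

theorem measurable_onePoint_elim {𝒳 : Type*} [TopologicalSpace 𝒳] [MeasurableSpace 𝒳]
    [BorelSpace 𝒳] {g : 𝒳 → ℝ≥0∞} (hg : Measurable g) :
    Measurable fun y : OnePoint 𝒳 => y.elim 0 g := by
  have h : (fun y : OnePoint 𝒳 => y.elim 0 g) =
      Function.extend ((↑) : 𝒳 → OnePoint 𝒳) g fun _ => 0 := by
    ext y
    induction y using OnePoint.rec with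
    | infty => rw [Function.extend_apply' _ _ _ (by simp)]; rfl
    | coe y => rw [OnePoint.coe_injective.extend_apply]; rfl
  rw [h]
  exact (measurableEmbedding_coe_onePoint 𝒳).measurable_extend hg measurable_const

/-- The value of a random time in `[0, ∞]`. -/
def duration (T : WithTop ℝ≥0) : ℝ≥0∞ := 
  WithTop.recTopCoe (C := fun _ : WithTop ℝ≥0 => ℝ≥0∞) ⊤ (fun a : ℝ≥0 => (a : ℝ≥0∞)) T

@[simp] theorem duration_top : duration ⊤ = ⊤ := rfl

@[simp] theorem duration_coe (a : ℝ≥0) : duration a = a := rfl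

theorem duration_mono : Monotone duration := by
  intro a b hab
  induction b using WithTop.recTopCoe with
  | top => exact le_top
  | coe b =>
    induction a using WithTop.recTopCoe with
    | top => exact absurd hab (WithTop.not_top_le_coe b)
    | coe a => exact ENNReal.coe_le_coe.2 (WithTop.coe_le_coe.1 hab)

theorem duration_add_coe (a : ℝ≥0) (T : WithTop ℝ≥0) :
    duration (a + T) = a + duration T := by
  induction T using WithTop.recTopCoe with
  | top => rw [WithTop.add_top, duration_top, add_top]
  | coe b => rw [← WithTop.coe_add, duration_coe, duration_coe, ENNReal.coe_add]

theorem measurable_duration : Measurable duration := duration_mono.measurable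

theorem withTop_eq_of_forall_lt_coe_iff {a b : WithTop ℝ≥0}
    (h : ∀ i : ℝ≥0, a < i ↔ b < i) : a = b := by
  have key : ∀ {a b : WithTop ℝ≥0}, (∀ i : ℝ≥0, a < i → b < i) → b ≤ a := by
    intro a b h
    by_contra! hlt
    obtain ⟨a', ha'⟩ := WithTop.ne_top_iff_exists.1 hlt.ne_top
    induction b using WithTop.recTopCoe with
    | top => exact absurd (h (a' + 1) (by rw [← ha']; exact_mod_cast lt_add_one a')) (by simp)
    | coe b => exact lt_irrefl _ (h b hlt)
  exact le_antisymm (key fun i => (h i).2) (key fun i => (h i).1)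

namespace HuntProcess

variable {𝒳 Ω : Type*} [TopologicalSpace 𝒳] [mΩ : MeasurableSpace Ω] (Z : HuntProcess 𝒳 Ω)

open scoped Classical in
/-- The position at the exit time of `U`, understood as the cemetery if `U` is never left. -/
def exitPos (U : Set 𝒳) (ω : Ω) : OnePoint 𝒳 :=
  if Z.exitTime U ω < ⊤ then Z.X ((Z.exitTime U ω).untopD 0) ω else OnePoint.infty

theorem exitPos_of_lt {U : Set 𝒳} {ω : Ω} (h : Z.exitTime U ω < ⊤) :
    Z.exitPos U ω = Z.X ((Z.exitTime U ω).untopD 0) ω :=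
  if_pos h

theorem exitPos_of_eq_coe {U : Set 𝒳} {ω : Ω} {a : ℝ≥0} (h : Z.exitTime U ω = a) :
    Z.exitPos U ω = Z.X a ω := by
  rw [exitPos_of_lt Z (by rw [h]; exact WithTop.coe_lt_top a), h, WithTop.untopD_coe]

theorem exitPos_of_eq_top {U : Set 𝒳} {ω : Ω} (h : Z.exitTime U ω = ⊤) :
    Z.exitPos U ω = OnePoint.infty :=
  if_neg (by simp [h])

theorem isClosed_compl_image_coe {U : Set 𝒳} (hU : IsOpen U) :
    IsClosed (((↑) : 𝒳 → OnePoint 𝒳) '' U)ᶜ :=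
  (OnePoint.isOpen_image_coe.2 hU).isClosed_compl

theorem exitTime_mono {W V : Set 𝒳} (h : W ⊆ V) (ω : Ω) : Z.exitTime W ω ≤ Z.exitTime V ω :=
  hittingAfter_apply_anti Z.X 0 ω (compl_subset_compl.2 (image_mono h))

theorem X_mem_of_lt_exitTime {U : Set 𝒳} {ω : Ω} {s : ℝ≥0} (h : (s : WithTop ℝ≥0) < Z.exitTime U ω) :
    Z.X s ω ∈ ((↑) : 𝒳 → OnePoint 𝒳) '' U := by
  by_contra hc
  exact notMem_of_lt_hittingAfter h zero_le hc

theorem exitTime_eq_zero {U : Set 𝒳} {ω : Ω} (h : Z.X 0 ω ∉ ((↑) : 𝒳 → OnePoint 𝒳) '' U) :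
    Z.exitTime U ω = (0 : ℝ≥0) :=
  le_antisymm (hittingAfter_le_of_mem le_rfl h) (le_hittingAfter ω)

/-- The exit time of a larger set, after the exit from a smaller one. -/
theorem exitTime_shift {W V : Set 𝒳} (hWV : W ⊆ V) {ω : Ω} {s : ℝ≥0} (hs : Z.exitTime W ω = s) :
    Z.exitTime V ω = s + Z.exitTime V (Z.shift s ω) := by
  refine withTop_eq_of_forall_lt_coe_iff fun i => ?_
  constructor
  · intro h
    obtain ⟨j, hj, hjV⟩ := hittingAfter_lt_iff.1 h
    have hsj : s ≤ j := by
      by_contra! hlt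
      have := Z.X_mem_of_lt_exitTime (U := W) (ω := ω) (s := j) (by rw [hs]; exact_mod_cast hlt)
      exact hjV (image_mono hWV this)
    have h1 : Z.exitTime V (Z.shift s ω) ≤ ((j - s : ℝ≥0) : WithTop ℝ≥0) := by
      refine hittingAfter_le_of_mem zero_le ?_
      rw [Z.shift_eq, tsub_add_cancel_of_le hsj]
      exact hjV
    calc (s : WithTop ℝ≥0) + Z.exitTime V (Z.shift s ω) ≤ s + ((j - s : ℝ≥0) : WithTop ℝ≥0) := by
          gcongr
      _ = (j : WithTop ℝ≥0) := by rw [← WithTop.coe_add, add_tsub_cancel_of_le hsj]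
      _ < i := by exact_mod_cast hj.2
  · intro h
    have hne : Z.exitTime V (Z.shift s ω) ≠ ⊤ := by
      intro h'
      rw [h', WithTop.add_top] at h
      exact not_top_lt h
    obtain ⟨a, ha⟩ := WithTop.ne_top_iff_exists.1 hne
    rw [← ha, ← WithTop.coe_add, WithTop.coe_lt_coe] at h
    have h1 : Z.exitTime V (Z.shift s ω) < ((i - s : ℝ≥0) : WithTop ℝ≥0) := by
      rw [← ha, WithTop.coe_lt_coe, lt_tsub_iff_left]; exact h
    obtain ⟨j, hj, hjV⟩ := hittingAfter_lt_iff.1 h1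
    rw [Z.shift_eq] at hjV
    refine hittingAfter_lt_iff.2 ⟨j + s, ⟨zero_le, ?_⟩, hjV⟩
    exact lt_tsub_iff_right.1 hj.2

theorem exitPos_shift {W V : Set 𝒳} (hWV : W ⊆ V) {ω : Ω} {s : ℝ≥0} (hs : Z.exitTime W ω = s) :
    Z.exitPos V ω = Z.exitPos V (Z.shift s ω) := by
  have h := Z.exitTime_shift hWV hs
  by_cases htop : Z.exitTime V (Z.shift s ω) = ⊤
  · rw [Z.exitPos_of_eq_top htop, Z.exitPos_of_eq_top (by rw [h, htop, WithTop.add_top])]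
  · obtain ⟨a, ha⟩ := WithTop.ne_top_iff_exists.1 htop
    rw [← ha, ← WithTop.coe_add] at h
    rw [Z.exitPos_of_eq_coe ha.symm, Z.exitPos_of_eq_coe h, Z.shift_eq, add_comm]

/-- The mean exit time from `U`, for the process started at `x`. -/
def meanExit (U : Set 𝒳) (x : 𝒳) : ℝ≥0∞ := ∫⁻ ω, duration (Z.exitTime U ω) ∂(Z.P x)

theorem meanExit_mono {W V : Set 𝒳} (h : W ⊆ V) (x : 𝒳) : Z.meanExit W x ≤ Z.meanExit V x :=
  lintegral_mono fun ω => duration_mono (Z.exitTime_mono h ω)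

theorem P_bind_null {N : Set Ω} (hNm : MeasurableSet N) (hN : ∀ x, Z.P x N = 0)
    (μ : Measure (OnePoint 𝒳)) : μ.bind Z.P N = 0 := by
  rw [Measure.bind_apply hNm Z.P.measurable.aemeasurable]
  simp [hN]

theorem ae_exitTime_infty (V : Set 𝒳) : ∀ᵐ ω ∂(Z.P OnePoint.infty),
    Z.exitTime V ω = (0 : ℝ≥0) ∧ Z.exitPos V ω = OnePoint.infty := by
  filter_upwards [Z.start OnePoint.infty] with ω hω
  have h := Z.exitTime_eq_zero (U := V) (ω := ω) (by rw [hω]; simp)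
  exact ⟨h, by rw [Z.exitPos_of_eq_coe h, hω]⟩

section Measurability

variable [T2Space 𝒳] [LocallyCompactSpace 𝒳] [SecondCountableTopology 𝒳]

theorem isStoppingTime_exitTime {U : Set 𝒳} (hU : IsOpen U) :
    IsStoppingTime (augmentedFiltration Z.X Z.P) (Z.exitTime U) := by
  obtain ⟨S, N, -, hSst, hNm, hN, hSeq, -⟩ := Z.exists_hittingAfter_closed
    (isClosed_compl_image_coe hU)
  intro t
  have h := hSst t
  refine MeasurableSpace.measurableSet_iInf.2 fun μ => ?_
  have hμ := MeasurableSpace.measurableSet_iInf.1 h μ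
  refine EventuallyMeasurableSet.congr hμ ?_
  have hae : ∀ᵐ ω ∂((μ : Measure (OnePoint 𝒳)).bind Z.P), ω ∉ N :=
    measure_eq_zero_iff_ae_notMem.1 (Z.P_bind_null hNm hN μ)
  filter_upwards [hae] with ω hω
  change (Z.exitTime U ω ≤ t) = (S ω ≤ t)
  rw [← hSeq ω hω]; rfl

/-- The exit position has a measurable version. -/
theorem exists_exitPos_version {U : Set 𝒳} (hU : IsOpen U) :
    ∃ (S : Ω → WithTop ℝ≥0) (Y : Ω → OnePoint 𝒳) (N : Set Ω), Measurable S ∧ Measurable Y ∧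
      MeasurableSet N ∧ (∀ x, Z.P x N = 0) ∧ (∀ ω ∉ N, Z.exitTime U ω = S ω) ∧
      (∀ ω ∉ N, Z.exitPos U ω = Y ω) ∧
      (∀ ω ∉ N, Z.exitPos U ω ∉ ((↑) : 𝒳 → OnePoint 𝒳) '' U) := by
  classical
  obtain ⟨S, N, hS, -, hNm, hN, hSeq, hmem, -⟩ := Z.exists_hittingAfter_closed
    (isClosed_compl_image_coe hU)
  refine ⟨S, {ω | S ω < ⊤}.piecewise (fun ω => Z.X ((S ω).untopD 0) ω)
    (fun _ => OnePoint.infty), N, hS,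
    Measurable.piecewise (hS measurableSet_Iio) (Z.measurable_X_comp hS) measurable_const,
    hNm, hN, hSeq, fun ω hω => ?_, fun ω hω => ?_⟩
  · have h : Z.exitTime U ω = S ω := hSeq ω hω
    by_cases hlt : S ω < ⊤
    · rw [Z.exitPos_of_lt (by rw [h]; exact hlt), Set.piecewise_eq_of_mem _ _ _ (show ω ∈ {ω | S ω < ⊤} from hlt), h]
    · rw [Z.exitPos_of_eq_top (by rw [h]; exact not_lt_top_iff.1 hlt),
        Set.piecewise_eq_of_notMem _ _ _ (show ω ∉ {ω | S ω < ⊤} from hlt)]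
  · have h : Z.exitTime U ω = S ω := hSeq ω hω
    by_cases hlt : S ω < ⊤
    · rw [Z.exitPos_of_lt (by rw [h]; exact hlt), h]
      exact hmem ω hω hlt
    · rw [Z.exitPos_of_eq_top (by rw [h]; exact not_lt_top_iff.1 hlt)]
      simp

theorem aemeasurable_exitPos {U : Set 𝒳} (hU : IsOpen U) (x : OnePoint 𝒳) :
    AEMeasurable (Z.exitPos U) (Z.P x) := by
  obtain ⟨S, Y, N, -, hY, -, hN, -, hYeq, -⟩ := Z.exists_exitPos_version hU
  refine ⟨Y, hY, ?_⟩
  filter_upwards [measure_eq_zero_iff_ae_notMem.1 (hN x)] with ω hω using hYeq ω hω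

theorem aemeasurable_exitTime {U : Set 𝒳} (hU : IsOpen U) (x : OnePoint 𝒳) :
    AEMeasurable (Z.exitTime U) (Z.P x) := by
  obtain ⟨S, Y, N, hS, -, -, hN, hSeq, -⟩ := Z.exists_exitPos_version hU
  refine ⟨S, hS, ?_⟩
  filter_upwards [measure_eq_zero_iff_ae_notMem.1 (hN x)] with ω hω using hSeq ω hω

end Measurability

variable [MeasurableSpace 𝒳]

/-- The law of the position at the exit from `U`, for the process started at `x`, on the event
that `U` is left alive. -/
def exitLaw (U : Set 𝒳) (x : 𝒳) : Measure 𝒳 :=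
  ((Z.P x).map (Z.exitPos U)).comap ((↑) : 𝒳 → OnePoint 𝒳)

variable [T2Space 𝒳] [LocallyCompactSpace 𝒳] [SecondCountableTopology 𝒳] [BorelSpace 𝒳]

theorem exitLaw_apply {U : Set 𝒳} (hU : IsOpen U) (x : 𝒳) {s : Set 𝒳} (hs : MeasurableSet s) :
    Z.exitLaw U x s = Z.P x {ω | Z.exitPos U ω ∈ ((↑) : 𝒳 → OnePoint 𝒳) '' s} := by
  have he := measurableEmbedding_coe_onePoint 𝒳
  rw [exitLaw, he.comap_apply,
    Measure.map_apply_of_aemeasurable (Z.aemeasurable_exitPos hU x) (he.measurableSet_image.2 hs)]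
  rfl

theorem lintegral_exitLaw {U : Set 𝒳} (hU : IsOpen U) (x : 𝒳) {g : 𝒳 → ℝ≥0∞} (hg : Measurable g) :
    ∫⁻ y, g y ∂(Z.exitLaw U x) = ∫⁻ ω, (Z.exitPos U ω).elim 0 g ∂(Z.P x) := by
  have he := measurableEmbedding_coe_onePoint 𝒳
  rw [← lintegral_map' (measurable_onePoint_elim hg).aemeasurable (Z.aemeasurable_exitPos hU x)]
  have h1 : ∫⁻ y, (fun y : OnePoint 𝒳 => y.elim 0 g) (y : OnePoint 𝒳) ∂(Z.exitLaw U x) =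
      ∫⁻ y in range ((↑) : 𝒳 → OnePoint 𝒳), y.elim 0 g ∂((Z.P x).map (Z.exitPos U)) := by
    rw [← he.map_comap, he.lintegral_map]
    rfl
  refine h1.trans ?_
  rw [← lintegral_indicator he.measurableSet_range]
  refine lintegral_congr fun y => ?_
  induction y using OnePoint.rec with
  | infty => simp
  | coe y => simp

theorem exitLaw_univ_le_one {U : Set 𝒳} (hU : IsOpen U) (x : 𝒳) : Z.exitLaw U x univ ≤ 1 := by
  have := Z.isMarkovKernel
  rw [Z.exitLaw_apply hU x MeasurableSet.univ]
  exact prob_le_one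

theorem exitLaw_self {U : Set 𝒳} (hU : IsOpen U) (x : 𝒳) : Z.exitLaw U x U = 0 := by
  obtain ⟨S, Y, N, -, -, -, hN, -, -, hmem⟩ := Z.exists_exitPos_version hU
  rw [Z.exitLaw_apply hU x hU.measurableSet]
  refine measure_mono_null (fun ω hω => ?_) (hN x)
  by_contra hc
  exact hmem ω hc hω

theorem measurable_lintegral_exitLaw {U : Set 𝒳} (hU : IsOpen U) {g : 𝒳 → ℝ≥0∞}
    (hg : Measurable g) : Measurable fun x => ∫⁻ y, g y ∂(Z.exitLaw U x) := by
  obtain ⟨S, Y, N, -, hY, -, hN, -, hYeq, -⟩ := Z.exists_exitPos_version hU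
  have h : (fun x => ∫⁻ y, g y ∂(Z.exitLaw U x)) =
      fun x : 𝒳 => ∫⁻ ω, (Y ω).elim 0 g ∂(Z.P x) := by
    ext x
    rw [Z.lintegral_exitLaw hU x hg]
    refine lintegral_congr_ae ?_
    filter_upwards [measure_eq_zero_iff_ae_notMem.1 (hN x)] with ω hω
    rw [hYeq ω hω]
  rw [h]
  exact (((measurable_onePoint_elim hg).comp hY).lintegral_kernel (κ := Z.P)).comp
    (measurableEmbedding_coe_onePoint 𝒳).measurable

theorem measurable_meanExit {U : Set 𝒳} (hU : IsOpen U) : Measurable (Z.meanExit U) := by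
  obtain ⟨S, Y, N, hS, -, -, hN, hSeq, -⟩ := Z.exists_exitPos_version hU
  have h : Z.meanExit U = fun x : 𝒳 => ∫⁻ ω, duration (S ω) ∂(Z.P x) := by
    ext x
    refine lintegral_congr_ae ?_
    filter_upwards [measure_eq_zero_iff_ae_notMem.1 (hN x)] with ω hω
    rw [hSeq ω hω]
  rw [h]
  exact ((measurable_duration.comp hS).lintegral_kernel (κ := Z.P)).comp
    (measurableEmbedding_coe_onePoint 𝒳).measurable

theorem exitLaw_of_notMem {U : Set 𝒳} (hU : IsOpen U) {x : 𝒳} (hx : x ∉ U) :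
    Z.exitLaw U x = Measure.dirac x := by
  have := Z.isMarkovKernel
  ext s hs
  rw [Z.exitLaw_apply hU x hs, Measure.dirac_apply' _ hs]
  have hae : ∀ᵐ ω ∂(Z.P x), Z.exitPos U ω = x := by
    filter_upwards [Z.start x] with ω hω
    rw [Z.exitPos_of_eq_coe (Z.exitTime_eq_zero (by rw [hω]; simpa using hx)), hω]
  have h : ({ω | Z.exitPos U ω ∈ ((↑) : 𝒳 → OnePoint 𝒳) '' s} : Set Ω) =ᵐ[Z.P x]
      {_ω | x ∈ s} := by
    filter_upwards [hae] with ω hω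
    change (Z.exitPos U ω ∈ ((↑) : 𝒳 → OnePoint 𝒳) '' s) = (x ∈ s)
    rw [hω]; simp
  rw [measure_congr h]
  by_cases hxs : x ∈ s <;> simp [hxs]

/-- The strong Markov property at an exit time, for functionals that have a measurable version and
vanish at the cemetery. -/
theorem lintegral_shift_exitTime {W : Set 𝒳} (hW : IsOpen W) {f f' : Ω → ℝ≥0∞} {N : Set Ω}
    (hf' : Measurable f') (hNm : MeasurableSet N) (hN : ∀ x, Z.P x N = 0)
    (hff' : ∀ ω ∉ N, f ω = f' ω) (h0 : ∫⁻ ω, f ω ∂(Z.P OnePoint.infty) = 0) (x : 𝒳) :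
    ∫⁻ ω, {ω | Z.exitTime W ω < ⊤}.indicator
        (fun ω => f (Z.shift ((Z.exitTime W ω).untopD 0) ω)) ω ∂(Z.P x) =
      ∫⁻ y, ∫⁻ ω, f ω ∂(Z.P (y : OnePoint 𝒳)) ∂(Z.exitLaw W x) := by
  classical
  set τ := Z.exitTime W with hτ
  have hnull : NullMeasurableSet {ω | τ ω < ⊤} (Z.P x) :=
    (Z.aemeasurable_exitTime hW x).nullMeasurableSet_preimage measurableSet_Iio
  let f₁ : Ω → ℝ≥0∞ := N.piecewise (fun _ => ⊤) f'
  let f₂ : Ω → ℝ≥0∞ := N.piecewise (fun _ => 0) f'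
  have hm₁ : Measurable f₁ := Measurable.piecewise hNm measurable_const hf'
  have hm₂ : Measurable f₂ := Measurable.piecewise hNm measurable_const hf'
  have hle₁ : ∀ ω, f ω ≤ f₁ ω := fun ω => by
    by_cases h : ω ∈ N
    · simp [f₁, h]
    · simp [f₁, h, hff' ω h]
  have hle₂ : ∀ ω, f₂ ω ≤ f ω := fun ω => by
    by_cases h : ω ∈ N
    · simp [f₂, h]
    · simp [f₂, h, hff' ω h]
  have hinteg₁ : ∀ z, ∫⁻ ω, f₁ ω ∂(Z.P z) = ∫⁻ ω, f ω ∂(Z.P z) := fun z => by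
    refine lintegral_congr_ae ?_
    filter_upwards [measure_eq_zero_iff_ae_notMem.1 (hN z)] with ω hω
    simp [f₁, hω, hff' ω hω]
  have hinteg₂ : ∀ z, ∫⁻ ω, f₂ ω ∂(Z.P z) = ∫⁻ ω, f ω ∂(Z.P z) := fun z => by
    refine lintegral_congr_ae ?_
    filter_upwards [measure_eq_zero_iff_ae_notMem.1 (hN z)] with ω hω
    simp [f₂, hω, hff' ω hω]
  have hG : Measurable fun z => ∫⁻ ω, f ω ∂(Z.P z) := by
    simp_rw [← hinteg₂]
    exact hm₂.lintegral_kernel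
  have hSM : ∀ Y : Ω → ℝ≥0∞, Measurable Y → (∀ z, ∫⁻ ω, Y ω ∂(Z.P z) = ∫⁻ ω, f ω ∂(Z.P z)) →
      ∫⁻ ω, {ω | τ ω < ⊤}.indicator (fun ω => Y (Z.shift ((τ ω).untopD 0) ω)) ω ∂(Z.P x) =
        ∫⁻ y, ∫⁻ ω, f ω ∂(Z.P (y : OnePoint 𝒳)) ∂(Z.exitLaw W x) := by
    intro Y hY hYf
    have h := Z.strong_markov τ (Z.isStoppingTime_exitTime hW)
      ⟨Measure.dirac (x : OnePoint 𝒳), inferInstance⟩ Y hY univ MeasurableSet.univ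
    simp only [ProbabilityMeasure.coe_mk, dirac_bind, univ_inter, hYf] at h
    rw [← lintegral_indicator₀ hnull, ← lintegral_indicator₀ hnull] at h
    have hG' : Measurable fun y : 𝒳 => ∫⁻ ω, f ω ∂(Z.P (y : OnePoint 𝒳)) :=
      hG.comp (measurableEmbedding_coe_onePoint 𝒳).measurable
    rw [h, Z.lintegral_exitLaw hW x hG']
    refine lintegral_congr fun ω => ?_
    by_cases hlt : τ ω < ⊤
    · rw [indicator_of_mem (show ω ∈ {ω | τ ω < ⊤} from hlt), Z.exitPos_of_lt hlt]
      generalize Z.X ((τ ω).untopD 0) ω = z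
      induction z using OnePoint.rec with
      | infty => simpa using h0
      | coe z => simp
    · rw [indicator_of_notMem (show ω ∉ {ω | τ ω < ⊤} from hlt),
        Z.exitPos_of_eq_top (not_lt_top_iff.1 hlt)]
      simp
  refine le_antisymm ?_ ?_
  · rw [← hSM f₁ hm₁ hinteg₁]
    exact lintegral_mono fun ω => indicator_le_indicator (hle₁ _)
  · rw [← hSM f₂ hm₂ hinteg₂]
    exact lintegral_mono fun ω => indicator_le_indicator (hle₂ _)

/-- Leaving `V` after leaving a smaller set `W`. -/
theorem lintegral_exitLaw_of_subset {W V : Set 𝒳} (hW : IsOpen W) (hV : IsOpen V) (hWV : W ⊆ V)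
    {g : 𝒳 → ℝ≥0∞} (hg : Measurable g) (x : 𝒳) :
    ∫⁻ y, g y ∂(Z.exitLaw V x) = ∫⁻ y, ∫⁻ z, g z ∂(Z.exitLaw V y) ∂(Z.exitLaw W x) := by
  obtain ⟨S, Y, N, -, hY, hNm, hN, -, hYeq, -⟩ := Z.exists_exitPos_version hV
  have h := Z.lintegral_shift_exitTime hW (f := fun ω => (Z.exitPos V ω).elim 0 g)
    ((measurable_onePoint_elim hg).comp hY) hNm hN
    (fun ω hω => by simp only [Function.comp_apply, hYeq ω hω]) (by
      rw [lintegral_congr_ae (g := fun _ => 0), lintegral_zero]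
      filter_upwards [Z.ae_exitTime_infty V] with ω hω
      rw [hω.2]; rfl) x
  simp only [← Z.lintegral_exitLaw hV _ hg] at h
  rw [← h, Z.lintegral_exitLaw hV x hg]
  refine lintegral_congr fun ω => ?_
  by_cases hlt : Z.exitTime W ω < ⊤
  · rw [indicator_of_mem (show ω ∈ {ω | Z.exitTime W ω < ⊤} from hlt)]
    obtain ⟨s, hs⟩ := WithTop.ne_top_iff_exists.1 hlt.ne
    rw [Z.exitPos_shift hWV hs.symm, ← hs, WithTop.untopD_coe]
  · rw [indicator_of_notMem (show ω ∉ {ω | Z.exitTime W ω < ⊤} from hlt), Z.exitPos_of_eq_top]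
    · rfl
    · exact top_le_iff.1 ((not_lt_top_iff.1 hlt) ▸ Z.exitTime_mono hWV ω)

theorem meanExit_of_subset {W V : Set 𝒳} (hW : IsOpen W) (hV : IsOpen V) (hWV : W ⊆ V) (x : 𝒳) :
    Z.meanExit V x = Z.meanExit W x + ∫⁻ y, Z.meanExit V y ∂(Z.exitLaw W x) := by
  obtain ⟨S, Y, N, hS, -, hNm, hN, hSeq, -⟩ := Z.exists_exitPos_version hV
  have h := Z.lintegral_shift_exitTime hW (f := fun ω => duration (Z.exitTime V ω))
    (measurable_duration.comp hS) hNm hN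
    (fun ω hω => by simp only [Function.comp_apply, hSeq ω hω]) (by
      rw [lintegral_congr_ae (g := fun _ => 0), lintegral_zero]
      filter_upwards [Z.ae_exitTime_infty V] with ω hω
      rw [hω.1, duration_coe, ENNReal.coe_zero]) x
  simp only [meanExit] at h ⊢
  have hm : AEMeasurable (fun ω => duration (Z.exitTime W ω)) (Z.P x) :=
    measurable_duration.comp_aemeasurable (Z.aemeasurable_exitTime hW x)
  rw [← h, ← lintegral_add_left' hm]
  refine lintegral_congr fun ω => ?_
  by_cases hlt : Z.exitTime W ω < ⊤
  · rw [indicator_of_mem (show ω ∈ {ω | Z.exitTime W ω < ⊤} from hlt)]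
    obtain ⟨s, hs⟩ := WithTop.ne_top_iff_exists.1 hlt.ne
    rw [Z.exitTime_shift hWV hs.symm, ← hs, WithTop.untopD_coe, duration_add_coe, duration_coe]
  · have hW' := not_lt_top_iff.1 hlt
    have hV' : Z.exitTime V ω = ⊤ := top_le_iff.1 (hW' ▸ Z.exitTime_mono hWV ω)
    rw [hW', hV']; simp

end HuntProcess

namespace HuntProcess

variable {𝒳 Ω : Type*} [TopologicalSpace 𝒳] [mΩ : MeasurableSpace Ω] (Z : HuntProcess 𝒳 Ω)

theorem setOf_le_eq (T : WithTop ℝ≥0) :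
    MeasurableSet {s : ℝ | 0 ≤ s ∧ ((s.toNNReal : ℝ≥0) : WithTop ℝ≥0) ≤ T} ∧
    volume {s : ℝ | 0 ≤ s ∧ ((s.toNNReal : ℝ≥0) : WithTop ℝ≥0) ≤ T} = duration T ∧
    ∀ᵐ s ∂(volume.restrict {s : ℝ | 0 ≤ s ∧ ((s.toNNReal : ℝ≥0) : WithTop ℝ≥0) ≤ T}),
      ((s.toNNReal : ℝ≥0) : WithTop ℝ≥0) < T := by
  induction T using WithTop.recTopCoe with
  | top =>
    have h : {s : ℝ | 0 ≤ s ∧ ((s.toNNReal : ℝ≥0) : WithTop ℝ≥0) ≤ ⊤} = Ici 0 := by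
      ext s
      exact ⟨fun hs => hs.1, fun hs => ⟨hs, le_top⟩⟩
    rw [h]
    exact ⟨measurableSet_Ici, by simp, Eventually.of_forall fun s => WithTop.coe_lt_top _⟩
  | coe t =>
    have h : {s : ℝ | 0 ≤ s ∧ ((s.toNNReal : ℝ≥0) : WithTop ℝ≥0) ≤ (t : WithTop ℝ≥0)} =
        Icc 0 (t : ℝ) := by
      ext s
      simp only [mem_ofPred_eq, mem_Icc, WithTop.coe_le_coe, Real.toNNReal_le_iff_le_coe]
    rw [h]
    refine ⟨measurableSet_Icc, by
      rw [Real.volume_Icc, sub_zero, ENNReal.ofReal_coe_nnreal, duration_coe], ?_⟩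
    rw [ae_restrict_iff' measurableSet_Icc]
    filter_upwards [compl_mem_ae_iff.2 (measure_singleton (μ := volume) (t : ℝ))] with s hs hs'
    rw [WithTop.coe_lt_coe, ← NNReal.coe_lt_coe, Real.coe_toNNReal _ hs'.1]
    exact lt_of_le_of_ne hs'.2 hs

/-- The jump sum in a Lévy system, for `f(s, a, b) = 1_A(a) g(b)` and the exit time of `W`. -/
def exitJumpSum (W A : Set 𝒳) (g : 𝒳 → ℝ≥0∞) (ω : Ω) : ℝ≥0∞ :=
  ∑' s : {s : ℝ≥0 // (s : WithTop ℝ≥0) ≤ Z.exitTime W ω},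
    (Function.leftLim (fun t => Z.X t ω) (s : ℝ≥0)).elim 0
      (fun a => (Z.X s ω).elim 0 (fun b => A.indicator (fun _ => g b) a))

theorem exitJumpSum_of_eq_top {W A : Set 𝒳} {g : 𝒳 → ℝ≥0∞} (hg : ∀ w ∈ W, g w = 0) {ω : Ω}
    (h : Z.exitTime W ω = ⊤) : Z.exitJumpSum W A g ω = 0 := by
  refine ENNReal.tsum_eq_zero.2 fun s => ?_
  obtain ⟨w, hw, hws⟩ := Z.X_mem_of_lt_exitTime (U := W) (ω := ω) (s := s)
    (lt_of_lt_of_eq (WithTop.coe_lt_top _) h.symm)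
  rw [← hws]
  generalize Function.leftLim (fun t => Z.X t ω) (s : ℝ≥0) = y
  induction y using OnePoint.rec with
  | infty => rfl
  | coe a => simp [hg w hw]

theorem exitJumpSum_of_eq_coe {W A : Set 𝒳} {g : 𝒳 → ℝ≥0∞} (hg : ∀ w ∈ W, g w = 0) {ω : Ω}
    {t : ℝ≥0} (h : Z.exitTime W ω = t) :
    Z.exitJumpSum W A g ω = (Function.leftLim (fun t => Z.X t ω) t).elim 0
      (fun a => (Z.X t ω).elim 0 (fun b => A.indicator (fun _ => g b) a)) := by
  refine tsum_eq_single (⟨t, h.ge⟩ : {s : ℝ≥0 // (s : WithTop ℝ≥0) ≤ Z.exitTime W ω}) ?_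
  rintro ⟨s, hs⟩ hne
  have hlt : (s : WithTop ℝ≥0) < Z.exitTime W ω := by
    refine lt_of_le_of_ne hs fun heq => hne ?_
    rw [h, WithTop.coe_inj] at heq
    exact Subtype.ext heq
  obtain ⟨w, hw, hws⟩ := Z.X_mem_of_lt_exitTime hlt
  simp only
  rw [← hws]
  generalize Function.leftLim (fun t => Z.X t ω) s = y
  induction y using OnePoint.rec with
  | infty => rfl
  | coe a => simp [hg w hw]

variable [T2Space 𝒳] [LocallyCompactSpace 𝒳] [SecondCountableTopology 𝒳]

/-- The process cannot return from the cemetery: a left limit at the cemetery is a death. -/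
theorem ae_leftLimit_ne_infty (x : OnePoint 𝒳) :
    ∀ᵐ ω ∂(Z.P x), ∀ t : ℝ≥0, 0 < t →
      Tendsto (fun s => Z.X s ω) (𝓝[<] t) (𝓝 OnePoint.infty) → Z.X t ω = OnePoint.infty := by
  obtain ⟨S, N, -, -, -, hN, -, hmem, hlim⟩ :=
    Z.exists_hittingAfter_closed (F := {OnePoint.infty}) OnePoint.isClosed_infty
  filter_upwards [measure_eq_zero_iff_ae_notMem.1 (hN x)] with ω hω t ht hl
  have hSt := hlim ω hω t ht _ rfl hl
  obtain ⟨s, hs⟩ := WithTop.ne_top_iff_exists.1 (hSt.trans_lt (WithTop.coe_lt_top t)).ne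
  have h1 := hmem ω hω (by rw [← hs]; exact WithTop.coe_lt_top s)
  rw [← hs, WithTop.untopD_coe] at h1
  rw [← hs, WithTop.coe_le_coe] at hSt
  exact Z.cemetery s t ω hSt h1

variable [MeasurableSpace 𝒳]

theorem lintegral_exitJumpSum {J : 𝒳 → Measure 𝒳} (hJ : Z.IsLevySystem J) {W A : Set 𝒳}
    (hW : IsOpen W) (hA : MeasurableSet A) {g : 𝒳 → ℝ≥0∞} (hg : Measurable g)
    (hgA : ∀ w ∈ A, g w = 0) (x : 𝒳) :
    ∫⁻ ω, Z.exitJumpSum W A g ω ∂(Z.P x) =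
      ∫⁻ ω, (∫⁻ s in {s : ℝ | 0 ≤ s ∧ ((s.toNNReal : ℝ≥0) : WithTop ℝ≥0) ≤ Z.exitTime W ω},
        (Z.X s.toNNReal ω).elim 0
          (fun a => ∫⁻ y, A.indicator (fun _ => g y) a ∂(J a))) ∂(Z.P x) := by
  refine hJ (fun _ a b => A.indicator (fun _ => g b) a) ?_ ?_ _ (Z.isStoppingTime_exitTime hW) x
  · have : (fun p : ℝ≥0 × 𝒳 × 𝒳 => A.indicator (fun _ => g p.2.2) p.2.1) =
        {p : ℝ≥0 × 𝒳 × 𝒳 | p.2.1 ∈ A}.indicator (fun p => g p.2.2) := by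
      ext p
      by_cases h : p.2.1 ∈ A <;> simp [h]
    rw [this]
    exact (hg.comp measurable_snd.snd).indicator (measurable_snd.fst hA)
  · intro _ a
    by_cases h : a ∈ A <;> simp [h, hgA]

variable [BorelSpace 𝒳]

/-- Lower bound for the exit law by the jumps out of `W`. -/
theorem mul_meanExit_le_lintegral_exitLaw {J : 𝒳 → Measure 𝒳} (hJ : Z.IsLevySystem J)
    {W : Set 𝒳} (hW : IsOpen W) {g : 𝒳 → ℝ≥0∞} (hg : Measurable g) (hgW : ∀ w ∈ W, g w = 0)
    {c : ℝ≥0∞} (hc : ∀ w ∈ W, c ≤ ∫⁻ y, g y ∂(J w)) (x : 𝒳) :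
    c * Z.meanExit W x ≤ ∫⁻ y, g y ∂(Z.exitLaw W x) := by
  calc c * Z.meanExit W x = ∫⁻ ω, c * duration (Z.exitTime W ω) ∂(Z.P x) :=
        (lintegral_const_mul'' c
          (measurable_duration.comp_aemeasurable (Z.aemeasurable_exitTime hW x))).symm
    _ ≤ ∫⁻ ω, (∫⁻ s in {s : ℝ | 0 ≤ s ∧ ((s.toNNReal : ℝ≥0) : WithTop ℝ≥0) ≤ Z.exitTime W ω},
        (Z.X s.toNNReal ω).elim 0
          (fun a => ∫⁻ y, W.indicator (fun _ => g y) a ∂(J a))) ∂(Z.P x) := by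
        refine lintegral_mono fun ω => ?_
        obtain ⟨-, hvol, hae⟩ := setOf_le_eq (Z.exitTime W ω)
        rw [← hvol, ← setLIntegral_const]
        refine lintegral_mono_ae ?_
        filter_upwards [hae] with s hs
        obtain ⟨w, hw, hws⟩ := Z.X_mem_of_lt_exitTime hs
        rw [← hws]
        simpa [hw] using hc w hw
    _ = ∫⁻ ω, Z.exitJumpSum W W g ω ∂(Z.P x) :=
        (Z.lintegral_exitJumpSum hJ hW hW.measurableSet hg hgW x).symm
    _ ≤ ∫⁻ ω, (Z.exitPos W ω).elim 0 g ∂(Z.P x) := by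
        refine lintegral_mono fun ω => ?_
        by_cases htop : Z.exitTime W ω = ⊤
        · rw [Z.exitJumpSum_of_eq_top hgW htop]; exact zero_le
        · obtain ⟨t, ht⟩ := WithTop.ne_top_iff_exists.1 htop
          rw [Z.exitJumpSum_of_eq_coe hgW ht.symm, Z.exitPos_of_eq_coe ht.symm]
          generalize Function.leftLim (fun t => Z.X t ω) t = y
          induction y using OnePoint.rec with
          | infty => exact zero_le
          | coe a =>
            generalize Z.X t ω = z
            induction z using OnePoint.rec with
            | infty => exact zero_le
            | coe b => exact indicator_le_self W (fun _ => g b) a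
    _ = _ := (Z.lintegral_exitLaw hW x hg).symm

/-- Upper bound for the exit law, at a distance from `W`, by the jumps out of `W`. -/
theorem lintegral_exitLaw_le_mul_meanExit {J : 𝒳 → Measure 𝒳} (hJ : Z.IsLevySystem J)
    {W A : Set 𝒳} (hW : IsOpen W) (hA : IsClosed A) (hWA : W ⊆ A) {g : 𝒳 → ℝ≥0∞}
    (hg : Measurable g) (hgA : ∀ w ∈ A, g w = 0)
    {c : ℝ≥0∞} (hc : ∀ w ∈ W, ∫⁻ y, g y ∂(J w) ≤ c) {x : 𝒳} (hx : x ∈ W) :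
    ∫⁻ y, g y ∂(Z.exitLaw W x) ≤ c * Z.meanExit W x := by
  have hgW : ∀ w ∈ W, g w = 0 := fun w hw => hgA w (hWA hw)
  calc ∫⁻ y, g y ∂(Z.exitLaw W x) = ∫⁻ ω, (Z.exitPos W ω).elim 0 g ∂(Z.P x) :=
        Z.lintegral_exitLaw hW x hg
    _ ≤ ∫⁻ ω, Z.exitJumpSum W A g ω ∂(Z.P x) := by
        obtain ⟨S, Y, N, -, -, -, hN, -, -, hmem⟩ := Z.exists_exitPos_version hW
        refine lintegral_mono_ae ?_
        filter_upwards [measure_eq_zero_iff_ae_notMem.1 (hN x), Z.start x,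
          Z.ae_leftLimit_ne_infty x] with ω hω hstart hleft
        by_cases htop : Z.exitTime W ω = ⊤
        · rw [Z.exitPos_of_eq_top htop]; exact zero_le
        obtain ⟨t, ht⟩ := WithTop.ne_top_iff_exists.1 htop
        have hmem' := hmem ω hω
        rw [Z.exitPos_of_eq_coe ht.symm] at hmem' ⊢
        rw [Z.exitJumpSum_of_eq_coe hgW ht.symm]
        have ht0 : 0 < t := by
          refine pos_of_ne_zero fun h0 => hmem' ?_
          rw [h0, hstart]
          exact ⟨x, hx, rfl⟩
        have : (𝓝[<] t).NeBot := nhdsLT_neBot_of_exists_lt ⟨0, ht0⟩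
        obtain ⟨y, hy⟩ := Z.left_limits ω t
        rw [leftLim_eq_of_tendsto hy]
        have hev : ∀ᶠ s in 𝓝[<] t, Z.X s ω ∈ ((↑) : 𝒳 → OnePoint 𝒳) '' W := by
          filter_upwards [self_mem_nhdsWithin] with s hs
          refine Z.X_mem_of_lt_exitTime ?_
          rw [← ht]
          exact WithTop.coe_lt_coe.2 hs
        induction y using OnePoint.rec with
        | infty =>
          rw [hleft t ht0 hy]; exact zero_le
        | coe a =>
          have haA : a ∈ A := by
            have h1 : (a : OnePoint 𝒳) ∈ closure (((↑) : 𝒳 → OnePoint 𝒳) '' W) :=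
              mem_closure_of_tendsto hy hev
            have h2 : a ∈ closure W := by
              rw [OnePoint.isOpenEmbedding_coe.isInducing.closure_eq_preimage_closure_image]
              exact h1
            exact closure_minimal hWA hA h2
          simp [haA]
    _ = ∫⁻ ω, (∫⁻ s in {s : ℝ | 0 ≤ s ∧ ((s.toNNReal : ℝ≥0) : WithTop ℝ≥0) ≤ Z.exitTime W ω},
        (Z.X s.toNNReal ω).elim 0
          (fun a => ∫⁻ y, A.indicator (fun _ => g y) a ∂(J a))) ∂(Z.P x) :=
        Z.lintegral_exitJumpSum hJ hW hA.measurableSet hg hgA x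
    _ ≤ ∫⁻ ω, c * duration (Z.exitTime W ω) ∂(Z.P x) := by
        refine lintegral_mono fun ω => ?_
        obtain ⟨-, hvol, hae⟩ := setOf_le_eq (Z.exitTime W ω)
        rw [← hvol, ← setLIntegral_const]
        refine lintegral_mono_ae ?_
        filter_upwards [hae] with s hs
        obtain ⟨w, hw, hws⟩ := Z.X_mem_of_lt_exitTime hs
        rw [← hws]
        simpa [hWA hw] using hc w hw
    _ = c * Z.meanExit W x := lintegral_const_mul'' c
          (measurable_duration.comp_aemeasurable (Z.aemeasurable_exitTime hW x))

/-- Leaving `D ∩ B` without leaving `D` takes a long time or is a fast exit from `B`. -/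
theorem exitLaw_inter_apply_le {D B : Set 𝒳} (hD : IsOpen D) (hB : IsOpen B) (x : 𝒳) {t : ℝ≥0}
    (ht : 0 < t) :
    Z.exitLaw (D ∩ B) x D ≤
      Z.meanExit (D ∩ B) x / t + Z.P x {ω | Z.exitTime B ω < (t : WithTop ℝ≥0)} := by
  have hW := hD.inter hB
  obtain ⟨S, Y, N, -, -, -, hN, -, -, hmem⟩ := Z.exists_exitPos_version hW
  rw [Z.exitLaw_apply hW x hD.measurableSet]
  have hsub : {ω | Z.exitPos (D ∩ B) ω ∈ ((↑) : 𝒳 → OnePoint 𝒳) '' D} ⊆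
      N ∪ ({ω | (t : ℝ≥0∞) ≤ duration (Z.exitTime (D ∩ B) ω)} ∪
        {ω | Z.exitTime B ω < (t : WithTop ℝ≥0)}) := by
    intro ω hω
    by_cases hωN : ω ∈ N
    · exact Or.inl hωN
    refine Or.inr ?_
    have hm := hmem ω hωN
    by_cases hle : (t : WithTop ℝ≥0) ≤ Z.exitTime (D ∩ B) ω
    · exact Or.inl (duration_mono hle)
    refine Or.inr ?_
    rw [not_le] at hle
    obtain ⟨s, hs⟩ := WithTop.ne_top_iff_exists.1 hle.ne_top
    simp only [mem_ofPred_eq, Z.exitPos_of_eq_coe hs.symm] at hω hm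
    obtain ⟨y, hyD, hy⟩ := hω
    refine lt_of_le_of_lt ?_ hle
    rw [← hs]
    refine hittingAfter_le_of_mem zero_le ?_
    rintro ⟨z, hz, hzy⟩
    have : y = z := OnePoint.coe_injective (hy.trans hzy.symm)
    exact hm ⟨y, ⟨hyD, this ▸ hz⟩, hy⟩
  refine (measure_mono hsub).trans ((measure_union_le _ _).trans ?_)
  rw [hN, zero_add]
  refine (measure_union_le _ _).trans (add_le_add ?_ le_rfl)
  exact meas_ge_le_lintegral_div (measurable_duration.comp_aemeasurable
    (Z.aemeasurable_exitTime hW x)) (by exact_mod_cast ht.ne') ENNReal.coe_ne_top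

end HuntProcess

/-! ### Estimates for the exit laws at a given location and scale -/

/-- Two-sided comparison, at the location `z` and the scale `ρ`, of the exit laws with a reference
measure `N`, together with a bound for the probability of leaving small balls fast. Time is measured
in units of `σ⁻¹`. -/
structure JumpEstimates {𝒳 Ω : Type*} [MetricSpace 𝒳] [MeasurableSpace 𝒳] [MeasurableSpace Ω]
    (Z : HuntProcess 𝒳 Ω) (σ : ℝ≥0∞) (N : Measure 𝒳) (K : ℝ≥0) (γ : ℕ) (z : 𝒳) (ρ : ℝ) :
    Prop where
  scale_pos : 0 < ρ
  lower : ∀ W : Set 𝒳, IsOpen W → W ⊆ Metric.ball z (2 * ρ) → ∀ x : 𝒳, ∀ g : 𝒳 → ℝ≥0∞,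
    Measurable g → (∀ w ∈ W, g w = 0) →
      Z.meanExit W x * σ * ∫⁻ y, g y ∂N ≤ K * ∫⁻ y, g y ∂(Z.exitLaw W x)
  upper : ∀ W : Set 𝒳, IsOpen W → W ⊆ Metric.ball z (2 * ρ) → ∀ x ∈ W, ∀ g : 𝒳 → ℝ≥0∞,
    Measurable g → ∀ Δ : ℝ≥0, 1 ≤ Δ → (∀ w ∈ W, ∀ y, dist w y < ρ / Δ → g y = 0) →
      ∫⁻ y, g y ∂(Z.exitLaw W x) ≤ K * Δ ^ γ * (Z.meanExit W x * σ * ∫⁻ y, g y ∂N)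
  mass_le : N univ ≤ K
  mass_compl : 1 ≤ K * N (Metric.ball z (2 * ρ))ᶜ
  fast_exit : ∀ D : Set 𝒳, IsOpen D → ∀ x : 𝒳, ∀ Δ : ℝ≥0, 1 ≤ Δ → ∀ S : ℝ≥0, 0 < S →
    Z.exitLaw (D ∩ Metric.ball x (ρ / Δ)) x D ≤
      S * (Z.meanExit (D ∩ Metric.ball x (ρ / Δ)) x * σ) + K * Δ ^ γ * ((S⁻¹ : ℝ≥0) : ℝ≥0∞)

namespace HuntProcess

section ExitInside

variable {𝒳 Ω : Type*} [TopologicalSpace 𝒳] [T2Space 𝒳] [LocallyCompactSpace 𝒳]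
  [SecondCountableTopology 𝒳] [MeasurableSpace 𝒳] [BorelSpace 𝒳] [MeasurableSpace Ω]
  (Z : HuntProcess 𝒳 Ω)

theorem exitLaw_apply_of_subset {W V : Set 𝒳} (hW : IsOpen W) (hV : IsOpen V) (hWV : W ⊆ V)
    {s : Set 𝒳} (hs : MeasurableSet s) (x : 𝒳) :
    Z.exitLaw V x s = ∫⁻ y, Z.exitLaw V y s ∂(Z.exitLaw W x) := by
  have h := Z.lintegral_exitLaw_of_subset hW hV hWV (measurable_one.indicator hs) x
  simpa only [lintegral_indicator_one hs] using h

theorem exitLaw_le_one {V : Set 𝒳} (hV : IsOpen V) (x : 𝒳) (s : Set 𝒳) : Z.exitLaw V x s ≤ 1 :=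
  (measure_mono (subset_univ s)).trans (Z.exitLaw_univ_le_one hV x)

theorem exitLaw_apply_eq_zero {V D : Set 𝒳} (hV : IsOpen V) (hD : IsOpen D) (hVD : V ⊆ D) {y : 𝒳}
    (hy : y ∉ D) : Z.exitLaw V y D = 0 := by
  rw [Z.exitLaw_of_notMem hV fun h => hy (hVD h), Measure.dirac_apply' _ hD.measurableSet]
  simp [hy]

theorem exitLaw_apply_le_indicator {V D : Set 𝒳} (hV : IsOpen V) (hD : IsOpen D) (hVD : V ⊆ D)
    (y : 𝒳) : Z.exitLaw V y D ≤ D.indicator 1 y := by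
  by_cases hy : y ∈ D
  · simpa [hy] using Z.exitLaw_le_one hV y D
  · simp [Z.exitLaw_apply_eq_zero hV hD hVD hy]

theorem exitLaw_apply_anti {W V D : Set 𝒳} (hW : IsOpen W) (hV : IsOpen V) (hD : IsOpen D)
    (hWV : W ⊆ V) (hVD : V ⊆ D) (x : 𝒳) : Z.exitLaw V x D ≤ Z.exitLaw W x D := by
  rw [Z.exitLaw_apply_of_subset hW hV hWV hD.measurableSet x,
    ← lintegral_indicator_one hD.measurableSet]
  exact lintegral_mono fun y => Z.exitLaw_apply_le_indicator hV hD hVD y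

theorem meanExit_mul_of_subset {W V : Set 𝒳} (hW : IsOpen W) (hV : IsOpen V) (hWV : W ⊆ V)
    (σ : ℝ≥0∞) (x : 𝒳) :
    Z.meanExit V x * σ =
      Z.meanExit W x * σ + ∫⁻ y, Z.meanExit V y * σ ∂(Z.exitLaw W x) := by
  rw [lintegral_mul_const _ (Z.measurable_meanExit hV), Z.meanExit_of_subset hW hV hWV x, add_mul]

end ExitInside

end HuntProcess

namespace JumpEstimates

variable {𝒳 Ω : Type*} [MetricSpace 𝒳] [MeasurableSpace 𝒳] [MeasurableSpace Ω]
  {Z : HuntProcess 𝒳 Ω} {σ : ℝ≥0∞} {N : Measure 𝒳} {K : ℝ≥0} {γ : ℕ} {z : 𝒳} {ρ : ℝ}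

/-- The exit law of `W` gives little mass to the points away from `W`. -/
theorem exitLaw_far_le (h : JumpEstimates Z σ N K γ z ρ) {W s : Set 𝒳} (hW : IsOpen W)
    (hWz : W ⊆ Metric.ball z (2 * ρ)) {x : 𝒳} (hx : x ∈ W) (hs : MeasurableSet s) {Δ : ℝ≥0}
    (hΔ : 1 ≤ Δ) (hsW : ∀ w ∈ W, ∀ y ∈ s, ρ / Δ ≤ dist w y) :
    Z.exitLaw W x s ≤ (K * Δ ^ γ * K : ℝ≥0) * (Z.meanExit W x * σ) := by
  have h1 := h.upper W hW hWz x hx (s.indicator 1) (measurable_one.indicator hs) Δ hΔ (by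
    intro w hw y hy
    by_contra hc
    have hys : y ∈ s := by
      by_contra hys
      exact hc (indicator_of_notMem hys _)
    exact absurd (hsW w hw y hys) (not_le.2 hy))
  rw [lintegral_indicator_one hs, lintegral_indicator_one hs] at h1
  have h2 : N s ≤ K := (measure_mono (subset_univ s)).trans h.mass_le
  calc Z.exitLaw W x s ≤ K * Δ ^ γ * (Z.meanExit W x * σ * N s) := h1
    _ ≤ K * Δ ^ γ * (Z.meanExit W x * σ * K) := by gcongr
    _ = _ := by push_cast; ring

/-- The constant in the a priori bound for the probability of leaving a ball inside `D`. -/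
def aprioriConst (K : ℝ≥0) (γ : ℕ) : ℝ≥0 :=
  1 + K * 4 ^ γ * (1 + K * 8 ^ γ) + K * 8 ^ γ * K

/-- The radii used in the iteration. -/
def boxRadius (ρ : ℝ) (k : ℕ) : ℝ := ρ * (1 / 4 + (1 / 2) ^ k / 4)

/-- The thresholds used in the iteration. -/
def boxLevel (γ k : ℕ) : ℝ≥0 := ((1 / 2) ^ (γ + 1)) ^ k

theorem boxLevel_pos (γ k : ℕ) : 0 < boxLevel γ k := by unfold boxLevel; positivity

theorem boxLevel_le_one (γ k : ℕ) : boxLevel γ k ≤ 1 :=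
  pow_le_one₀ zero_le (pow_le_one₀ zero_le (by norm_num))

theorem boxLevel_mul_pow (γ k : ℕ) : boxLevel γ k * (2 ^ k) ^ γ = (1 / 2) ^ k := by
  unfold boxLevel
  rw [← pow_mul 2 k γ, mul_comm k γ, pow_mul 2 γ k, ← mul_pow, pow_succ, mul_right_comm, ← mul_pow]
  norm_num

theorem boxLevel_le (γ k : ℕ) : boxLevel γ k ≤ (1 / 2) ^ k := by
  rw [← boxLevel_mul_pow]
  exact le_mul_of_one_le_right zero_le (one_le_pow₀ (one_le_pow₀ (by norm_num)))

/-- The bound at the points far from the centre in the iteration. -/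
def boxTail (K : ℝ≥0) (γ : ℕ) (z : 𝒳) (ρ : ℝ) (k : ℕ) (y : 𝒳) : ℝ≥0∞ :=
  ∑ j ∈ Finset.range k, ((aprioriConst K γ * boxLevel γ j ^ 3 : ℝ≥0) : ℝ≥0∞) *
      (Metric.ball z (boxRadius ρ (j + 1)))ᶜ.indicator 1 y +
    (Metric.ball z (boxRadius ρ 0))ᶜ.indicator 1 y

/-- The constant in the bound for the tail term of the iteration. -/
def boxTailConst (K : ℝ≥0) (γ : ℕ) : ℝ≥0 :=
  aprioriConst K γ * (K * 32 ^ γ * K) * 2 + K * 16 ^ γ * K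

/-- The increment constant of the iteration. -/
def boxIncrement (K : ℝ≥0) (γ : ℕ) : ℝ≥0 :=
  aprioriConst K γ * 4 ^ (γ + 1) * (1 + K * 16 ^ γ)

/-- The constants of the iteration. -/
def boxConst (K : ℝ≥0) (γ k : ℕ) : ℝ≥0 :=
  boxTailConst K γ + boxIncrement K γ * ∑ j ∈ Finset.range k, (1 / 2) ^ j

theorem sum_half_pow_le (k : ℕ) : ∑ j ∈ Finset.range k, (1 / 2 : ℝ≥0) ^ j ≤ 2 := by
  rw [← NNReal.coe_le_coe]
  push_cast
  exact sum_geometric_two_le k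

theorem boxConst_mono (K : ℝ≥0) (γ k : ℕ) : boxConst K γ k ≤ boxConst K γ (k + 1) := by
  unfold boxConst
  rw [Finset.sum_range_succ, mul_add (boxIncrement K γ)]
  gcongr
  exact le_self_add

theorem boxConst_step (K : ℝ≥0) (γ k : ℕ) :
    boxConst K γ k + aprioriConst K γ * boxLevel γ k ^ 3 * (1 + K * (2 ^ (k + 4)) ^ γ) *
      (boxLevel γ (k + 1) ^ 2)⁻¹ ≤ boxConst K γ (k + 1) := by
  unfold boxConst
  rw [Finset.sum_range_succ, mul_add (boxIncrement K γ), ← add_assoc]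
  refine add_le_add le_rfl ?_
  have h0 := boxLevel_pos γ k
  have h1 : boxLevel γ k ^ 3 * (boxLevel γ (k + 1) ^ 2)⁻¹ = boxLevel γ k * 4 ^ (γ + 1) := by
    have h2 : boxLevel γ (k + 1) = boxLevel γ k * (1 / 2) ^ (γ + 1) := by
      unfold boxLevel; rw [pow_succ]
    have h3 : ((1 / 2 : ℝ≥0) ^ (γ + 1)) ^ 2 * 4 ^ (γ + 1) = 1 := by
      rw [← pow_mul, mul_comm, mul_comm (γ + 1) 2, pow_mul, ← mul_pow]; norm_num
    rw [← div_eq_mul_inv, div_eq_iff (by have := boxLevel_pos γ (k + 1); positivity), h2]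
    calc boxLevel γ k ^ 3 = boxLevel γ k ^ 3 * (((1 / 2 : ℝ≥0) ^ (γ + 1)) ^ 2 * 4 ^ (γ + 1)) := by
          rw [h3, mul_one]
      _ = _ := by ring
  calc aprioriConst K γ * boxLevel γ k ^ 3 * (1 + K * (2 ^ (k + 4)) ^ γ) *
        (boxLevel γ (k + 1) ^ 2)⁻¹
      = aprioriConst K γ * (boxLevel γ k ^ 3 * (boxLevel γ (k + 1) ^ 2)⁻¹) *
          (1 + K * (2 ^ (k + 4)) ^ γ) := by ring
    _ = aprioriConst K γ * 4 ^ (γ + 1) *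
          (boxLevel γ k + K * 16 ^ γ * (boxLevel γ k * (2 ^ k) ^ γ)) := by
        rw [h1, pow_add 2 k 4, mul_pow]; norm_num; ring
    _ ≤ aprioriConst K γ * 4 ^ (γ + 1) * ((1 / 2) ^ k + K * 16 ^ γ * (1 / 2) ^ k) := by
        rw [boxLevel_mul_pow]
        gcongr
        exact boxLevel_le γ k
    _ = boxIncrement K γ * (1 / 2) ^ k := by unfold boxIncrement; ring

variable [BorelSpace 𝒳]

/-- The tail term is controlled by the mean exit time. -/
theorem lintegral_boxTail_le (h : JumpEstimates Z σ N K γ z ρ) {D : Set 𝒳} (hD : IsOpen D) {x : 𝒳}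
    (hxD : x ∈ D) {k : ℕ} (hx : x ∈ Metric.ball z (boxRadius ρ (k + 1))) :
    ∫⁻ y, boxTail K γ z ρ k y
        ∂(Z.exitLaw (D ∩ Metric.ball x (ρ / ((2 ^ (k + 4) : ℝ≥0) : ℝ))) x) ≤
      boxTailConst K γ *
        (Z.meanExit (D ∩ Metric.ball x (ρ / ((2 ^ (k + 4) : ℝ≥0) : ℝ))) x * σ) := by
  have hρ := h.scale_pos
  set W := D ∩ Metric.ball x (ρ / ((2 ^ (k + 4) : ℝ≥0) : ℝ)) with hWdef
  have hW : IsOpen W := hD.inter Metric.isOpen_ball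
  have hxW : x ∈ W := ⟨hxD, Metric.mem_ball_self (by positivity)⟩
  have hdiv : ∀ n : ℕ, ρ / ((2 ^ (n + 4) : ℝ≥0) : ℝ) = ρ * ((1 / 2) ^ n / 16) := by
    intro n
    push_cast
    rw [pow_add, one_div, inv_pow]
    field_simp
    norm_num
  have hpow : ∀ i j : ℕ, i ≤ j → ((1 / 2 : ℝ)) ^ j ≤ (1 / 2) ^ i := fun i j hij =>
    pow_le_pow_of_le_one (by norm_num) (by norm_num) hij
  have hWdist : ∀ w ∈ W, dist w z < boxRadius ρ (k + 1) + ρ * ((1 / 2) ^ k / 16) := by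
    intro w hw
    have h1 := Metric.mem_ball.1 hw.2
    have h2 := Metric.mem_ball.1 hx
    have h3 := dist_triangle w x z
    rw [hdiv] at h1
    linarith
  have hWz : W ⊆ Metric.ball z (2 * ρ) := by
    intro w hw
    refine Metric.mem_ball.2 ((hWdist w hw).trans_le ?_)
    unfold boxRadius
    have h1 := hpow 0 k (Nat.zero_le k)
    have h2 := hpow 0 (k + 1) (Nat.zero_le _)
    rw [pow_zero] at h1 h2
    nlinarith
  have hfar : ∀ i ≤ k, Z.exitLaw W x (Metric.ball z (boxRadius ρ i))ᶜ ≤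
      (K * (2 ^ (i + 4)) ^ γ * K : ℝ≥0) * (Z.meanExit W x * σ) := by
    intro i hi
    refine h.exitLaw_far_le hW hWz hxW Metric.isOpen_ball.measurableSet.compl
      (one_le_pow₀ (by norm_num)) ?_
    intro w hw y hy
    have h1 := hWdist w hw
    have h2 : boxRadius ρ i ≤ dist y z := not_lt.1 hy
    have h3 := dist_triangle y w z
    rw [dist_comm y w] at h3
    rw [hdiv]
    have h4 : ρ * (1 / 2) ^ k ≤ ρ * (1 / 2) ^ i := mul_le_mul_of_nonneg_left (hpow i k hi) hρ.le
    have h5 : (1 / 2 : ℝ) ^ (k + 1) = (1 / 2) ^ k * (1 / 2) := pow_succ _ _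
    unfold boxRadius at h1 h2
    rw [h5] at h1
    nlinarith
  set q := Z.meanExit W x * σ with hq
  unfold boxTail
  rw [lintegral_add_right _ (measurable_one.indicator Metric.isOpen_ball.measurableSet.compl),
    lintegral_finsetSum _ (fun j _ =>
      (measurable_one.indicator Metric.isOpen_ball.measurableSet.compl).const_mul _),
    lintegral_indicator_one Metric.isOpen_ball.measurableSet.compl]
  have hterm : ∀ j ∈ Finset.range k,
      ∫⁻ y, ((aprioriConst K γ * boxLevel γ j ^ 3 : ℝ≥0) : ℝ≥0∞) *
        (Metric.ball z (boxRadius ρ (j + 1)))ᶜ.indicator 1 y ∂(Z.exitLaw W x) ≤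
      (aprioriConst K γ * (K * 32 ^ γ * K) * (1 / 2) ^ j : ℝ≥0) * q := by
    intro j hj
    rw [lintegral_const_mul _ (measurable_one.indicator Metric.isOpen_ball.measurableSet.compl),
      lintegral_indicator_one Metric.isOpen_ball.measurableSet.compl]
    refine (mul_le_mul_right (hfar (j + 1) (Finset.mem_range.1 hj)) _).trans ?_
    rw [← mul_assoc, ← ENNReal.coe_mul]
    refine mul_le_mul_left (ENNReal.coe_le_coe.2 ?_) _
    have h1 : boxLevel γ j ^ 3 ≤ boxLevel γ j :=
      pow_le_of_le_one zero_le (boxLevel_le_one γ j) (by norm_num)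
    calc aprioriConst K γ * boxLevel γ j ^ 3 * (K * (2 ^ (j + 1 + 4)) ^ γ * K)
        ≤ aprioriConst K γ * boxLevel γ j * (K * (2 ^ (j + 1 + 4)) ^ γ * K) := by gcongr
      _ = aprioriConst K γ * (K * 32 ^ γ * K) * (boxLevel γ j * (2 ^ j) ^ γ) := by
          rw [show (2 : ℝ≥0) ^ (j + 1 + 4) = 2 ^ j * 32 by rw [add_assoc, pow_add]; norm_num,
            mul_pow]
          ring
      _ = _ := by rw [boxLevel_mul_pow]
  have hzero : Z.exitLaw W x (Metric.ball z (boxRadius ρ 0))ᶜ ≤ (K * 16 ^ γ * K : ℝ≥0) * q := by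
    refine (hfar 0 (Nat.zero_le k)).trans (le_of_eq ?_)
    norm_num
  refine (add_le_add (Finset.sum_le_sum hterm) hzero).trans ?_
  rw [← Finset.sum_mul, ← add_mul, ← ENNReal.ofNNReal_finsetSum, ← Finset.mul_sum, ← ENNReal.coe_add]
  refine mul_le_mul_left (ENNReal.coe_le_coe.2 ?_) _
  unfold boxTailConst
  gcongr
  exact sum_half_pow_le k

variable [LocallyCompactSpace 𝒳] [SecondCountableTopology 𝒳]

/-- A priori bound: where the mean exit time is at most `t ^ 4`, the probability to leave the ball
before leaving `D` is of order at most `t ^ 3`. -/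
theorem apriori (h : JumpEstimates Z σ N K γ z ρ) {D : Set 𝒳} (hD : IsOpen D) {x : 𝒳}
    (hx : x ∈ Metric.ball z (ρ / 2)) {t : ℝ≥0} (ht0 : 0 < t) (ht1 : t ≤ 1)
    (hv : Z.meanExit (D ∩ Metric.ball z ρ) x * σ ≤ (t ^ 4 : ℝ≥0)) :
    Z.exitLaw (D ∩ Metric.ball z ρ) x D ≤ (aprioriConst K γ * t ^ 3 : ℝ≥0) := by
  have hρ := h.scale_pos
  set V := D ∩ Metric.ball z ρ with hVdef
  have hV : IsOpen V := hD.inter Metric.isOpen_ball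
  have hVD : V ⊆ D := inter_subset_left
  by_cases hxD : x ∈ D
  swap
  · rw [Z.exitLaw_apply_eq_zero hV hD hVD hxD]; exact zero_le
  set W := D ∩ Metric.ball x (ρ / (8 : ℝ≥0)) with hWdef
  have hW : IsOpen W := hD.inter Metric.isOpen_ball
  have hxz := Metric.mem_ball.1 hx
  have hWV : W ⊆ V := by
    rintro y ⟨hyD, hy⟩
    refine ⟨hyD, Metric.mem_ball.2 ?_⟩
    have h1 := Metric.mem_ball.1 hy
    have h2 := dist_triangle y x z
    push_cast at h1
    linarith
  have hWz : W ⊆ Metric.ball z (2 * ρ) := fun y hy =>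
    Metric.ball_subset_ball (by linarith) (hWV hy).2
  have hxW : x ∈ W := ⟨hxD, Metric.mem_ball_self (by positivity)⟩
  have hqW : Z.meanExit W x * σ ≤ (t ^ 4 : ℝ≥0) :=
    le_trans (mul_le_mul_left (Z.meanExit_mono hWV x) σ) hv
  have hpt : ∀ y, Z.exitLaw V y D ≤ (t⁻¹ : ℝ≥0) * (Z.meanExit V y * σ) +
      ((K * 4 ^ γ * t : ℝ≥0) * D.indicator 1 y +
        (Metric.ball x (ρ / 4))ᶜ.indicator 1 y) := by
    intro y
    by_cases hyD : y ∈ D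
    swap
    · rw [Z.exitLaw_apply_eq_zero hV hD hVD hyD]; exact zero_le
    by_cases hyB : y ∈ Metric.ball x (ρ / 4)
    · have hyx := Metric.mem_ball.1 hyB
      have hsub : D ∩ Metric.ball y (ρ / (4 : ℝ≥0)) ⊆ V := by
        rintro w ⟨hwD, hw⟩
        refine ⟨hwD, Metric.mem_ball.2 ?_⟩
        have h1 := Metric.mem_ball.1 hw
        have h2 := dist_triangle4 w y x z
        push_cast at h1
        linarith
      have h1 := Z.exitLaw_apply_anti (hD.inter Metric.isOpen_ball) hV hD hsub hVD y
      have h2 := h.fast_exit D hD y 4 (by norm_num) t⁻¹ (inv_pos.2 ht0)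
      have h3 := mul_le_mul_left (Z.meanExit_mono hsub y) σ
      refine h1.trans (h2.trans ?_)
      rw [inv_inv]
      refine add_le_add (by gcongr) (le_add_right ?_)
      simp [hyD]
    · refine (Z.exitLaw_le_one hV y D).trans ?_
      refine le_add_left (le_add_left ?_)
      simp only [indicator_of_mem (show y ∈ (Metric.ball x (ρ / 4))ᶜ from hyB), Pi.one_apply, le_rfl]
  have hA : Z.exitLaw W x D ≤ ((1 + K * 8 ^ γ) * t ^ 2 : ℝ≥0) := by
    have h2 := h.fast_exit D hD x 8 (by norm_num) (t ^ 2)⁻¹ (inv_pos.2 (by positivity))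
    refine h2.trans ?_
    rw [inv_inv]
    refine (add_le_add_left (mul_le_mul_right hqW _) _).trans ?_
    rw [show ((8 : ℝ≥0) : ℝ≥0∞) ^ γ = ((8 ^ γ : ℝ≥0) : ℝ≥0∞) by push_cast; rfl]
    norm_cast
    rw [show (t ^ 2)⁻¹ * t ^ 4 = t ^ 2 by field_simp]
    exact le_of_eq (by ring)
  have hfar : Z.exitLaw W x (Metric.ball x (ρ / 4))ᶜ ≤ (K * 8 ^ γ * K * t ^ 4 : ℝ≥0) := by
    refine (h.exitLaw_far_le hW hWz hxW Metric.isOpen_ball.measurableSet.compl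
      (Δ := 8) (by norm_num) ?_).trans ?_
    · intro w hw y hy
      have h1 := Metric.mem_ball.1 hw.2
      have h2 : ρ / 4 ≤ dist y x := not_lt.1 hy
      have h3 := dist_triangle y w x
      rw [dist_comm y w] at h3
      push_cast at h1 ⊢
      linarith
    · refine (mul_le_mul_right hqW _).trans ?_
      norm_cast
  have hvW : ∫⁻ y, Z.meanExit V y * σ ∂(Z.exitLaw W x) ≤ (t ^ 4 : ℝ≥0) := by
    refine le_trans ?_ hv
    rw [Z.meanExit_mul_of_subset hW hV hWV σ x]
    exact le_add_self
  have hm1 : Measurable fun y => ((t⁻¹ : ℝ≥0) : ℝ≥0∞) * (Z.meanExit V y * σ) :=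
    ((Z.measurable_meanExit hV).mul_const σ).const_mul _
  have hm2 : Measurable fun y => ((K * 4 ^ γ * t : ℝ≥0) : ℝ≥0∞) * D.indicator 1 y :=
    (measurable_one.indicator hD.measurableSet).const_mul _
  rw [Z.exitLaw_apply_of_subset hW hV hWV hD.measurableSet x]
  refine (lintegral_mono hpt).trans ?_
  rw [lintegral_add_left hm1, lintegral_add_left hm2, lintegral_const_mul _
    ((Z.measurable_meanExit hV).mul_const σ), lintegral_const_mul _
    (measurable_one.indicator hD.measurableSet), lintegral_indicator_one hD.measurableSet,
    lintegral_indicator_one Metric.isOpen_ball.measurableSet.compl]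
  refine (add_le_add (mul_le_mul_right hvW _) (add_le_add (mul_le_mul_right hA _) hfar)).trans ?_
  simp only [← ENNReal.coe_mul, ← ENNReal.coe_add]
  refine ENNReal.coe_le_coe.2 ?_
  rw [show t⁻¹ * t ^ 4 = t ^ 3 by field_simp]
  have h43 : t ^ 4 ≤ t ^ 3 := pow_le_pow_of_le_one zero_le ht1 (by norm_num)
  calc t ^ 3 + (K * 4 ^ γ * t * ((1 + K * 8 ^ γ) * t ^ 2) + K * 8 ^ γ * K * t ^ 4)
      ≤ t ^ 3 + (K * 4 ^ γ * t * ((1 + K * 8 ^ γ) * t ^ 2) + K * 8 ^ γ * K * t ^ 3) := by gcongr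
    _ = aprioriConst K γ * t ^ 3 := by unfold aprioriConst; ring

/-- One step of the improvement of the bound for the probability of leaving a ball inside `D`. -/
theorem improve (h : JumpEstimates Z σ N K γ z ρ) {D V : Set 𝒳} (hD : IsOpen D) (hV : IsOpen V)
    (hVD : V ⊆ D) {d a c s Δ : ℝ≥0} {G : 𝒳 → ℝ≥0∞}
    (hbound : ∀ y, Z.exitLaw V y D ≤ d * (Z.meanExit V y * σ) + (a + G y)) {x : 𝒳}
    (hs : 0 < s) (hΔ : 1 ≤ Δ) (hx : (s ^ 4 : ℝ≥0) ≤ Z.meanExit V x * σ)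
    (hWV : D ∩ Metric.ball x (ρ / Δ) ⊆ V) (hcd : c ≤ d)
    (hGc : ∫⁻ y, G y ∂(Z.exitLaw (D ∩ Metric.ball x (ρ / Δ)) x) ≤
      c * (Z.meanExit (D ∩ Metric.ball x (ρ / Δ)) x * σ)) :
    Z.exitLaw V x D ≤
      (d + a * (1 + K * Δ ^ γ) * (s ^ 2)⁻¹ : ℝ≥0) * (Z.meanExit V x * σ) := by
  set W := D ∩ Metric.ball x (ρ / Δ) with hWdef
  have hW : IsOpen W := hD.inter Metric.isOpen_ball
  set q := Z.meanExit W x * σ with hq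
  set v := Z.meanExit V x * σ with hv
  set I := ∫⁻ y, Z.meanExit V y * σ ∂(Z.exitLaw W x) with hI
  have hvI : v = q + I := Z.meanExit_mul_of_subset hW hV hWV σ x
  have hpt : ∀ y, Z.exitLaw V y D ≤
      d * (Z.meanExit V y * σ) + (a * D.indicator 1 y + G y) := by
    intro y
    by_cases hyD : y ∈ D
    · simpa [hyD] using hbound y
    · rw [Z.exitLaw_apply_eq_zero hV hD hVD hyD]; exact zero_le
  have hA : Z.exitLaw W x D ≤ ((1 + K * Δ ^ γ) * (s ^ 2)⁻¹ : ℝ≥0) * v := by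
    refine (h.fast_exit D hD x Δ hΔ (s ^ 2)⁻¹ (inv_pos.2 (by positivity))).trans ?_
    rw [inv_inv]
    have h1 : ((s ^ 2 : ℝ≥0) : ℝ≥0∞) ≤ ((s ^ 2)⁻¹ : ℝ≥0) * v := by
      refine le_trans ?_ (mul_le_mul_right hx _)
      rw [← ENNReal.coe_mul, show (s ^ 2)⁻¹ * s ^ 4 = s ^ 2 by field_simp]
    have h2 : q ≤ v := by rw [hvI]; exact le_self_add
    refine (add_le_add (mul_le_mul_right h2 _) (mul_le_mul_right h1 _)).trans (le_of_eq ?_)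
    push_cast
    ring
  have hm1 : Measurable fun y => (d : ℝ≥0∞) * (Z.meanExit V y * σ) :=
    ((Z.measurable_meanExit hV).mul_const σ).const_mul _
  have hm2 : Measurable fun y => (a : ℝ≥0∞) * D.indicator 1 y :=
    (measurable_one.indicator hD.measurableSet).const_mul _
  rw [Z.exitLaw_apply_of_subset hW hV hWV hD.measurableSet x]
  refine (lintegral_mono hpt).trans ?_
  rw [lintegral_add_left hm1, lintegral_add_left hm2, lintegral_const_mul _
    ((Z.measurable_meanExit hV).mul_const σ), lintegral_const_mul _
    (measurable_one.indicator hD.measurableSet), lintegral_indicator_one hD.measurableSet]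
  have hcq : (c : ℝ≥0∞) * q ≤ d * q := mul_le_mul_left (by exact_mod_cast hcd) _
  calc (d : ℝ≥0∞) * I + (a * Z.exitLaw W x D + ∫⁻ y, G y ∂(Z.exitLaw W x))
      ≤ d * I + (a * (((1 + K * Δ ^ γ) * (s ^ 2)⁻¹ : ℝ≥0) * v) + d * q) := by
        gcongr
        exact hGc.trans hcq
    _ = d * (q + I) + a * (((1 + K * Δ ^ γ) * (s ^ 2)⁻¹ : ℝ≥0) * v) := by ring
    _ = _ := by rw [← hvI]; push_cast; ring

theorem exitLaw_le_box (h : JumpEstimates Z σ N K γ z ρ) {D : Set 𝒳} (hD : IsOpen D) (k : ℕ) :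
    ∀ y, Z.exitLaw (D ∩ Metric.ball z ρ) y D ≤
      boxConst K γ k * (Z.meanExit (D ∩ Metric.ball z ρ) y * σ) +
        ((aprioriConst K γ * boxLevel γ k ^ 3 : ℝ≥0) + boxTail K γ z ρ k y) := by
  have hρ := h.scale_pos
  have hV : IsOpen (D ∩ Metric.ball z ρ) := hD.inter Metric.isOpen_ball
  have hVD : D ∩ Metric.ball z ρ ⊆ D := inter_subset_left
  induction k with
  | zero =>
    intro y
    refine (Z.exitLaw_le_one hV y D).trans (le_add_left (le_add_right ?_))
    rw [boxLevel, pow_zero, one_pow, mul_one, aprioriConst, add_assoc]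
    exact_mod_cast le_self_add
  | succ k ih =>
    intro y
    by_cases hyD : y ∈ D
    swap
    · rw [Z.exitLaw_apply_eq_zero hV hD hVD hyD]; exact zero_le
    by_cases hyB : y ∈ Metric.ball z (boxRadius ρ (k + 1))
    swap
    · refine (ih y).trans (add_le_add (mul_le_mul_left
        (ENNReal.coe_le_coe.2 (boxConst_mono K γ k)) _) (le_add_left ?_))
      unfold boxTail
      rw [Finset.sum_range_succ, indicator_of_mem
        (show y ∈ (Metric.ball z (boxRadius ρ (k + 1)))ᶜ from hyB), Pi.one_apply, mul_one,
        ← add_assoc, add_comm (((aprioriConst K γ * boxLevel γ k ^ 3 : ℝ≥0)) : ℝ≥0∞)]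
    have hrad : boxRadius ρ (k + 1) ≤ ρ / 2 := by
      unfold boxRadius
      have : (1 / 2 : ℝ) ^ (k + 1) ≤ 1 := pow_le_one₀ (by norm_num) (by norm_num)
      nlinarith
    by_cases hv : Z.meanExit (D ∩ Metric.ball z ρ) y * σ ≤ (boxLevel γ (k + 1) ^ 4 : ℝ≥0)
    · exact (h.apriori hD (Metric.ball_subset_ball hrad hyB) (boxLevel_pos γ (k + 1))
        (boxLevel_le_one γ (k + 1)) hv).trans (le_add_left le_self_add)
    · refine le_add_right ?_
      have hWV : D ∩ Metric.ball y (ρ / ((2 ^ (k + 4) : ℝ≥0) : ℝ)) ⊆ D ∩ Metric.ball z ρ := by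
        rintro w ⟨hwD, hw⟩
        refine ⟨hwD, Metric.mem_ball.2 ?_⟩
        have h1 := Metric.mem_ball.1 hw
        have h2 := Metric.mem_ball.1 hyB
        have h3 := dist_triangle w y z
        have h4 : ρ / ((2 ^ (k + 4) : ℝ≥0) : ℝ) ≤ ρ / 2 := by
          push_cast
          refine div_le_div_of_nonneg_left hρ.le (by norm_num) ?_
          calc (2 : ℝ) = 2 ^ 1 := by norm_num
            _ ≤ 2 ^ (k + 4) := pow_le_pow_right₀ (by norm_num) (by omega)
        linarith
      refine (h.improve hD hV hVD ih (boxLevel_pos γ (k + 1))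
        (one_le_pow₀ (by norm_num)) (not_le.1 hv).le hWV (c := boxTailConst K γ) ?_
        (h.lintegral_boxTail_le hD hyD hyB)).trans ?_
      · unfold boxConst; exact le_self_add
      · exact mul_le_mul_left (ENNReal.coe_le_coe.2 (boxConst_step K γ k)) _

/-- The constant in the bound for the probability of leaving a ball inside `D`. -/
def exitInsideConst (K : ℝ≥0) (γ : ℕ) : ℝ≥0 := boxTailConst K γ + boxIncrement K γ * 2

/-- The probability of leaving a ball before leaving `D`, for the process started at the centre, is
bounded by the normalised mean exit time from the intersection. -/
theorem exitLaw_inter_ball_le (h : JumpEstimates Z σ N K γ z ρ) {D : Set 𝒳} (hD : IsOpen D) :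
    Z.exitLaw (D ∩ Metric.ball z ρ) z D ≤
      exitInsideConst K γ * (Z.meanExit (D ∩ Metric.ball z ρ) z * σ) := by
  have hρ := h.scale_pos
  have htail : ∀ k, boxTail K γ z ρ k z = 0 := by
    intro k
    have hz : ∀ i, z ∈ Metric.ball z (boxRadius ρ i) := fun i =>
      Metric.mem_ball_self (by unfold boxRadius; positivity)
    simp [boxTail, hz]
  have hk : ∀ k, Z.exitLaw (D ∩ Metric.ball z ρ) z D ≤
      exitInsideConst K γ * (Z.meanExit (D ∩ Metric.ball z ρ) z * σ) +
        ((aprioriConst K γ * (1 / 2) ^ k : ℝ≥0) : ℝ≥0∞) := by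
    intro k
    refine (h.exitLaw_le_box hD k z).trans ?_
    rw [htail, add_zero]
    have h1 : boxConst K γ k ≤ exitInsideConst K γ := by
      unfold boxConst exitInsideConst
      gcongr
      exact sum_half_pow_le k
    have h2 : boxLevel γ k ^ 3 ≤ (1 / 2) ^ k :=
      (pow_le_of_le_one zero_le (boxLevel_le_one γ k) (by norm_num)).trans (boxLevel_le γ k)
    gcongr
  have hlim : Tendsto (fun k : ℕ => exitInsideConst K γ *
      (Z.meanExit (D ∩ Metric.ball z ρ) z * σ) +
        ((aprioriConst K γ * (1 / 2) ^ k : ℝ≥0) : ℝ≥0∞)) atTop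
      (𝓝 (exitInsideConst K γ * (Z.meanExit (D ∩ Metric.ball z ρ) z * σ) +
        ((aprioriConst K γ * 0 : ℝ≥0) : ℝ≥0∞))) := by
    refine tendsto_const_nhds.add (ENNReal.tendsto_coe.2 (Tendsto.const_mul _ ?_))
    exact tendsto_pow_atTop_nhds_zero_of_lt_one zero_le (by
      rw [← NNReal.coe_lt_coe]; norm_num)
  rw [mul_zero, ENNReal.coe_zero, add_zero] at hlim
  exact ge_of_tendsto' hlim hk

end JumpEstimates

namespace JumpEstimates

variable {𝒳 Ω : Type*} [MetricSpace 𝒳] [MeasurableSpace 𝒳] [BorelSpace 𝒳] [MeasurableSpace Ω]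
  {Z : HuntProcess 𝒳 Ω} {σ : ℝ≥0∞} {N : Measure 𝒳} {K : ℝ≥0} {γ : ℕ} {z : 𝒳} {ρ : ℝ}

/-- The mean exit time is bounded by the probability of a jump out of the ball. -/
theorem meanExit_le_exitLaw (h : JumpEstimates Z σ N K γ z ρ) {W : Set 𝒳} (hW : IsOpen W)
    (hWz : W ⊆ Metric.ball z (2 * ρ)) (x : 𝒳) :
    Z.meanExit W x * σ ≤ (K ^ 2 : ℝ≥0) * Z.exitLaw W x (Metric.ball z (2 * ρ))ᶜ := by
  have hm : MeasurableSet (Metric.ball z (2 * ρ))ᶜ := Metric.isOpen_ball.measurableSet.compl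
  have h1 := h.lower W hW hWz x ((Metric.ball z (2 * ρ))ᶜ.indicator 1)
    (measurable_one.indicator hm)
      fun w hw => indicator_of_notMem (s := (Metric.ball z (2 * ρ))ᶜ) (not_not.2 (hWz hw)) _
  rw [lintegral_indicator_one hm, lintegral_indicator_one hm] at h1
  calc Z.meanExit W x * σ ≤ Z.meanExit W x * σ * (K * N (Metric.ball z (2 * ρ))ᶜ) :=
        le_mul_of_one_le_right zero_le h.mass_compl
    _ = K * (Z.meanExit W x * σ * N (Metric.ball z (2 * ρ))ᶜ) := by ring
    _ ≤ K * (K * Z.exitLaw W x (Metric.ball z (2 * ρ))ᶜ) := by gcongr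
    _ = _ := by push_cast; ring

variable [LocallyCompactSpace 𝒳] [SecondCountableTopology 𝒳]

theorem meanExit_le (h : JumpEstimates Z σ N K γ z ρ) {W : Set 𝒳} (hW : IsOpen W)
    (hWz : W ⊆ Metric.ball z (2 * ρ)) (x : 𝒳) : Z.meanExit W x * σ ≤ (K ^ 2 : ℝ≥0) :=
  (h.meanExit_le_exitLaw hW hWz x).trans
    (mul_le_of_le_one_right zero_le (Z.exitLaw_le_one hW x _))

/-- A bound, smaller than one, for the probability of leaving a ball inside `D` without a large
jump. -/
def stayConst (K : ℝ≥0) : ℝ≥0 := (4 * (K + 1) * K ^ 2 + 1 / 4) / (1 + 4 * (K + 1) * K ^ 2)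

theorem stayConst_lt_one (K : ℝ≥0) : stayConst K < 1 := by
  unfold stayConst
  rw [div_lt_one (by positivity), add_comm]
  gcongr
  rw [← NNReal.coe_lt_coe]; norm_num

theorem exitLaw_near_le (h : JumpEstimates Z σ N K γ z ρ) {D : Set 𝒳} (hD : IsOpen D) :
    Z.exitLaw (D ∩ Metric.ball z ρ) z (D ∩ Metric.ball z (2 * ρ)) ≤ stayConst K := by
  have hρ := h.scale_pos
  set W := D ∩ Metric.ball z ρ with hWdef
  have hW : IsOpen W := hD.inter Metric.isOpen_ball
  have hWz : W ⊆ Metric.ball z (2 * ρ) := fun y hy =>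
    Metric.ball_subset_ball (by linarith) hy.2
  set a := Z.exitLaw W z (D ∩ Metric.ball z (2 * ρ)) with ha
  set b := Z.exitLaw W z (Metric.ball z (2 * ρ))ᶜ with hb
  have hm : MeasurableSet (Metric.ball z (2 * ρ))ᶜ := Metric.isOpen_ball.measurableSet.compl
  have hab : a + b ≤ 1 := by
    rw [ha, hb, ← measure_union _ hm]
    · exact Z.exitLaw_le_one hW z _
    · exact disjoint_compl_right.mono_left inter_subset_right
  have hqb : Z.meanExit W z * σ ≤ (K ^ 2 : ℝ≥0) * b := h.meanExit_le_exitLaw hW hWz z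
  set M : ℝ≥0 := 4 * (K + 1) * K ^ 2 with hM
  have hS : (0 : ℝ≥0) < 4 * (K + 1) := by positivity
  have haq : a ≤ M * b + (1 / 4 : ℝ≥0) := by
    have h1 := h.fast_exit D hD z 1 le_rfl (4 * (K + 1)) hS
    rw [NNReal.coe_one, div_one, ← hWdef] at h1
    refine (measure_mono inter_subset_left).trans (h1.trans (add_le_add ?_ ?_))
    · refine (mul_le_mul_right hqb _).trans (le_of_eq ?_)
      rw [hM]; push_cast; ring
    · rw [ENNReal.coe_one, one_pow, mul_one, ← ENNReal.coe_mul]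
      refine ENNReal.coe_le_coe.2 ?_
      rw [← div_eq_mul_inv, div_le_div_iff₀ hS (by norm_num)]
      calc K * 4 = 4 * K := mul_comm _ _
        _ ≤ 4 * (K + 1) := by gcongr; exact le_self_add
        _ = 1 * (4 * (K + 1)) := (one_mul _).symm
  have hmul : a * ((1 + M : ℝ≥0) : ℝ≥0∞) ≤ ((M + 1 / 4 : ℝ≥0) : ℝ≥0∞) := by
    calc a * ((1 + M : ℝ≥0) : ℝ≥0∞) = a + M * a := by push_cast; ring
      _ ≤ (M * b + (1 / 4 : ℝ≥0)) + M * a := by gcongr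
      _ = M * (a + b) + (1 / 4 : ℝ≥0) := by ring
      _ ≤ M * 1 + (1 / 4 : ℝ≥0) := by gcongr
      _ = _ := by rw [mul_one, ENNReal.coe_add]
  have hpos : (1 + M : ℝ≥0) ≠ 0 := by positivity
  rw [stayConst, ENNReal.coe_div hpos]
  rw [ENNReal.le_div_iff_mul_le (Or.inl (by exact_mod_cast hpos)) (Or.inl ENNReal.coe_ne_top)]
  exact hmul

section Harmonic

variable {ξ : 𝒳} {r : ℝ} {D : Set 𝒳} {f : 𝒳 → ℝ≥0∞}

theorem lintegral_exitLaw_eq_zero (hD : IsOpen D) (hf : Measurable f)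
    (hf0 : ∀ y ∈ Metric.ball ξ (2 * r), f y = 0) {y : 𝒳} (hy : y ∈ Metric.ball ξ (2 * r))
    (hyD : y ∉ D) : ∫⁻ w, f w ∂(Z.exitLaw (D ∩ Metric.ball ξ (2 * r)) y) = 0 := by
  rw [Z.exitLaw_of_notMem (hD.inter Metric.isOpen_ball) fun h => hyD h.1, lintegral_dirac' _ hf]
  exact hf0 y hy

/-- A harmonic function at a point, in terms of its values nearby and of its mean. -/
theorem harmonic_le (h : JumpEstimates Z σ N K γ ξ r) (hD : IsOpen D) (hf : Measurable f)
    (hf0 : ∀ y ∈ Metric.ball ξ (2 * r), f y = 0) {x : 𝒳} (hx : x ∈ D) {Δ : ℝ≥0} (hΔ : 1 ≤ Δ)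
    (hxξ : Metric.ball x (2 * (r / Δ)) ⊆ Metric.ball ξ (2 * r)) {M : ℝ≥0∞}
    (hM : ∀ y ∈ D ∩ Metric.ball x (2 * (r / Δ)),
      ∫⁻ w, f w ∂(Z.exitLaw (D ∩ Metric.ball ξ (2 * r)) y) ≤ M) :
    ∫⁻ w, f w ∂(Z.exitLaw (D ∩ Metric.ball ξ (2 * r)) x) ≤
      M * Z.exitLaw (D ∩ Metric.ball x (r / Δ)) x (D ∩ Metric.ball x (2 * (r / Δ))) +
        K * Δ ^ γ * (Z.meanExit (D ∩ Metric.ball x (r / Δ)) x * σ *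
          ∫⁻ y, ∫⁻ w, f w ∂(Z.exitLaw (D ∩ Metric.ball ξ (2 * r)) y) ∂N) := by
  have hr := h.scale_pos
  have hΔ0 : (0 : ℝ) < Δ := lt_of_lt_of_le one_pos (by exact_mod_cast hΔ)
  have hrΔ : 0 < r / Δ := div_pos hr hΔ0
  set U := D ∩ Metric.ball ξ (2 * r) with hUdef
  set W := D ∩ Metric.ball x (r / Δ) with hWdef
  set H : 𝒳 → ℝ≥0∞ := fun y => ∫⁻ w, f w ∂(Z.exitLaw U y) with hH
  have hU : IsOpen U := hD.inter Metric.isOpen_ball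
  have hW : IsOpen W := hD.inter Metric.isOpen_ball
  have hball : Metric.ball x (r / Δ) ⊆ Metric.ball x (2 * (r / Δ)) :=
    Metric.ball_subset_ball (by linarith)
  have hWU : W ⊆ U := fun y hy => ⟨hy.1, hxξ (hball hy.2)⟩
  have hHm : Measurable H := Z.measurable_lintegral_exitLaw hU hf
  have hxW : x ∈ W := ⟨hx, Metric.mem_ball_self hrΔ⟩
  have hBm : MeasurableSet (Metric.ball x (2 * (r / Δ)))ᶜ :=
    Metric.isOpen_ball.measurableSet.compl
  have hDm : MeasurableSet (D ∩ Metric.ball x (2 * (r / Δ))) :=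
    (hD.inter Metric.isOpen_ball).measurableSet
  have hpt : ∀ y, H y ≤ M * (D ∩ Metric.ball x (2 * (r / Δ))).indicator 1 y +
      (Metric.ball x (2 * (r / Δ)))ᶜ.indicator H y := by
    intro y
    by_cases hyB : y ∈ Metric.ball x (2 * (r / Δ))
    · by_cases hyD : y ∈ D
      · refine le_add_right ?_
        rw [indicator_of_mem (show y ∈ D ∩ Metric.ball x (2 * (r / Δ)) from ⟨hyD, hyB⟩),
          Pi.one_apply, mul_one]
        exact hM y ⟨hyD, hyB⟩
      · rw [hH]
        simp only
        rw [lintegral_exitLaw_eq_zero hD hf hf0 (hxξ hyB) hyD]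
        exact zero_le
    · rw [indicator_of_mem (show y ∈ (Metric.ball x (2 * (r / Δ)))ᶜ from hyB)]
      exact le_add_self
  have hfar : ∫⁻ y, (Metric.ball x (2 * (r / Δ)))ᶜ.indicator H y ∂(Z.exitLaw W x) ≤
      K * Δ ^ γ * (Z.meanExit W x * σ * ∫⁻ y, H y ∂N) := by
    refine (h.upper W hW (fun y hy => (hWU hy).2) x hxW _ (hHm.indicator hBm) Δ hΔ ?_).trans ?_
    · intro w hw y hy
      refine indicator_of_notMem (show y ∉ (Metric.ball x (2 * (r / Δ)))ᶜ from not_not.2 ?_) _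
      have h1 := Metric.mem_ball.1 hw.2
      have h2 := dist_triangle y w x
      rw [dist_comm y w] at h2
      exact Metric.mem_ball.2 (by linarith)
    · gcongr
      exact indicator_le_self _ _ _
  have hHx : H x = ∫⁻ y, H y ∂(Z.exitLaw W x) := Z.lintegral_exitLaw_of_subset hW hU hWU hf x
  change H x ≤ _
  rw [hHx]
  refine (lintegral_mono hpt).trans ?_
  rw [lintegral_add_left ((measurable_one.indicator hDm).const_mul M),
    lintegral_const_mul _ (measurable_one.indicator hDm), lintegral_indicator_one hDm]
  gcongr

/-- Carleson-type estimate: a bounded non-negative function that is harmonic in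
`D ∩ B(ξ, 2r)` and vanishes on `B(ξ, 2r) \ D` is controlled by its mean. -/
theorem harmonic_le_mean (h : JumpEstimates Z σ N K γ ξ r) {σ' : ℝ → ℝ≥0∞}
    {N' : 𝒳 → ℝ → Measure 𝒳}
    (h' : ∀ z ρ, 0 < ρ → ρ ≤ r → JumpEstimates Z (σ' ρ) (N' z ρ) K γ z ρ)
    (hD : IsOpen D) (hf : Measurable f) (hf0 : ∀ y ∈ Metric.ball ξ (2 * r), f y = 0) {B : ℝ≥0}
    (hfB : ∀ y, f y ≤ B) {κ : ℝ} {Θ Δ : ℝ≥0} (hκ : κ < 2) (hΘ : 1 < Θ)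
    (hΘK : stayConst K * Θ ^ γ < 1) (hΔ : 1 ≤ Δ)
    (hΔκ : 2 ≤ (Δ : ℝ) * (2 - κ) * (1 - 1 / Θ)) {x : 𝒳} (hx : x ∈ D ∩ Metric.ball ξ (κ * r)) :
    ∫⁻ w, f w ∂(Z.exitLaw (D ∩ Metric.ball ξ (2 * r)) x) ≤
      (K ^ 3 * Δ ^ γ * (1 - stayConst K * Θ ^ γ)⁻¹ : ℝ≥0) *
        ∫⁻ y, ∫⁻ w, f w ∂(Z.exitLaw (D ∩ Metric.ball ξ (2 * r)) y) ∂N := by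
  have hr := h.scale_pos
  set U := D ∩ Metric.ball ξ (2 * r) with hUdef
  have hU : IsOpen U := hD.inter Metric.isOpen_ball
  set H : 𝒳 → ℝ≥0∞ := fun y => ∫⁻ w, f w ∂(Z.exitLaw U y) with hH
  set A := ∫⁻ y, H y ∂N with hA
  set p := stayConst K with hp
  have hΘ0 : (0 : ℝ) < Θ := lt_trans one_pos (by exact_mod_cast hΘ)
  have hΔ0 : (0 : ℝ) < Δ := lt_of_lt_of_le one_pos (by exact_mod_cast hΔ)
  let R : ℕ → ℝ := fun n => r * (2 - (2 - κ) * (1 / Θ) ^ n)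
  have hHB : ∀ y, H y ≤ B := by
    intro y
    calc H y ≤ ∫⁻ _w, (B : ℝ≥0∞) ∂(Z.exitLaw U y) := lintegral_mono hfB
      _ = B * Z.exitLaw U y univ := lintegral_const _
      _ ≤ B := mul_le_of_le_one_right zero_le (Z.exitLaw_univ_le_one hU y)
  have hΔn : ∀ n : ℕ, 1 ≤ Δ * Θ ^ n := fun n =>
    one_le_mul_of_one_le_of_one_le hΔ (one_le_pow₀ hΘ.le)
  have hiter : ∀ m n : ℕ, ∀ y ∈ D ∩ Metric.ball ξ (R n), H y ≤ p ^ m * B +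
      (K ^ 3 * ∑ j ∈ Finset.range m, p ^ j * (Δ * Θ ^ (n + j)) ^ γ : ℝ≥0) * A := by
    intro m
    induction m with
    | zero => intro n y _; simpa using hHB y
    | succ m ih =>
      intro n y hy
      have hΔn0 : (0 : ℝ) < ((Δ * Θ ^ n : ℝ≥0) : ℝ) := by push_cast; positivity
      have hρ : 0 < r / ((Δ * Θ ^ n : ℝ≥0) : ℝ) := div_pos hr hΔn0
      have hρr : r / ((Δ * Θ ^ n : ℝ≥0) : ℝ) ≤ r :=
        div_le_self hr.le (by exact_mod_cast hΔn n)
      have hstep : R n + 2 * (r / ((Δ * Θ ^ n : ℝ≥0) : ℝ)) ≤ R (n + 1) := by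
        have hinv : r / ((Δ * Θ ^ n : ℝ≥0) : ℝ) = r * (1 / Θ) ^ n / Δ := by
          push_cast
          rw [one_div, inv_pow]
          field_simp
        have h1 : 2 / (Δ : ℝ) ≤ (2 - κ) * (1 - 1 / Θ) := by
          rw [div_le_iff₀ hΔ0]; linarith
        have h2 : 0 ≤ r * (1 / (Θ : ℝ)) ^ n := by positivity
        have h3 := mul_le_mul_of_nonneg_left h1 h2
        rw [hinv]
        simp only [R, pow_succ]
        have h4 : 2 * (r * (1 / (Θ : ℝ)) ^ n / Δ) = r * (1 / (Θ : ℝ)) ^ n * (2 / Δ) := by ring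
        rw [h4]
        linarith
      have hR2 : R (n + 1) ≤ 2 * r := by
        have : 0 ≤ (2 - κ) * (1 / (Θ : ℝ)) ^ (n + 1) := by
          have : 0 < 2 - κ := by linarith
          positivity
        simp only [R]
        nlinarith
      have hsub : Metric.ball y (2 * (r / ((Δ * Θ ^ n : ℝ≥0) : ℝ))) ⊆ Metric.ball ξ (R (n + 1)) := by
        intro w hw
        have h1 := Metric.mem_ball.1 hw
        have h2 := Metric.mem_ball.1 hy.2
        have h3 := dist_triangle w y ξ
        exact Metric.mem_ball.2 (by linarith)
      have hmain := h.harmonic_le hD hf hf0 hy.1 (hΔn n)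
        (hsub.trans (Metric.ball_subset_ball hR2)) (fun w hw => ih (n + 1) w ⟨hw.1, hsub hw.2⟩)
      have hstay := (h' y _ hρ hρr).exitLaw_near_le hD
      have hq : Z.meanExit (D ∩ Metric.ball y (r / ((Δ * Θ ^ n : ℝ≥0) : ℝ))) y * σ ≤
          (K ^ 2 : ℝ≥0) := by
        refine h.meanExit_le (hD.inter Metric.isOpen_ball) (fun w hw => ?_) y
        exact Metric.ball_subset_ball hR2
          (hsub (Metric.ball_subset_ball (by linarith) hw.2))
      refine hmain.trans ?_
      refine (add_le_add (mul_le_mul_right hstay _)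
        (mul_le_mul_right (mul_le_mul_left hq _) _)).trans (le_of_eq ?_)
      rw [Finset.sum_range_succ']
      have hsum : ∑ j ∈ Finset.range m, p ^ (j + 1) * (Δ * Θ ^ (n + (j + 1))) ^ γ =
          p * ∑ j ∈ Finset.range m, p ^ j * (Δ * Θ ^ (n + 1 + j)) ^ γ := by
        rw [Finset.mul_sum]
        refine Finset.sum_congr rfl fun j _ => ?_
        rw [show n + (j + 1) = n + 1 + j by ring]
        ring
      rw [hsum]
      push_cast
      ring
  have hgeo : ∀ m : ℕ, ∑ j ∈ Finset.range m, p ^ j * (Δ * Θ ^ (0 + j)) ^ γ ≤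
      Δ ^ γ * (1 - p * Θ ^ γ)⁻¹ := by
    intro m
    have h1 : ∀ j, p ^ j * (Δ * Θ ^ (0 + j)) ^ γ = Δ ^ γ * (p * Θ ^ γ) ^ j := by
      intro j
      rw [zero_add, mul_pow, mul_pow, ← pow_mul, ← pow_mul, mul_comm j γ]
      ring
    simp_rw [h1]
    rw [← Finset.mul_sum]
    gcongr
    have hs := NNReal.hasSum_geometric hΘK
    exact sum_le_hasSum _ (fun _ _ => zero_le) hs
  have hx0 : x ∈ D ∩ Metric.ball ξ (R 0) := by
    refine ⟨hx.1, ?_⟩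
    have : R 0 = κ * r := by simp only [R, pow_zero]; ring
    rw [this]; exact hx.2
  have hbound : ∀ m : ℕ, H x ≤ p ^ m * B + (K ^ 3 * Δ ^ γ * (1 - p * Θ ^ γ)⁻¹ : ℝ≥0) * A := by
    intro m
    refine (hiter m 0 x hx0).trans ?_
    rw [mul_assoc (K ^ 3)]
    gcongr
    exact hgeo m
  have hlim : Tendsto (fun m : ℕ => (p : ℝ≥0∞) ^ m * B +
      (K ^ 3 * Δ ^ γ * (1 - p * Θ ^ γ)⁻¹ : ℝ≥0) * A) atTop
      (𝓝 (0 * B + (K ^ 3 * Δ ^ γ * (1 - p * Θ ^ γ)⁻¹ : ℝ≥0) * A)) := by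
    refine Tendsto.add_const _ (ENNReal.Tendsto.mul_const ?_ (Or.inr ENNReal.coe_ne_top))
    exact ENNReal.tendsto_pow_atTop_nhds_zero_of_lt_one
      (by exact_mod_cast stayConst_lt_one K)
  rw [zero_mul, zero_add] at hlim
  exact ge_of_tendsto' hlim hbound

/-- Factorisation of a bounded harmonic function near the boundary: it is comparable to the mean
exit time from a small ball times its mean. -/
theorem harmonic_factorization (h : JumpEstimates Z σ N K γ ξ r) {σ' : ℝ≥0∞} {N' : Measure 𝒳}
    {x : 𝒳} {Δ C : ℝ≥0} (h' : JumpEstimates Z σ' N' K γ x (r / Δ)) (hσ : σ' ≤ K * Δ ^ γ * σ)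
    (hD : IsOpen D) (hf : Measurable f) (hf0 : ∀ y ∈ Metric.ball ξ (2 * r), f y = 0) {B : ℝ≥0}
    (hfB : ∀ y, f y ≤ B) (hΔ : 1 ≤ Δ) (hx : x ∈ D)
    (hxξ : Metric.ball x (2 * (r / Δ)) ⊆ Metric.ball ξ (2 * r))
    (hC : ∀ y ∈ D ∩ Metric.ball x (2 * (r / Δ)),
      ∫⁻ w, f w ∂(Z.exitLaw (D ∩ Metric.ball ξ (2 * r)) y) ≤
        C * ∫⁻ y, ∫⁻ w, f w ∂(Z.exitLaw (D ∩ Metric.ball ξ (2 * r)) y) ∂N)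
    (hsmall : 2 * C * N (Metric.ball x (r / Δ)) ≤ 1) :
    ∫⁻ w, f w ∂(Z.exitLaw (D ∩ Metric.ball ξ (2 * r)) x) ≤
      (C * exitInsideConst K γ * K * Δ ^ γ + K * Δ ^ γ : ℝ≥0) *
        (Z.meanExit (D ∩ Metric.ball x (r / Δ)) x * σ *
          ∫⁻ y, ∫⁻ w, f w ∂(Z.exitLaw (D ∩ Metric.ball ξ (2 * r)) y) ∂N) ∧
    Z.meanExit (D ∩ Metric.ball x (r / Δ)) x * σ *
        ∫⁻ y, ∫⁻ w, f w ∂(Z.exitLaw (D ∩ Metric.ball ξ (2 * r)) y) ∂N ≤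
      (2 * K : ℝ≥0) * ∫⁻ w, f w ∂(Z.exitLaw (D ∩ Metric.ball ξ (2 * r)) x) := by
  have hr := h.scale_pos
  have hrΔ := h'.scale_pos
  have hU : IsOpen (D ∩ Metric.ball ξ (2 * r)) := hD.inter Metric.isOpen_ball
  have hW : IsOpen (D ∩ Metric.ball x (r / Δ)) := hD.inter Metric.isOpen_ball
  have hball : Metric.ball x (r / Δ) ⊆ Metric.ball x (2 * (r / Δ)) :=
    Metric.ball_subset_ball (by linarith)
  have hmain := h.harmonic_le hD hf hf0 hx hΔ hxξ hC
  have hbox := h'.exitLaw_inter_ball_le hD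
  set U := D ∩ Metric.ball ξ (2 * r) with hUdef
  set W := D ∩ Metric.ball x (r / Δ) with hWdef
  have hWU : W ⊆ U := fun y hy => ⟨hy.1, hxξ (hball hy.2)⟩
  set H : 𝒳 → ℝ≥0∞ := fun y => ∫⁻ w, f w ∂(Z.exitLaw U y) with hH
  have hHm : Measurable H := Z.measurable_lintegral_exitLaw hU hf
  set A := ∫⁻ y, H y ∂N with hA
  set T := Z.meanExit W x with hT
  constructor
  · have h1 : Z.exitLaw W x (D ∩ Metric.ball x (2 * (r / Δ))) ≤
        exitInsideConst K γ * (T * (K * Δ ^ γ * σ)) :=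
      (measure_mono inter_subset_left).trans (hbox.trans (by gcongr))
    refine hmain.trans ((add_le_add_left (mul_le_mul_right h1 _) _).trans (le_of_eq ?_))
    push_cast
    ring
  · have hHB : ∀ y, H y ≤ B := by
      intro y
      calc H y ≤ ∫⁻ _w, (B : ℝ≥0∞) ∂(Z.exitLaw U y) := lintegral_mono hfB
        _ = B * Z.exitLaw U y univ := lintegral_const _
        _ ≤ B := mul_le_of_le_one_right zero_le (Z.exitLaw_univ_le_one hU y)
    have hAfin : A ≠ ⊤ := by
      refine ne_top_of_le_ne_top (b := (B : ℝ≥0∞) * K) ?_ ?_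
      · exact ENNReal.mul_ne_top ENNReal.coe_ne_top ENNReal.coe_ne_top
      · calc A ≤ ∫⁻ _y, (B : ℝ≥0∞) ∂N := lintegral_mono hHB
          _ = B * N univ := lintegral_const _
          _ ≤ B * K := by gcongr; exact h.mass_le
    have hWm : MeasurableSet W := hW.measurableSet
    have hsplit : A = ∫⁻ y in W, H y ∂N + ∫⁻ y, Wᶜ.indicator H y ∂N := by
      rw [lintegral_indicator hWm.compl]
      exact (lintegral_add_compl H hWm).symm
    have hWle : 2 * ∫⁻ y in W, H y ∂N ≤ A := by
      have h1 : ∫⁻ y in W, H y ∂N ≤ C * A * N (Metric.ball x (r / Δ)) := by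
        calc ∫⁻ y in W, H y ∂N ≤ ∫⁻ _y in W, C * A ∂N :=
              setLIntegral_mono measurable_const fun y hy => hC y ⟨hy.1, hball hy.2⟩
          _ = C * A * N W := setLIntegral_const _ _
          _ ≤ _ := by gcongr; exact inter_subset_right
      calc 2 * ∫⁻ y in W, H y ∂N ≤ 2 * (C * A * N (Metric.ball x (r / Δ))) := by gcongr
        _ = (2 * C * N (Metric.ball x (r / Δ))) * A := by ring
        _ ≤ A := mul_le_of_le_one_left zero_le hsmall
    have hA2 : A ≤ 2 * ∫⁻ y, Wᶜ.indicator H y ∂N := by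
      have h2 : A + A ≤ A + 2 * ∫⁻ y, Wᶜ.indicator H y ∂N := by
        calc A + A = 2 * ∫⁻ y in W, H y ∂N + 2 * ∫⁻ y, Wᶜ.indicator H y ∂N := by
              rw [← mul_add, ← hsplit, two_mul]
          _ ≤ _ := by gcongr
      exact (ENNReal.add_le_add_iff_left hAfin).1 h2
    have hlow := h.lower W hW (fun y hy => (hWU hy).2) x (Wᶜ.indicator H)
      (hHm.indicator hWm.compl) fun w hw => indicator_of_notMem (show w ∉ Wᶜ from not_not.2 hw) _
    have hHx : H x = ∫⁻ y, H y ∂(Z.exitLaw W x) := Z.lintegral_exitLaw_of_subset hW hU hWU hf x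
    calc T * σ * A ≤ T * σ * (2 * ∫⁻ y, Wᶜ.indicator H y ∂N) := by gcongr
      _ = 2 * (T * σ * ∫⁻ y, Wᶜ.indicator H y ∂N) := by ring
      _ ≤ 2 * (K * ∫⁻ y, Wᶜ.indicator H y ∂(Z.exitLaw W x)) := by gcongr
      _ ≤ 2 * (K * ∫⁻ y, H y ∂(Z.exitLaw W x)) := by
          gcongr
          exact indicator_le_self _ _ _
      _ = (2 * K : ℝ≥0) * H x := by rw [← hHx]; push_cast; ring

end Harmonic

end JumpEstimates

/-! ### Volume growth -/

section VolumeDoubling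

variable {𝒳 : Type*} [MetricSpace 𝒳] [MeasurableSpace 𝒳] {m : Measure 𝒳} {c : ℝ}

theorem VolumeDoubling.measure_ball_two_pow_le (h : VolumeDoubling m c) (x : 𝒳) {r : ℝ}
    (hr : 0 < r) (n : ℕ) :
    m (Metric.ball x (2 ^ n * r)) ≤ ENNReal.ofReal c ^ n * m (Metric.ball x r) := by
  induction n with
  | zero => simp
  | succ n ih =>
    calc m (Metric.ball x (2 ^ (n + 1) * r)) = m (Metric.ball x (2 * (2 ^ n * r))) := by ring_nf
      _ ≤ ENNReal.ofReal c * m (Metric.ball x (2 ^ n * r)) := h x _ (by positivity)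
      _ ≤ ENNReal.ofReal c * (ENNReal.ofReal c ^ n * m (Metric.ball x r)) := by gcongr
      _ = _ := by ring

/-- Under volume doubling, the volume of balls grows at most polynomially. -/
theorem VolumeDoubling.measure_ball_mul_le (h : VolumeDoubling m c) {α : ℕ} (hα : c ≤ 2 ^ α)
    (x : 𝒳) {r : ℝ} (hr : 0 < r) {s : ℝ≥0} (hs : 1 ≤ s) :
    m (Metric.ball x (s * r)) ≤ (2 * s : ℝ≥0) ^ α * m (Metric.ball x r) := by
  obtain ⟨n, hn, hn'⟩ := exists_nat_pow_near (show (1 : ℝ) ≤ s from hs) one_lt_two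
  calc m (Metric.ball x (s * r)) ≤ m (Metric.ball x (2 ^ (n + 1) * r)) :=
        measure_mono (Metric.ball_subset_ball (by gcongr))
    _ ≤ ENNReal.ofReal c ^ (n + 1) * m (Metric.ball x r) := h.measure_ball_two_pow_le x hr _
    _ ≤ (2 * s : ℝ≥0) ^ α * m (Metric.ball x r) := by
        refine mul_le_mul' ?_ le_rfl
        have h1 : ENNReal.ofReal c ≤ ((2 ^ α : ℝ≥0) : ℝ≥0∞) := by
          rw [ENNReal.ofReal_le_iff_le_toReal ENNReal.coe_ne_top]
          simpa using hα
        have h2 : (2 : ℝ≥0) ^ (n + 1) ≤ 2 * s := by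
          rw [pow_succ, mul_comm]
          have : (2 : ℝ≥0) ^ n ≤ s := by exact_mod_cast hn
          gcongr
        calc ENNReal.ofReal c ^ (n + 1) ≤ ((2 ^ α : ℝ≥0) : ℝ≥0∞) ^ (n + 1) := by gcongr
          _ = (((2 ^ (n + 1)) ^ α : ℝ≥0) : ℝ≥0∞) := by
              rw [← ENNReal.coe_pow, ← pow_mul, ← pow_mul, mul_comm]
          _ ≤ (((2 * s) ^ α : ℝ≥0) : ℝ≥0∞) := by gcongr
          _ = _ := ENNReal.coe_pow _ _

theorem VolumeDoubling.measure_ball_lt_top (h : VolumeDoubling m c) [LocallyCompactSpace 𝒳]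
    [IsFiniteMeasureOnCompacts m] (x : 𝒳) (r : ℝ) : m (Metric.ball x r) < ⊤ := by
  obtain ⟨k, hk, hkx⟩ := exists_compact_mem_nhds x
  obtain ⟨ε, hε, hεk⟩ := Metric.mem_nhds_iff.1 hkx
  obtain ⟨n, hn⟩ := pow_unbounded_of_one_lt (r / ε) one_lt_two
  calc m (Metric.ball x r) ≤ m (Metric.ball x (2 ^ n * ε)) :=
        measure_mono (Metric.ball_subset_ball ((div_le_iff₀ hε).1 hn.le))
    _ ≤ ENNReal.ofReal c ^ n * m (Metric.ball x ε) := h.measure_ball_two_pow_le x hε n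
    _ < ⊤ := ENNReal.mul_lt_top (ENNReal.pow_lt_top ENNReal.ofReal_lt_top)
        ((measure_mono hεk).trans_lt hk.measure_lt_top)

theorem VolumeDoubling.sigmaFinite (h : VolumeDoubling m c) [LocallyCompactSpace 𝒳]
    [IsFiniteMeasureOnCompacts m] (z : 𝒳) : SigmaFinite m :=
  ⟨⟨{ set := fun n => Metric.ball z n
      set_mem := fun _ => trivial
      finite := fun n => h.measure_ball_lt_top z n
      spanning := Metric.iUnion_ball_nat z }⟩⟩

end VolumeDoubling

/-- A metric space that carries a σ-finite measure of full support is second countable. -/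
theorem secondCountableTopology_of_sigmaFinite {𝒳 : Type*} [MetricSpace 𝒳] [MeasurableSpace 𝒳]
    [BorelSpace 𝒳] (m : Measure 𝒳) [SigmaFinite m] [m.IsOpenPosMeasure] :
    SecondCountableTopology 𝒳 := by
  refine Metric.secondCountable_of_almost_dense_set fun ε hε => ?_
  obtain ⟨s, hs⟩ := zorn_subset {s : Set 𝒳 | s.Pairwise fun x y => ε < dist x y} (by
    intro c hc hchain
    refine ⟨⋃₀ c, ?_, fun s hs => subset_sUnion_of_mem hs⟩
    exact (pairwise_sUnion hchain.directedOn).2 hc)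
  refine ⟨s, ?_, fun x => ?_⟩
  · have h1 := Measure.countable_meas_pos_of_disjoint_iUnion (μ := m)
      (As := fun x : s => Metric.ball (x : 𝒳) (ε / 2)) (fun _ => Metric.isOpen_ball.measurableSet)
      (fun x y hxy => Metric.ball_disjoint_ball (by
        have := hs.prop x.2 y.2 (fun h => hxy (Subtype.ext h))
        linarith))
    have h2 : {x : s | 0 < m (Metric.ball (x : 𝒳) (ε / 2))} = univ :=
      eq_univ_of_forall fun x => Metric.measure_ball_pos m _ (half_pos hε)
    rw [h2, countable_univ_iff] at h1
    exact h1
  · by_contra! hx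
    have hins : (insert x s).Pairwise fun x y => ε < dist x y :=
      hs.prop.insert fun y hy _ => ⟨hx y hy, by rw [dist_comm]; exact hx y hy⟩
    have hmem := hs.mem_of_prop_insert hins
    have := hx x hmem
    rw [dist_self] at this
    exact absurd this hε.not_gt

section Scale

variable {φ : ℝ → ℝ} {c β : ℝ}

theorem IsScaleFunction.pos (h : IsScaleFunction φ c β) {r : ℝ} (hr : 0 < r) : 0 < φ r := by
  have := h.strictMonoOn (mem_Ici.2 le_rfl) (mem_Ici.2 hr.le) hr
  rwa [h.map_zero] at this

theorem IsScaleFunction.mono (h : IsScaleFunction φ c β) {r s : ℝ} (hr : 0 < r) (hrs : r ≤ s) :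
    φ r ≤ φ s :=
  h.strictMonoOn.monotoneOn (mem_Ici.2 hr.le) (mem_Ici.2 (hr.le.trans hrs)) hrs

theorem IsScaleFunction.map_mul_le (h : IsScaleFunction φ c β) (hc : 0 ≤ c) {β' : ℕ} (hβ : β ≤ β')
    {r : ℝ} (hr : 0 < r) {s : ℝ≥0} (hs : 1 ≤ s) :
    ENNReal.ofReal (φ (s * r)) ≤ (c.toNNReal * s ^ β' : ℝ≥0) * ENNReal.ofReal (φ r) := by
  have hs1 : (1 : ℝ) ≤ s := hs
  have h1 := h.doubling r (s * r) hr (le_mul_of_one_le_left hr.le hs1)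
  rw [div_le_iff₀ (h.pos hr), mul_div_cancel_right₀ _ hr.ne'] at h1
  have h2 : (s : ℝ) ^ β ≤ (s : ℝ) ^ β' := by
    rw [← Real.rpow_natCast]
    exact Real.rpow_le_rpow_of_exponent_le hs1 hβ
  have h3 : (((c.toNNReal * s ^ β' : ℝ≥0) : ℝ≥0∞)) = ENNReal.ofReal (c * (s : ℝ) ^ β') := by
    rw [ENNReal.ofReal, Real.toNNReal_mul hc, Real.toNNReal_pow s.coe_nonneg, Real.toNNReal_coe]
  rw [h3, ← ENNReal.ofReal_mul (by positivity)]
  refine ENNReal.ofReal_le_ofReal (h1.trans ?_)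
  have := (h.pos hr).le
  gcongr

theorem ScaleReverseDoubling.pow_mul_le {a b : ℝ} (h : ScaleReverseDoubling φ a b) (ha : 0 < a)
    (hb : 0 ≤ b) {r : ℝ} (hr : 0 < r) (n : ℕ) : b ^ n * φ r ≤ φ (a ^ n * r) := by
  induction n with
  | zero => simp
  | succ n ih =>
    calc b ^ (n + 1) * φ r = b * (b ^ n * φ r) := by ring
      _ ≤ b * φ (a ^ n * r) := by gcongr
      _ ≤ φ (a * (a ^ n * r)) := h _ (by positivity)
      _ = _ := by ring_nf

end Scale

/-! ### The reference measures -/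

/-- `V(z, s) φ(s)`. -/
def jumpScale {𝒳 : Type*} [MetricSpace 𝒳] [MeasurableSpace 𝒳] (m : Measure 𝒳) (φ : ℝ → ℝ) (z : 𝒳)
    (s : ℝ) : ℝ≥0∞ :=
  m (Metric.ball z s) * ENNReal.ofReal (φ s)

/-- The measure `φ(ρ) / (V(z, ρ + d(z, y)) φ(ρ + d(z, y))) m(dy)`. -/
def refMeasure {𝒳 : Type*} [MetricSpace 𝒳] [MeasurableSpace 𝒳] (m : Measure 𝒳) (φ : ℝ → ℝ) (z : 𝒳)
    (ρ : ℝ) : Measure 𝒳 :=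
  m.withDensity fun y => ENNReal.ofReal (φ ρ) * (jumpScale m φ z (ρ + dist z y))⁻¹

/-- `φ` is positive and increasing, balls have finite positive volume, and the volume and `φ` grow at
most polynomially, uniformly in the location and the scale. -/
structure PolynomialGrowth {𝒳 : Type*} [MetricSpace 𝒳] [MeasurableSpace 𝒳] (m : Measure 𝒳)
    (φ : ℝ → ℝ) (M : ℝ≥0) (γ : ℕ) : Prop where
  measure_lt_top : ∀ z r, m (Metric.ball z r) < ⊤
  measure_pos : ∀ z r, 0 < r → 0 < m (Metric.ball z r)
  scale_pos : ∀ r, 0 < r → 0 < φ r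
  scale_mono : ∀ r s, 0 < r → r ≤ s → φ r ≤ φ s
  measure_mul_le : ∀ (z : 𝒳) (r : ℝ), 0 < r → ∀ s : ℝ≥0, 1 ≤ s →
    m (Metric.ball z (s * r)) ≤ (M * s ^ γ : ℝ≥0) * m (Metric.ball z r)
  scale_mul_le : ∀ r : ℝ, 0 < r → ∀ s : ℝ≥0, 1 ≤ s →
    ENNReal.ofReal (φ (s * r)) ≤ (M * s ^ γ : ℝ≥0) * ENNReal.ofReal (φ r)

theorem inv_le_mul_inv {A B c : ℝ≥0∞} (h : A ≤ c * B) (hA : A ≠ 0) (hA' : A ≠ ⊤) (hB : B ≠ 0)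
    (hB' : B ≠ ⊤) : B⁻¹ ≤ c * A⁻¹ := by
  calc B⁻¹ = B⁻¹ * (A * A⁻¹) := by rw [ENNReal.mul_inv_cancel hA hA', mul_one]
    _ ≤ B⁻¹ * (c * B * A⁻¹) := by gcongr
    _ = c * A⁻¹ * (B * B⁻¹) := by ring
    _ = c * A⁻¹ := by rw [ENNReal.mul_inv_cancel hB hB', mul_one]

namespace PolynomialGrowth

variable {𝒳 : Type*} [MetricSpace 𝒳] [MeasurableSpace 𝒳] {m : Measure 𝒳} {φ : ℝ → ℝ} {M : ℝ≥0}
  {γ : ℕ} {z w y : 𝒳} {ρ : ℝ}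

theorem ofReal_scale_ne_zero (h : PolynomialGrowth m φ M γ) {s : ℝ} (hs : 0 < s) :
    ENNReal.ofReal (φ s) ≠ 0 :=
  (ENNReal.ofReal_pos.2 (h.scale_pos s hs)).ne'

theorem jumpScale_ne_zero (h : PolynomialGrowth m φ M γ) (z : 𝒳) {s : ℝ} (hs : 0 < s) :
    jumpScale m φ z s ≠ 0 :=
  mul_ne_zero (h.measure_pos z s hs).ne' (h.ofReal_scale_ne_zero hs)

theorem jumpScale_ne_top (h : PolynomialGrowth m φ M γ) (z : 𝒳) (s : ℝ) :
    jumpScale m φ z s ≠ ⊤ :=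
  ENNReal.mul_ne_top (h.measure_lt_top z s).ne ENNReal.ofReal_ne_top

theorem jumpScale_mono (h : PolynomialGrowth m φ M γ) {s t : ℝ} (hs : 0 < s)
    (hst : s + dist z w ≤ t) : jumpScale m φ z s ≤ jumpScale m φ w t :=
  mul_le_mul' (measure_mono (Metric.ball_subset_ball' hst))
    (ENNReal.ofReal_le_ofReal (h.scale_mono s t hs (by linarith [dist_nonneg (x := z) (y := w)])))

theorem jumpScale_mul_le (h : PolynomialGrowth m φ M γ) (z : 𝒳) {r : ℝ} (hr : 0 < r) {s : ℝ≥0}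
    (hs : 1 ≤ s) :
    jumpScale m φ z (s * r) ≤ (M ^ 2 * s ^ (2 * γ) : ℝ≥0) * jumpScale m φ z r := by
  calc jumpScale m φ z (s * r) ≤ (M * s ^ γ : ℝ≥0) * m (Metric.ball z r) *
        ((M * s ^ γ : ℝ≥0) * ENNReal.ofReal (φ r)) :=
        mul_le_mul' (h.measure_mul_le z r hr s hs) (h.scale_mul_le r hr s hs)
    _ = ((M * s ^ γ) * (M * s ^ γ) : ℝ≥0) * jumpScale m φ z r := by
        rw [ENNReal.coe_mul (M * s ^ γ), jumpScale]; ring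
    _ = _ := by congr 2; ring

theorem inv_jumpScale_le_of_mem_ball (h : PolynomialGrowth m φ M γ) (hw : w ∈ Metric.ball z (2 * ρ))
    (hwy : w ≠ y) :
    (jumpScale m φ z (ρ + dist z y))⁻¹ ≤
      (M ^ 2 * 4 ^ (2 * γ) : ℝ≥0) * (jumpScale m φ w (dist w y))⁻¹ := by
  have hw' := Metric.mem_ball.1 hw
  have hρ : 0 < ρ := by linarith [dist_nonneg (x := w) (y := z)]
  have hd : 0 < dist w y := dist_pos.2 hwy
  have hzy : 0 < ρ + dist z y := by positivity
  have h1 : jumpScale m φ w (dist w y) ≤ jumpScale m φ z ((4 : ℝ≥0) * (ρ + dist z y)) := by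
    refine h.jumpScale_mono hd ?_
    have h2 := dist_triangle w z y
    have h3 := dist_nonneg (x := z) (y := y)
    push_cast
    linarith
  exact inv_le_mul_inv (h1.trans (h.jumpScale_mul_le z hzy (by norm_num)))
    (h.jumpScale_ne_zero w hd) (h.jumpScale_ne_top _ _) (h.jumpScale_ne_zero z hzy)
    (h.jumpScale_ne_top _ _)

theorem inv_jumpScale_le_of_le_dist (h : PolynomialGrowth m φ M γ)
    (hw : w ∈ Metric.ball z (2 * ρ)) {Δ : ℝ≥0} (hΔ : 1 ≤ Δ) (hwy : ρ / Δ ≤ dist w y) :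
    (jumpScale m φ w (dist w y))⁻¹ ≤
      (M ^ 2 * (6 * Δ) ^ (2 * γ) : ℝ≥0) * (jumpScale m φ z (ρ + dist z y))⁻¹ := by
  have hw' := Metric.mem_ball.1 hw
  have hρ : 0 < ρ := by linarith [dist_nonneg (x := w) (y := z)]
  have hΔ1 : (1 : ℝ) ≤ Δ := hΔ
  have hΔ0 : (0 : ℝ) < Δ := one_pos.trans_le hΔ1
  have hd : 0 < dist w y := (div_pos hρ hΔ0).trans_le hwy
  have hzy : 0 < ρ + dist z y := by positivity
  rw [div_le_iff₀ hΔ0] at hwy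
  have h1 : jumpScale m φ z (ρ + dist z y) ≤ jumpScale m φ w ((6 * Δ : ℝ≥0) * dist w y) := by
    refine h.jumpScale_mono hzy ?_
    have h2 := dist_triangle z w y
    have h3 : dist w y ≤ dist w y * Δ := le_mul_of_one_le_right hd.le hΔ1
    rw [dist_comm z w] at h2 ⊢
    push_cast
    linarith
  exact inv_le_mul_inv (h1.trans (h.jumpScale_mul_le w hd
      (one_le_mul_of_one_le_of_one_le (by norm_num) hΔ)))
    (h.jumpScale_ne_zero z hzy) (h.jumpScale_ne_top _ _) (h.jumpScale_ne_zero w hd)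
    (h.jumpScale_ne_top _ _)

theorem scale_mul_inv_jumpScale (h : PolynomialGrowth m φ M γ) (z : 𝒳) (hρ : 0 < ρ) :
    ENNReal.ofReal (φ ρ) * (jumpScale m φ z ρ)⁻¹ = (m (Metric.ball z ρ))⁻¹ := by
  rw [jumpScale, ENNReal.mul_inv (Or.inr ENNReal.ofReal_ne_top)
    (Or.inr (h.ofReal_scale_ne_zero hρ)), mul_left_comm,
    ENNReal.mul_inv_cancel (h.ofReal_scale_ne_zero hρ) ENNReal.ofReal_ne_top, mul_one]

theorem refMeasure_le (h : PolynomialGrowth m φ M γ) (z : 𝒳) (hρ : 0 < ρ) {s : Set 𝒳}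
    (hs : MeasurableSet s) : refMeasure m φ z ρ s ≤ (m (Metric.ball z ρ))⁻¹ * m s := by
  rw [refMeasure, withDensity_apply _ hs, ← setLIntegral_const]
  refine lintegral_mono fun y => ?_
  rw [← h.scale_mul_inv_jumpScale z hρ]
  gcongr
  exact h.jumpScale_mono hρ (by rw [dist_self, add_zero]; linarith [dist_nonneg (x := z) (y := y)])

variable [BorelSpace 𝒳]

theorem measurable_inv_jumpScale (h : PolynomialGrowth m φ M γ) (z : 𝒳) (hρ : 0 < ρ) :
    Measurable fun y => (jumpScale m φ z (ρ + dist z y))⁻¹ := by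
  have hd : Measurable fun y => dist z y := (continuous_const.dist continuous_id).measurable
  have hmono : Monotone fun s : ℝ => jumpScale m φ z (ρ + max s 0) := fun s t hst =>
    h.jumpScale_mono (by positivity) (by rw [dist_self, add_zero]; gcongr)
  refine Measurable.inv ?_
  have h1 := hmono.measurable.comp hd
  have h2 : (fun y => jumpScale m φ z (ρ + dist z y)) =
      (fun s : ℝ => jumpScale m φ z (ρ + max s 0)) ∘ fun y => dist z y :=
    funext fun y => by simp only [Function.comp_apply, max_eq_left dist_nonneg]
  rw [h2]
  exact h1

theorem measurable_density (h : PolynomialGrowth m φ M γ) (z : 𝒳) (hρ : 0 < ρ) :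
    Measurable fun y => ENNReal.ofReal (φ ρ) * (jumpScale m φ z (ρ + dist z y))⁻¹ :=
  (h.measurable_inv_jumpScale z hρ).const_mul _

theorem lintegral_refMeasure (h : PolynomialGrowth m φ M γ) (z : 𝒳) (hρ : 0 < ρ) {g : 𝒳 → ℝ≥0∞}
    (hg : Measurable g) :
    (ENNReal.ofReal (φ ρ))⁻¹ * ∫⁻ y, g y ∂(refMeasure m φ z ρ) =
      ∫⁻ y, (jumpScale m φ z (ρ + dist z y))⁻¹ * g y ∂m := by
  have hm := h.measurable_density z hρ
  rw [refMeasure, lintegral_withDensity_eq_lintegral_mul _ hm hg,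
    ← lintegral_const_mul _ (hm.mul hg)]
  refine lintegral_congr fun y => ?_
  rw [Pi.mul_apply, ← mul_assoc, ← mul_assoc,
    ENNReal.inv_mul_cancel (h.ofReal_scale_ne_zero hρ) ENNReal.ofReal_ne_top, one_mul]

/-- Reverse volume doubling gives a lower bound for the mass at a distance. -/
theorem le_refMeasure_compl (h : PolynomialGrowth m φ M γ) (z : 𝒳) (hρ : 0 < ρ) {l C K : ℝ≥0}
    (hl : 1 ≤ l) (hC : 1 < C)
    (hrvd : C * m (Metric.ball z (2 * ρ)) ≤ m (Metric.ball z (l * (2 * ρ))))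
    (hK : M ^ 2 * (3 * l) ^ (2 * γ) ≤ K * (C - 1)) :
    1 ≤ K * refMeasure m φ z ρ (Metric.ball z (2 * ρ))ᶜ := by
  have hl1 : (1 : ℝ) ≤ l := hl
  set A := Metric.ball z (l * (2 * ρ)) \ Metric.ball z (2 * ρ) with hA
  have hAm : MeasurableSet A := Metric.isOpen_ball.measurableSet.diff Metric.isOpen_ball.measurableSet
  have hC0 : ((C - 1 : ℝ≥0) : ℝ≥0∞) ≠ 0 :=
    ENNReal.coe_ne_zero.2 (tsub_pos_of_lt hC).ne'
  have hVA : ((C - 1 : ℝ≥0) : ℝ≥0∞) * m (Metric.ball z (2 * ρ)) ≤ m A := by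
    have h1 : m (Metric.ball z (2 * ρ)) + m A = m (Metric.ball z (l * (2 * ρ))) := by
      rw [hA, measure_add_sdiff Metric.isOpen_ball.measurableSet.nullMeasurableSet]
      congr 1
      exact union_eq_right.2 (Metric.ball_subset_ball (by nlinarith))
    have h2 : (C : ℝ≥0∞) = 1 + ((C - 1 : ℝ≥0) : ℝ≥0∞) := by
      rw [← ENNReal.coe_one, ← ENNReal.coe_add, add_tsub_cancel_of_le hC.le]
    rw [← h1, h2, add_mul, one_mul] at hrvd
    exact (ENNReal.add_le_add_iff_left (h.measure_lt_top _ _).ne).1 hrvd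
  have hdens : ∀ y ∈ A, (m (Metric.ball z ρ))⁻¹ ≤ (M ^ 2 * (3 * l) ^ (2 * γ) : ℝ≥0) *
      (ENNReal.ofReal (φ ρ) * (jumpScale m φ z (ρ + dist z y))⁻¹) := by
    intro y hy
    have hyd : dist z y < l * (2 * ρ) := by rw [dist_comm]; exact Metric.mem_ball.1 hy.1
    have hzy : 0 < ρ + dist z y := by positivity
    have h1 : jumpScale m φ z (ρ + dist z y) ≤ jumpScale m φ z ((3 * l : ℝ≥0) * ρ) := by
      refine h.jumpScale_mono hzy ?_
      rw [dist_self]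
      push_cast
      nlinarith
    have h2 := inv_le_mul_inv (h1.trans (h.jumpScale_mul_le z hρ
      (one_le_mul_of_one_le_of_one_le (by norm_num) hl)))
      (h.jumpScale_ne_zero z hzy) (h.jumpScale_ne_top _ _) (h.jumpScale_ne_zero z hρ)
      (h.jumpScale_ne_top _ _)
    rw [← h.scale_mul_inv_jumpScale z hρ, mul_left_comm]
    gcongr
  have hmain : ((C - 1 : ℝ≥0) : ℝ≥0∞) * 1 ≤
      ((C - 1 : ℝ≥0) : ℝ≥0∞) * (K * refMeasure m φ z ρ (Metric.ball z (2 * ρ))ᶜ) := by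
    calc ((C - 1 : ℝ≥0) : ℝ≥0∞) * 1
        = (C - 1 : ℝ≥0) * ((m (Metric.ball z ρ))⁻¹ * m (Metric.ball z ρ)) := by
          rw [ENNReal.inv_mul_cancel (h.measure_pos z ρ hρ).ne' (h.measure_lt_top z ρ).ne]
      _ ≤ (C - 1 : ℝ≥0) * ((m (Metric.ball z ρ))⁻¹ * m (Metric.ball z (2 * ρ))) := by
          gcongr
          linarith
      _ = (m (Metric.ball z ρ))⁻¹ * ((C - 1 : ℝ≥0) * m (Metric.ball z (2 * ρ))) := by ring
      _ ≤ (m (Metric.ball z ρ))⁻¹ * m A := by gcongr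
      _ = ∫⁻ _y in A, (m (Metric.ball z ρ))⁻¹ ∂m := (setLIntegral_const _ _).symm
      _ ≤ ∫⁻ y in A, (M ^ 2 * (3 * l) ^ (2 * γ) : ℝ≥0) *
          (ENNReal.ofReal (φ ρ) * (jumpScale m φ z (ρ + dist z y))⁻¹) ∂m :=
          setLIntegral_mono' hAm hdens
      _ = (M ^ 2 * (3 * l) ^ (2 * γ) : ℝ≥0) * refMeasure m φ z ρ A := by
          rw [lintegral_const_mul _ (h.measurable_density z hρ), refMeasure,
            withDensity_apply _ hAm]
      _ ≤ (K * (C - 1) : ℝ≥0) * refMeasure m φ z ρ (Metric.ball z (2 * ρ))ᶜ := by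
          gcongr
          exact fun y hy => hy.2
      _ = _ := by rw [ENNReal.coe_mul]; ring
  exact (ENNReal.mul_le_mul_iff_right hC0 ENNReal.coe_ne_top).1 hmain

/-- Reverse doubling of the scale function makes the reference measures finite. -/
theorem refMeasure_univ_le (h : PolynomialGrowth m φ M γ) (z : 𝒳) (hρ : 0 < ρ) {a b : ℝ≥0}
    (ha : 1 < a) (hb : 1 < b) (hab : ScaleReverseDoubling φ a b) :
    refMeasure m φ z ρ univ ≤ (M * a ^ γ * (1 - b⁻¹)⁻¹ : ℝ≥0) := by
  have ha1 : (1 : ℝ) < a := ha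
  have hb0 : 0 < b := one_pos.trans hb
  have ha0 : (0 : ℝ) < a := one_pos.trans ha1
  have han : ∀ n : ℕ, 0 < (a : ℝ) ^ n * ρ := fun n => by positivity
  set t : ℕ → ℝ≥0∞ := fun n => ENNReal.ofReal (φ ρ) * (jumpScale m φ z (a ^ n * ρ))⁻¹ with ht
  have hpt : ∀ y, ENNReal.ofReal (φ ρ) * (jumpScale m φ z (ρ + dist z y))⁻¹ ≤
      ∑' n, (Metric.ball z (a ^ (n + 1) * ρ)).indicator (fun _ => t n) y := by
    intro y
    obtain ⟨n, hn, hn'⟩ := exists_nat_pow_near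
      (show (1 : ℝ) ≤ (ρ + dist z y) / ρ from
        (one_le_div hρ).2 (by linarith [dist_nonneg (x := z) (y := y)])) ha1
    rw [le_div_iff₀ hρ] at hn
    rw [div_lt_iff₀ hρ] at hn'
    refine le_trans ?_ (ENNReal.le_tsum n)
    rw [indicator_of_mem (Metric.mem_ball.2 (by rw [dist_comm]; linarith))]
    simp only [ht]
    gcongr
    exact h.jumpScale_mono (han n) (by rwa [dist_self, add_zero])
  have hterm : ∀ n, t n * m (Metric.ball z (a ^ (n + 1) * ρ)) ≤
      (M * a ^ γ : ℝ≥0) * ((b⁻¹ : ℝ≥0) : ℝ≥0∞) ^ n := by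
    intro n
    have h1 : m (Metric.ball z (a ^ (n + 1) * ρ)) ≤
        (M * a ^ γ : ℝ≥0) * m (Metric.ball z (a ^ n * ρ)) := by
      have := h.measure_mul_le z (a ^ n * ρ) (han n) a ha.le
      rwa [← mul_assoc, ← pow_succ'] at this
    have h2 : ENNReal.ofReal (φ ρ) ≤
        ((b⁻¹ : ℝ≥0) : ℝ≥0∞) ^ n * ENNReal.ofReal (φ (a ^ n * ρ)) := by
      have h3 := hab.pow_mul_le ha0 b.coe_nonneg hρ n
      have h4 : (((b⁻¹ : ℝ≥0) : ℝ≥0∞)) ^ n = ENNReal.ofReal ((b : ℝ)⁻¹ ^ n) := by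
        rw [ENNReal.ofReal_pow (by positivity), ← NNReal.coe_inv, ENNReal.ofReal_coe_nnreal]
      rw [h4, ← ENNReal.ofReal_mul (by positivity)]
      refine ENNReal.ofReal_le_ofReal ?_
      rw [inv_pow, inv_mul_eq_div, le_div_iff₀ (by positivity), mul_comm]
      exact h3
    calc t n * m (Metric.ball z (a ^ (n + 1) * ρ))
        ≤ ((b⁻¹ : ℝ≥0) : ℝ≥0∞) ^ n * ENNReal.ofReal (φ (a ^ n * ρ)) *
          (jumpScale m φ z (a ^ n * ρ))⁻¹ *
          ((M * a ^ γ : ℝ≥0) * m (Metric.ball z (a ^ n * ρ))) := by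
          simp only [ht]
          gcongr
      _ = (M * a ^ γ : ℝ≥0) * ((b⁻¹ : ℝ≥0) : ℝ≥0∞) ^ n *
          (jumpScale m φ z (a ^ n * ρ) * (jumpScale m φ z (a ^ n * ρ))⁻¹) := by
          nth_rewrite 2 [jumpScale]; ring
      _ = _ := by
          rw [ENNReal.mul_inv_cancel (h.jumpScale_ne_zero z (han n)) (h.jumpScale_ne_top _ _),
            mul_one]
  rw [refMeasure, withDensity_apply _ MeasurableSet.univ, setLIntegral_univ]
  calc _ ≤ ∫⁻ y, ∑' n, (Metric.ball z (a ^ (n + 1) * ρ)).indicator (fun _ => t n) y ∂m :=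
        lintegral_mono hpt
    _ = ∑' n, t n * m (Metric.ball z (a ^ (n + 1) * ρ)) := by
        rw [lintegral_tsum fun n =>
          (measurable_const.indicator Metric.isOpen_ball.measurableSet).aemeasurable]
        exact tsum_congr fun n => lintegral_indicator_const Metric.isOpen_ball.measurableSet _
    _ ≤ ∑' n, (M * a ^ γ : ℝ≥0) * ((b⁻¹ : ℝ≥0) : ℝ≥0∞) ^ n := ENNReal.tsum_le_tsum hterm
    _ = (M * a ^ γ * (1 - b⁻¹)⁻¹ : ℝ≥0) := by
        have hb1 : 1 - b⁻¹ ≠ 0 := (tsub_pos_of_lt (inv_lt_one_of_one_lt₀ hb)).ne'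
        rw [ENNReal.tsum_mul_left, ENNReal.tsum_geometric, ENNReal.coe_mul (M * a ^ γ),
          ENNReal.coe_inv hb1, ENNReal.coe_sub, ENNReal.coe_one]

end PolynomialGrowth

theorem pow_mul_measure_ball_le {𝒳 : Type*} [MetricSpace 𝒳] [MeasurableSpace 𝒳] {m : Measure 𝒳}
    {l C : ℝ≥0} {r : ℝ} {x : 𝒳} (hl : 1 ≤ l)
    (hrvd : ∀ s, 0 < s → s ≤ r → C * m (Metric.ball x s) ≤ m (Metric.ball x (l * s)))
    (hr : 0 < r) (k : ℕ) : (C : ℝ≥0∞) ^ k * m (Metric.ball x (r / l ^ k)) ≤ m (Metric.ball x r) := by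
  have hl1 : (1 : ℝ) ≤ l := hl
  have hl0 : (0 : ℝ) < l := one_pos.trans_le hl1
  induction k with
  | zero => simp
  | succ k ih =>
    have h1 := hrvd (r / l ^ (k + 1)) (by positivity)
      (div_le_self hr.le (one_le_pow₀ hl1))
    have h2 : (l : ℝ) * (r / l ^ (k + 1)) = r / l ^ k := by
      rw [pow_succ]; field_simp
    rw [h2] at h1
    calc (C : ℝ≥0∞) ^ (k + 1) * m (Metric.ball x (r / l ^ (k + 1)))
        = C ^ k * (C * m (Metric.ball x (r / l ^ (k + 1)))) := by ring
      _ ≤ C ^ k * m (Metric.ball x (r / l ^ k)) := by gcongr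
      _ ≤ _ := ih

/-- Small balls carry a small part of the reference measure. -/
theorem PolynomialGrowth.pow_mul_refMeasure_ball_le {𝒳 : Type*} [MetricSpace 𝒳] [MeasurableSpace 𝒳]
    [BorelSpace 𝒳] {m : Measure 𝒳} {φ : ℝ → ℝ} {M : ℝ≥0} {γ : ℕ} (h : PolynomialGrowth m φ M γ)
    {l C : ℝ≥0} {r : ℝ} {ξ x : 𝒳} (hl : 1 ≤ l)
    (hrvd : ∀ s, 0 < s → s ≤ r → C * m (Metric.ball x s) ≤ m (Metric.ball x (l * s)))
    (hx : x ∈ Metric.ball ξ (2 * r)) (k : ℕ) :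
    (C : ℝ≥0∞) ^ k * refMeasure m φ ξ r (Metric.ball x (r / l ^ k)) ≤ (M * 3 ^ γ : ℝ≥0) := by
  have hx' := Metric.mem_ball.1 hx
  have hr : 0 < r := by linarith [dist_nonneg (x := x) (y := ξ)]
  calc (C : ℝ≥0∞) ^ k * refMeasure m φ ξ r (Metric.ball x (r / l ^ k))
      ≤ C ^ k * ((m (Metric.ball ξ r))⁻¹ * m (Metric.ball x (r / l ^ k))) := by
        gcongr
        exact h.refMeasure_le ξ hr Metric.isOpen_ball.measurableSet
    _ = (m (Metric.ball ξ r))⁻¹ * (C ^ k * m (Metric.ball x (r / l ^ k))) := by ring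
    _ ≤ (m (Metric.ball ξ r))⁻¹ * m (Metric.ball x r) := by
        gcongr
        exact pow_mul_measure_ball_le hl hrvd hr k
    _ ≤ (m (Metric.ball ξ r))⁻¹ * m (Metric.ball ξ ((3 : ℝ≥0) * r)) := by
        gcongr
        exact Metric.ball_subset_ball' (by push_cast; linarith)
    _ ≤ (m (Metric.ball ξ r))⁻¹ * ((M * 3 ^ γ : ℝ≥0) * m (Metric.ball ξ r)) := by
        gcongr
        exact h.measure_mul_le ξ r hr 3 (by norm_num)
    _ = (M * 3 ^ γ : ℝ≥0) * ((m (Metric.ball ξ r))⁻¹ * m (Metric.ball ξ r)) := by ring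
    _ = _ := by
        rw [ENNReal.inv_mul_cancel (h.measure_pos ξ r hr).ne' (h.measure_lt_top ξ r).ne, mul_one]

/-! ### The jump estimates under the conditions on the process -/

section

variable {𝒳 Ω : Type*} [MetricSpace 𝒳] [LocallyCompactSpace 𝒳] [SecondCountableTopology 𝒳]
  [MeasurableSpace 𝒳] [BorelSpace 𝒳] [MeasurableSpace Ω] {Z : HuntProcess 𝒳 Ω} {m : Measure 𝒳}
  {φ : ℝ → ℝ} {M K : ℝ≥0} {γ : ℕ} {z : 𝒳} {ρ : ℝ}

theorem lower_exitLaw_of_jumpKernelBounds {c₁ c₂ : ℝ≥0} (hJ : JumpKernelBounds Z m φ c₁ c₂)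
    (h : PolynomialGrowth m φ M γ) (hρ : 0 < ρ) (hK0 : 0 < K)
    (hK : M ^ 2 * 4 ^ (2 * γ) ≤ K * c₁) {W : Set 𝒳} (hW : IsOpen W)
    (hWz : W ⊆ Metric.ball z (2 * ρ)) (x : 𝒳) {g : 𝒳 → ℝ≥0∞} (hg : Measurable g)
    (hgW : ∀ w ∈ W, g w = 0) :
    Z.meanExit W x * (ENNReal.ofReal (φ ρ))⁻¹ * ∫⁻ y, g y ∂(refMeasure m φ z ρ) ≤
      K * ∫⁻ y, g y ∂(Z.exitLaw W x) := by
  obtain ⟨J, hJm, hJL, hJb⟩ := hJ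
  have hK' : (K : ℝ≥0∞) ≠ 0 := by exact_mod_cast hK0.ne'
  set I := (ENNReal.ofReal (φ ρ))⁻¹ * ∫⁻ y, g y ∂(refMeasure m φ z ρ) with hI
  have hIJ : ∀ w ∈ W, (K : ℝ≥0∞)⁻¹ * I ≤ ∫⁻ y, g y ∂(m.withDensity (J w)) := by
    intro w hw
    have hJw : Measurable (J w) := hJm.comp measurable_prodMk_left
    rw [ENNReal.inv_mul_le_iff hK' ENNReal.coe_ne_top, hI, h.lintegral_refMeasure z hρ hg,
      lintegral_withDensity_eq_lintegral_mul _ hJw hg, ← lintegral_const_mul _ (hJw.mul hg)]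
    refine lintegral_mono fun y => ?_
    by_cases hwy : w = y
    · rw [← hwy, Pi.mul_apply, hgW w hw]; simp
    rw [Pi.mul_apply, ← mul_assoc]
    gcongr
    calc (jumpScale m φ z (ρ + dist z y))⁻¹
        ≤ (M ^ 2 * 4 ^ (2 * γ) : ℝ≥0) * (jumpScale m φ w (dist w y))⁻¹ :=
          h.inv_jumpScale_le_of_mem_ball (hWz hw) hwy
      _ ≤ (K * c₁ : ℝ≥0) * (jumpScale m φ w (dist w y))⁻¹ := by gcongr
      _ = K * (ENNReal.ofReal c₁ / jumpScale m φ w (dist w y)) := by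
          rw [ENNReal.ofReal_coe_nnreal, ENNReal.coe_mul, div_eq_mul_inv, mul_assoc]
      _ ≤ K * J w y := by
          gcongr
          exact (hJb w y hwy).1
  have h1 := Z.mul_meanExit_le_lintegral_exitLaw hJL hW hg hgW hIJ x
  rw [mul_assoc, ENNReal.inv_mul_le_iff hK' ENNReal.coe_ne_top] at h1
  calc _ = I * Z.meanExit W x := by rw [hI]; ring
    _ ≤ _ := h1

theorem upper_exitLaw_of_jumpKernelBounds {c₁ c₂ : ℝ≥0} (hJ : JumpKernelBounds Z m φ c₁ c₂)
    (h : PolynomialGrowth m φ M γ) (hρ : 0 < ρ)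
    (hK : c₂ * (M ^ 2 * 6 ^ (2 * γ)) ≤ K) {W : Set 𝒳} (hW : IsOpen W)
    (hWz : W ⊆ Metric.ball z (2 * ρ)) {x : 𝒳} (hx : x ∈ W) {g : 𝒳 → ℝ≥0∞} (hg : Measurable g)
    {Δ : ℝ≥0} (hΔ : 1 ≤ Δ) (hgW : ∀ w ∈ W, ∀ y, dist w y < ρ / Δ → g y = 0) :
    ∫⁻ y, g y ∂(Z.exitLaw W x) ≤ K * Δ ^ (2 * γ) *
      (Z.meanExit W x * (ENNReal.ofReal (φ ρ))⁻¹ * ∫⁻ y, g y ∂(refMeasure m φ z ρ)) := by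
  obtain ⟨J, hJm, hJL, hJb⟩ := hJ
  have hΔ0 : (0 : ℝ) < Δ := one_pos.trans_le (show (1 : ℝ) ≤ Δ from hΔ)
  have hρΔ : 0 < ρ / Δ := by positivity
  set I := (ENNReal.ofReal (φ ρ))⁻¹ * ∫⁻ y, g y ∂(refMeasure m φ z ρ) with hI
  have hgA : ∀ y ∈ closure W, g y = 0 := by
    intro y hy
    obtain ⟨w, hw, hyw⟩ := Metric.mem_closure_iff.1 hy _ hρΔ
    exact hgW w hw y (by rwa [dist_comm])
  have hIJ : ∀ w ∈ W, ∫⁻ y, g y ∂(m.withDensity (J w)) ≤ K * Δ ^ (2 * γ) * I := by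
    intro w hw
    have hJw : Measurable (J w) := hJm.comp measurable_prodMk_left
    have hm : Measurable fun y => (jumpScale m φ z (ρ + dist z y))⁻¹ * g y :=
      (h.measurable_inv_jumpScale z hρ).mul hg
    rw [hI, h.lintegral_refMeasure z hρ hg,
      lintegral_withDensity_eq_lintegral_mul _ hJw hg, ← lintegral_const_mul _ hm]
    refine lintegral_mono fun y => ?_
    by_cases hwy : dist w y < ρ / Δ
    · rw [Pi.mul_apply, hgW w hw y hwy]; simp
    rw [not_lt] at hwy
    have hne : w ≠ y := dist_pos.1 (hρΔ.trans_le hwy)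
    rw [Pi.mul_apply, ← mul_assoc]
    gcongr
    calc J w y ≤ ENNReal.ofReal c₂ / jumpScale m φ w (dist w y) := (hJb w y hne).2
      _ = c₂ * (jumpScale m φ w (dist w y))⁻¹ := by
          rw [ENNReal.ofReal_coe_nnreal, div_eq_mul_inv]
      _ ≤ c₂ * ((M ^ 2 * (6 * Δ) ^ (2 * γ) : ℝ≥0) * (jumpScale m φ z (ρ + dist z y))⁻¹) := by
          gcongr
          exact h.inv_jumpScale_le_of_le_dist (hWz hw) hΔ hwy
      _ = (c₂ * (M ^ 2 * 6 ^ (2 * γ)) * Δ ^ (2 * γ) : ℝ≥0) *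
          (jumpScale m φ z (ρ + dist z y))⁻¹ := by
          rw [← mul_assoc, ← ENNReal.coe_mul, mul_pow]
          congr 2
          ring
      _ ≤ (K * Δ ^ (2 * γ) : ℝ≥0) * (jumpScale m φ z (ρ + dist z y))⁻¹ := by gcongr
      _ = K * Δ ^ (2 * γ) * (jumpScale m φ z (ρ + dist z y))⁻¹ := by push_cast; rfl
  refine (Z.lintegral_exitLaw_le_mul_meanExit hJL hW isClosed_closure subset_closure hg hgA hIJ
    hx).trans_eq ?_
  rw [hI]
  ring

theorem exitLaw_inter_ball_le_of_exitProbabilityBound {cEP : ℝ≥0} {r₀ : ℝ≥0∞}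
    (hEP : ExitProbabilityBound Z φ r₀ cEP) (h : PolynomialGrowth m φ M γ) (hρ : 0 < ρ)
    (hρ₀ : ENNReal.ofReal ρ < r₀) (hK : cEP * M ≤ K) {D : Set 𝒳} (hD : IsOpen D) (x : 𝒳)
    {Δ S : ℝ≥0} (hΔ : 1 ≤ Δ) (hS : 0 < S) :
    Z.exitLaw (D ∩ Metric.ball x (ρ / Δ)) x D ≤
      S * (Z.meanExit (D ∩ Metric.ball x (ρ / Δ)) x * (ENNReal.ofReal (φ ρ))⁻¹) +
        K * Δ ^ (2 * γ) * ((S⁻¹ : ℝ≥0) : ℝ≥0∞) := by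
  have hΔ1 : (1 : ℝ) ≤ Δ := hΔ
  have hΔ0 : (0 : ℝ) < Δ := one_pos.trans_le hΔ1
  have hρΔ : 0 < ρ / Δ := by positivity
  have hφ := h.scale_pos ρ hρ
  have hφΔ := h.scale_pos _ hρΔ
  set p : ℝ≥0 := (φ ρ).toNNReal with hp
  have hp0 : 0 < p := Real.toNNReal_pos.2 hφ
  have hpc : ENNReal.ofReal (φ ρ) = p := rfl
  have ht : 0 < p / S := by positivity
  refine (Z.exitLaw_inter_apply_le hD Metric.isOpen_ball x ht).trans (add_le_add ?_ ?_)
  · have hinv : ((p / S : ℝ≥0) : ℝ≥0∞)⁻¹ = S * (p : ℝ≥0∞)⁻¹ := by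
      rw [← ENNReal.coe_inv ht.ne', ← ENNReal.coe_inv hp0.ne', ← ENNReal.coe_mul, inv_div,
        div_eq_mul_inv]
    rw [hpc, ENNReal.div_eq_inv_mul, hinv]
    exact le_of_eq (by ring)
  · refine (hEP _ x (ρ / Δ) ht hρΔ (lt_of_le_of_lt (ENNReal.ofReal_le_ofReal
      (div_le_self hρ.le hΔ1)) hρ₀)).trans ?_
    have h1 := h.scale_mul_le _ hρΔ Δ hΔ
    rw [mul_div_cancel₀ _ hΔ0.ne', ← ENNReal.ofReal_coe_nnreal,
      ← ENNReal.ofReal_mul (NNReal.coe_nonneg _),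
      ENNReal.ofReal_le_ofReal_iff (by positivity)] at h1
    have h2 : (cEP : ℝ) * (p / S : ℝ≥0) / φ (ρ / Δ) ≤ (K * Δ ^ (2 * γ) * S⁻¹ : ℝ≥0) := by
      have hpφ : (p : ℝ) = φ ρ := Real.coe_toNNReal _ hφ.le
      have hS' : (0 : ℝ) < S := hS
      have hK' : (cEP : ℝ) * M ≤ K := by exact_mod_cast hK
      push_cast at h1 ⊢
      rw [hpφ, div_le_iff₀ hφΔ]
      have h3 : (Δ : ℝ) ^ γ ≤ (Δ : ℝ) ^ (2 * γ) := pow_le_pow_right₀ hΔ1 (by omega)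
      calc (cEP : ℝ) * (φ ρ / S) ≤ cEP * (M * Δ ^ γ * φ (ρ / Δ) / S) := by gcongr
        _ = cEP * M * Δ ^ γ * (S : ℝ)⁻¹ * φ (ρ / Δ) := by field_simp
        _ ≤ K * Δ ^ (2 * γ) * (S : ℝ)⁻¹ * φ (ρ / Δ) := by gcongr
    refine (ENNReal.ofReal_le_ofReal h2).trans_eq ?_
    rw [ENNReal.ofReal_coe_nnreal]
    push_cast
    rfl

/-- A constant that works in all the jump estimates. -/
def jumpConst (M : ℝ≥0) (γ : ℕ) (l C a b c₁ c₂ cEP : ℝ≥0) : ℝ≥0 :=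
  M ^ 2 * 4 ^ (2 * γ) / c₁ + c₂ * (M ^ 2 * 6 ^ (2 * γ)) + M * a ^ γ * (1 - b⁻¹)⁻¹ +
    M ^ 2 * (3 * l) ^ (2 * γ) / (C - 1) + cEP * M + M + 1

theorem two_mul_le_div {ρ l d : ℝ≥0∞} (h : ρ ≤ d / (2 * l)) : 2 * ρ ≤ d / l := by
  calc 2 * ρ ≤ 2 * (d / (2 * l)) := by gcongr
    _ = d / l := by
        rw [div_eq_mul_inv, div_eq_mul_inv, ENNReal.mul_inv (Or.inl two_ne_zero)
          (Or.inl ENNReal.ofNat_ne_top), mul_left_comm, ← mul_assoc 2,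
          ENNReal.mul_inv_cancel two_ne_zero ENNReal.ofNat_ne_top, one_mul]

theorem jumpEstimates_of_bounds {l C a b c₁ c₂ cEP : ℝ≥0} {r₀ : ℝ≥0∞}
    (h : PolynomialGrowth m φ M γ) (hrvd : ReverseVolumeDoubling m l C)
    (hab : ScaleReverseDoubling φ a b) (hJ : JumpKernelBounds Z m φ c₁ c₂)
    (hEP : ExitProbabilityBound Z φ r₀ cEP) (hl : 1 ≤ l) (hC : 1 < C) (ha : 1 < a) (hb : 1 < b)
    (hc₁ : 0 < c₁) (z : 𝒳) (hρ : 0 < ρ)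
    (hρ₀ : ENNReal.ofReal ρ <
      min (Metric.ediam (univ : Set 𝒳) / (2 * ENNReal.ofReal l)) r₀) :
    JumpEstimates Z (ENNReal.ofReal (φ ρ))⁻¹ (refMeasure m φ z ρ)
      (jumpConst M γ l C a b c₁ c₂ cEP) (2 * γ) z ρ := by
  have hC1 : 0 < C - 1 := tsub_pos_of_lt hC
  have hρ₁ := (lt_min_iff.1 hρ₀).1
  have hρ₂ := (lt_min_iff.1 hρ₀).2
  refine ⟨hρ, fun W hW hWz x g hg hgW => ?_, fun W hW hWz x hx g hg Δ hΔ hgW => ?_, ?_, ?_,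
    fun D hD x Δ hΔ S hS => ?_⟩
  · refine lower_exitLaw_of_jumpKernelBounds hJ h hρ (one_pos.trans_le ?_) ?_ hW hWz x hg hgW
    · rw [jumpConst]; exact le_add_self
    · rw [← div_le_iff₀ hc₁, jumpConst]
      simp only [add_assoc]
      exact le_self_add
  · refine upper_exitLaw_of_jumpKernelBounds hJ h hρ ?_ hW hWz hx hg hΔ hgW
    rw [jumpConst]
    simp only [add_assoc]
    exact le_add_left le_self_add
  · refine (h.refMeasure_univ_le z hρ ha hb hab).trans (ENNReal.coe_le_coe.2 ?_)
    rw [jumpConst]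
    simp only [add_assoc]
    exact le_add_left (le_add_left le_self_add)
  · refine h.le_refMeasure_compl z hρ hl hC ?_ ?_
    · have h1 := hrvd z (2 * ρ) (by positivity) (by
        rw [ENNReal.ofReal_mul zero_le_two, ENNReal.ofReal_ofNat]
        exact two_mul_le_div hρ₁.le)
      rwa [ENNReal.ofReal_coe_nnreal] at h1
    · rw [← div_le_iff₀ hC1, jumpConst]
      simp only [add_assoc]
      exact le_add_left (le_add_left (le_add_left le_self_add))
  · refine exitLaw_inter_ball_le_of_exitProbabilityBound hEP h hρ hρ₂ ?_ hD x hΔ hS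
    rw [jumpConst]
    simp only [add_assoc]
    exact le_add_left (le_add_left (le_add_left (le_add_left le_self_add)))

end

open JumpEstimates

/-! ### The uniform boundary Harnack principle -/

theorem polynomialGrowth_of_doubling {𝒳 : Type*} [MetricSpace 𝒳] [LocallyCompactSpace 𝒳]
    [MeasurableSpace 𝒳] {m : Measure 𝒳} [IsFiniteMeasureOnCompacts m] [m.IsOpenPosMeasure]
    {φ : ℝ → ℝ} {cV c β : ℝ} {α β' : ℕ} (hV : VolumeDoubling m cV) (hα : cV ≤ 2 ^ α)
    (hφ : IsScaleFunction φ c β) (hc : 0 ≤ c) (hβ : β ≤ β') :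
    PolynomialGrowth m φ (2 ^ α + c.toNNReal) (α + β') where
  measure_lt_top := hV.measure_ball_lt_top
  measure_pos _ _ hr := Metric.measure_ball_pos m _ hr
  scale_pos _ hr := hφ.pos hr
  scale_mono _ _ hr hrs := hφ.mono hr hrs
  measure_mul_le z r hr s hs := by
    refine (hV.measure_ball_mul_le hα z hr hs).trans (mul_le_mul' ?_ le_rfl)
    rw [← ENNReal.coe_pow, mul_pow]
    exact ENNReal.coe_le_coe.2 (mul_le_mul' le_self_add (pow_le_pow_right₀ hs (by omega)))
  scale_mul_le r hr s hs := by
    refine (hφ.map_mul_le hc hβ hr hs).trans (mul_le_mul' ?_ le_rfl)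
    exact ENNReal.coe_le_coe.2 (mul_le_mul' le_add_self (pow_le_pow_right₀ hs (by omega)))

theorem exists_stayConst_mul_pow_lt_one (K : ℝ≥0) (γ : ℕ) :
    ∃ Θ : ℝ≥0, 1 < Θ ∧ stayConst K * Θ ^ γ < 1 := by
  have hc : ContinuousAt (fun Θ : ℝ≥0 => stayConst K * Θ ^ γ) 1 := by fun_prop
  have hev : ∀ᶠ Θ in 𝓝[>] (1 : ℝ≥0), stayConst K * Θ ^ γ < 1 :=
    (hc.tendsto.mono_left nhdsWithin_le_nhds).eventually_lt_const
      (by simpa using stayConst_lt_one K)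
  obtain ⟨Θ, hΘ, hΘ1⟩ := (hev.and self_mem_nhdsWithin).exists
  exact ⟨Θ, hΘ1, hΘ⟩

theorem exists_two_le_mul {κ : ℝ} (hκ : κ < 2) {Θ : ℝ≥0} (hΘ : 1 < Θ) :
    ∃ Δ : ℝ≥0, 1 ≤ Δ ∧ 2 ≤ (Δ : ℝ) * (2 - κ) * (1 - 1 / Θ) := by
  have hΘ1 : (1 : ℝ) < Θ := hΘ
  have h1 : 0 < (2 - κ) * (1 - 1 / (Θ : ℝ)) :=
    mul_pos (by linarith) (sub_pos.2 ((div_lt_one (by linarith)).2 hΘ1))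
  refine ⟨(2 / ((2 - κ) * (1 - 1 / (Θ : ℝ)))).toNNReal + 1, le_add_self, ?_⟩
  rw [mul_assoc, ← div_le_iff₀ h1, NNReal.coe_add]
  exact (Real.le_coe_toNNReal _).trans (by simp)

theorem lintegral_eq_iSup_min {α : Type*} [MeasurableSpace α] (μ : Measure α) {f : α → ℝ≥0∞}
    (hf : Measurable f) :
    ∫⁻ w, f w ∂μ = ⨆ n : ℕ, ∫⁻ w, min (f w) n ∂μ := by
  rw [← lintegral_iSup (fun n => hf.min measurable_const)
    (fun i j hij w => min_le_min le_rfl (by exact_mod_cast hij))]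
  refine lintegral_congr fun w => ?_
  rw [← inf_iSup_eq, ENNReal.iSup_natCast, inf_top_eq]

theorem exitValue_eq {𝒳 Ω : Type*} [TopologicalSpace 𝒳] [MeasurableSpace Ω] (Z : HuntProcess 𝒳 Ω) (h : 𝒳 → ℝ)
    (U : Set 𝒳) (ω : Ω) : Z.exitValue h U ω = (Z.exitPos U ω).elim 0 h := by
  by_cases hω : Z.exitTime U ω < ⊤
  · rw [Z.exitPos_of_lt hω, HuntProcess.exitValue, indicator_of_mem (s := {ω | Z.exitTime U ω < ⊤}) hω]
  · rw [Z.exitPos_of_eq_top (not_lt_top_iff.1 hω), HuntProcess.exitValue,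
      indicator_of_notMem (s := {ω | Z.exitTime U ω < ⊤}) hω]
    rfl

section BoundaryHarnack

variable {𝒳 Ω : Type*} [MetricSpace 𝒳] [LocallyCompactSpace 𝒳] [SecondCountableTopology 𝒳]
  [MeasurableSpace 𝒳] [BorelSpace 𝒳] [MeasurableSpace Ω] {Z : HuntProcess 𝒳 Ω} {σ : ℝ → ℝ≥0∞}
  {N : 𝒳 → ℝ → Measure 𝒳} {K Θ Δ₁ Δ : ℝ≥0} {γ : ℕ} {ξ : 𝒳} {r κ : ℝ} {D : Set 𝒳}
  {f f₁ f₂ : 𝒳 → ℝ≥0∞}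

/-- The constant in the Carleson-type estimate. -/
def carlesonConst (K Θ Δ : ℝ≥0) (γ : ℕ) : ℝ≥0 := K ^ 3 * Δ ^ γ * (1 - stayConst K * Θ ^ γ)⁻¹

/-- The constant in the upper half of the factorisation. -/
def factorConst (K Θ Δ₁ Δ : ℝ≥0) (γ : ℕ) : ℝ≥0 :=
  carlesonConst K Θ Δ₁ γ * exitInsideConst K γ * K * Δ ^ γ + K * Δ ^ γ

/-- The scales `ρ ≤ r` at which the jump estimates hold, together with parameters `Θ`, `Δ₁`, `Δ` for
which the factorisation of harmonic functions in `B(ξ, κr)` is available. -/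
structure FactorizationData (Z : HuntProcess 𝒳 Ω) (σ : ℝ → ℝ≥0∞) (N : 𝒳 → ℝ → Measure 𝒳)
    (K Θ Δ₁ Δ : ℝ≥0) (γ : ℕ) (ξ : 𝒳) (r κ : ℝ) : Prop where
  pos : 0 < r
  estimates : ∀ z ρ, 0 < ρ → ρ ≤ r → JumpEstimates Z (σ ρ) (N z ρ) K γ z ρ
  scale_le : σ (r / Δ) ≤ K * Δ ^ γ * σ r
  lt_two : κ < 2
  one_lt : 1 < Θ
  stay_lt : stayConst K * Θ ^ γ < 1
  one_le_carleson : 1 ≤ Δ₁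
  two_le : 2 ≤ (Δ₁ : ℝ) * (2 - (κ + 2) / 2) * (1 - 1 / Θ)
  one_le : 1 ≤ Δ
  four_le : 4 ≤ (Δ : ℝ) * (2 - κ)
  small : ∀ x ∈ Metric.ball ξ (2 * r),
    2 * carlesonConst K Θ Δ₁ γ * N ξ r (Metric.ball x (r / Δ)) ≤ 1

theorem FactorizationData.factorization (h : FactorizationData Z σ N K Θ Δ₁ Δ γ ξ r κ)
    (hD : IsOpen D) (hf : Measurable f) (hf0 : ∀ y ∈ Metric.ball ξ (2 * r), f y = 0) {B : ℝ≥0}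
    (hfB : ∀ y, f y ≤ B) {x : 𝒳} (hx : x ∈ D ∩ Metric.ball ξ (κ * r)) :
    ∫⁻ w, f w ∂(Z.exitLaw (D ∩ Metric.ball ξ (2 * r)) x) ≤ factorConst K Θ Δ₁ Δ γ *
        (Z.meanExit (D ∩ Metric.ball x (r / Δ)) x * σ r *
          ∫⁻ y, ∫⁻ w, f w ∂(Z.exitLaw (D ∩ Metric.ball ξ (2 * r)) y) ∂(N ξ r)) ∧
    Z.meanExit (D ∩ Metric.ball x (r / Δ)) x * σ r *
        ∫⁻ y, ∫⁻ w, f w ∂(Z.exitLaw (D ∩ Metric.ball ξ (2 * r)) y) ∂(N ξ r) ≤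
      (2 * K : ℝ≥0) * ∫⁻ w, f w ∂(Z.exitLaw (D ∩ Metric.ball ξ (2 * r)) x) := by
  have hr := h.pos
  have hΔ1 : (1 : ℝ) ≤ Δ := h.one_le
  have hΔ0 : (0 : ℝ) < Δ := one_pos.trans_le hΔ1
  have hκ := h.lt_two
  have h4 : 2 * (r / Δ) ≤ (2 - κ) / 2 * r := by
    rw [← mul_div_assoc, div_le_iff₀ hΔ0]
    have := mul_le_mul_of_nonneg_right h.four_le hr.le
    linarith
  have hxd := Metric.mem_ball.1 hx.2
  have hsub : Metric.ball x (2 * (r / Δ)) ⊆ Metric.ball ξ ((κ + 2) / 2 * r) :=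
    Metric.ball_subset_ball' (by linarith)
  have hκr : κ * r < 2 * r := by gcongr
  have hsub2 : Metric.ball ξ ((κ + 2) / 2 * r) ⊆ Metric.ball ξ (2 * r) :=
    Metric.ball_subset_ball (by linarith)
  have hest := h.estimates ξ r hr le_rfl
  exact hest.harmonic_factorization
    (h.estimates x (r / Δ) (by positivity) (div_le_self hr.le hΔ1)) h.scale_le hD hf hf0 hfB h.one_le
    hx.1 (hsub.trans hsub2)
    (fun y hy => hest.harmonic_le_mean h.estimates hD hf hf0 hfB (by linarith) h.one_lt h.stay_lt
      h.one_le_carleson h.two_le ⟨hy.1, hsub hy.2⟩)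
    (h.small x (Metric.ball_subset_ball hκr.le hx.2))

theorem FactorizationData.mul_le_of_bounded (h : FactorizationData Z σ N K Θ Δ₁ Δ γ ξ r κ)
    (hD : IsOpen D) (hf₁ : Measurable f₁) (hf₁0 : ∀ y ∈ Metric.ball ξ (2 * r), f₁ y = 0) {B₁ : ℝ≥0}
    (hfB₁ : ∀ y, f₁ y ≤ B₁) (hf₂ : Measurable f₂) (hf₂0 : ∀ y ∈ Metric.ball ξ (2 * r), f₂ y = 0)
    {B₂ : ℝ≥0} (hfB₂ : ∀ y, f₂ y ≤ B₂) {x y : 𝒳} (hx : x ∈ D ∩ Metric.ball ξ (κ * r))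
    (hy : y ∈ D ∩ Metric.ball ξ (κ * r)) :
    (∫⁻ w, f₁ w ∂(Z.exitLaw (D ∩ Metric.ball ξ (2 * r)) x)) *
        ∫⁻ w, f₂ w ∂(Z.exitLaw (D ∩ Metric.ball ξ (2 * r)) y) ≤
      ((factorConst K Θ Δ₁ Δ γ * (2 * K)) ^ 2 : ℝ≥0) *
        ((∫⁻ w, f₁ w ∂(Z.exitLaw (D ∩ Metric.ball ξ (2 * r)) y)) *
          ∫⁻ w, f₂ w ∂(Z.exitLaw (D ∩ Metric.ball ξ (2 * r)) x)) := by
  obtain ⟨hx1, -⟩ := h.factorization hD hf₁ hf₁0 hfB₁ hx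
  obtain ⟨-, hy1⟩ := h.factorization hD hf₁ hf₁0 hfB₁ hy
  obtain ⟨-, hx2⟩ := h.factorization hD hf₂ hf₂0 hfB₂ hx
  obtain ⟨hy2, -⟩ := h.factorization hD hf₂ hf₂0 hfB₂ hy
  refine (mul_le_mul' hx1 hy2).trans ?_
  have h3 := mul_le_mul' hy1 hx2
  have h4 := mul_le_mul_right h3 ((factorConst K Θ Δ₁ Δ γ : ℝ≥0∞) ^ 2)
  refine le_trans (le_of_eq ?_) (h4.trans_eq ?_)
  · ring
  · push_cast; ring

theorem FactorizationData.mul_le (h : FactorizationData Z σ N K Θ Δ₁ Δ γ ξ r κ)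
    (hD : IsOpen D) (hf₁ : Measurable f₁) (hf₁0 : ∀ y ∈ Metric.ball ξ (2 * r), f₁ y = 0)
    (hf₂ : Measurable f₂) (hf₂0 : ∀ y ∈ Metric.ball ξ (2 * r), f₂ y = 0)
    {x y : 𝒳} (hx : x ∈ D ∩ Metric.ball ξ (κ * r)) (hy : y ∈ D ∩ Metric.ball ξ (κ * r)) :
    (∫⁻ w, f₁ w ∂(Z.exitLaw (D ∩ Metric.ball ξ (2 * r)) x)) *
        ∫⁻ w, f₂ w ∂(Z.exitLaw (D ∩ Metric.ball ξ (2 * r)) y) ≤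
      ((factorConst K Θ Δ₁ Δ γ * (2 * K)) ^ 2 : ℝ≥0) *
        ((∫⁻ w, f₁ w ∂(Z.exitLaw (D ∩ Metric.ball ξ (2 * r)) y)) *
          ∫⁻ w, f₂ w ∂(Z.exitLaw (D ∩ Metric.ball ξ (2 * r)) x)) := by
  rw [lintegral_eq_iSup_min (Z.exitLaw (D ∩ Metric.ball ξ (2 * r)) x) hf₁,
    lintegral_eq_iSup_min (Z.exitLaw (D ∩ Metric.ball ξ (2 * r)) y) hf₂, ENNReal.iSup_mul]
  refine iSup_le fun n => ?_
  rw [ENNReal.mul_iSup]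
  refine iSup_le fun k => ?_
  refine (h.mul_le_of_bounded hD (hf₁.min measurable_const)
    (fun y hy => by rw [hf₁0 y hy]; exact zero_min _) (B₁ := n) (fun y => by simp)
    (hf₂.min measurable_const)
    (fun y hy => by rw [hf₂0 y hy]; exact zero_min _) (B₂ := k) (fun y => by simp) hx hy).trans ?_
  gcongr <;> exact min_le_left _ _

/-- The values of a regular harmonic function are integrals of a Borel function, vanishing
on `B`, against the exit laws. -/
theorem exists_borel_of_isRegularHarmonic {h : 𝒳 → ℝ} {B : Set 𝒳} (hD : IsOpen D) (hB : IsOpen B)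
    (hm : UniversallyMeasurable h) (h0 : ∀ x, 0 ≤ h x) (hh : Z.IsRegularHarmonic h (D ∩ B))
    (hv : ∀ x ∈ B \ D, h x = 0) (x y : 𝒳) :
    ∃ f : 𝒳 → ℝ≥0∞, Measurable f ∧ (∀ w ∈ B, f w = 0) ∧ ∀ z ∈ D ∩ B, z = x ∨ z = y →
      ∫⁻ w, f w ∂(Z.exitLaw (D ∩ B) z) = ENNReal.ofReal (h z) := by
  have hU := hD.inter hB
  have hfin : ∀ z, IsFiniteMeasure (Z.exitLaw (D ∩ B) z) := fun z =>
    ⟨(Z.exitLaw_univ_le_one hU z).trans_lt ENNReal.one_lt_top⟩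
  have hae := hm (Z.exitLaw (D ∩ B) x + Z.exitLaw (D ∩ B) y)
  set g := hae.mk h with hg
  have hgm : Measurable g := hae.measurable_mk
  have hfm : Measurable (Bᶜ.indicator fun w => ENNReal.ofReal (g w)) :=
    hgm.ennreal_ofReal.indicator hB.measurableSet.compl
  refine ⟨Bᶜ.indicator fun w => ENNReal.ofReal (g w), hfm,
    fun w hw => indicator_of_notMem (show w ∉ Bᶜ from not_not.2 hw) _, fun z hz hxy => ?_⟩
  have hnull : Z.exitLaw (D ∩ B) z {w | h w ≠ g w} = 0 := by
    have h1 : (Z.exitLaw (D ∩ B) x + Z.exitLaw (D ∩ B) y) {w | h w ≠ g w} = 0 := hae.ae_eq_mk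
    rw [Measure.add_apply, add_eq_zero] at h1
    rcases hxy with rfl | rfl
    · exact h1.1
    · exact h1.2
  have hnull' : Z.exitLaw (D ∩ B) z {w | ENNReal.ofReal (h w) ≠
      Bᶜ.indicator (fun w => ENNReal.ofReal (g w)) w} = 0 := by
    refine measure_mono_null (fun w hw => ?_) (measure_union_null hnull (Z.exitLaw_self hU z))
    by_contra hc
    simp only [mem_union, mem_ofPred_eq, not_or, not_not] at hc
    refine hw ?_
    by_cases hwB : w ∈ B
    · rw [indicator_of_notMem (show w ∉ Bᶜ from not_not.2 hwB),
        hv w ⟨hwB, fun hwD => hc.2 ⟨hwD, hwB⟩⟩, ENNReal.ofReal_zero]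
    · rw [indicator_of_mem (show w ∈ Bᶜ from hwB), hc.1]
  obtain ⟨hinteg, heq⟩ := hh z hz
  rw [Z.lintegral_exitLaw hU z hfm, heq, ofReal_integral_eq_lintegral_ofReal hinteg]
  · obtain ⟨s, hs, hsm, hs0⟩ := exists_measurable_superset_of_null hnull'
    rw [Z.exitLaw_apply hU z hsm] at hs0
    refine lintegral_congr_ae ?_
    filter_upwards [compl_mem_ae_iff.2 hs0] with ω hω
    rw [exitValue_eq]
    induction hp : Z.exitPos (D ∩ B) ω using OnePoint.rec with
    | infty => simp
    | coe w =>
      simp only [OnePoint.elim_some]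
      by_contra hne
      exact hω ⟨w, hs (Ne.symm hne), hp.symm⟩
  · refine Eventually.of_forall fun ω => ?_
    rw [Pi.zero_apply, exitValue_eq]
    induction Z.exitPos (D ∩ B) ω using OnePoint.rec with
    | infty => simp
    | coe w => exact h0 w

theorem FactorizationData.boundary_harnack (h : FactorizationData Z σ N K Θ Δ₁ Δ γ ξ r κ)
    (hD : IsOpen D) {h₁ h₂ : 𝒳 → ℝ} (hm₁ : UniversallyMeasurable h₁)
    (hm₂ : UniversallyMeasurable h₂) (h₁0 : ∀ x, 0 ≤ h₁ x) (h₂0 : ∀ x, 0 ≤ h₂ x)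
    (hh₁ : Z.IsRegularHarmonic h₁ (D ∩ Metric.ball ξ (2 * r)))
    (hh₂ : Z.IsRegularHarmonic h₂ (D ∩ Metric.ball ξ (2 * r)))
    (hv₁ : ∀ x ∈ Metric.ball ξ (2 * r) \ D, h₁ x = 0)
    (hv₂ : ∀ x ∈ Metric.ball ξ (2 * r) \ D, h₂ x = 0) {x y : 𝒳}
    (hx : x ∈ D ∩ Metric.ball ξ (κ * r)) (hy : y ∈ D ∩ Metric.ball ξ (κ * r)) :
    h₁ x * h₂ y ≤ ((factorConst K Θ Δ₁ Δ γ * (2 * K)) ^ 2 : ℝ≥0) * (h₁ y * h₂ x) := by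
  obtain ⟨f₁, hf₁, hf₁0, hf₁h⟩ :=
    exists_borel_of_isRegularHarmonic hD Metric.isOpen_ball hm₁ h₁0 hh₁ hv₁ x y
  obtain ⟨f₂, hf₂, hf₂0, hf₂h⟩ :=
    exists_borel_of_isRegularHarmonic hD Metric.isOpen_ball hm₂ h₂0 hh₂ hv₂ x y
  have hκr : κ * r ≤ 2 * r := mul_le_mul_of_nonneg_right h.lt_two.le h.pos.le
  have hx' := (⟨hx.1, Metric.ball_subset_ball hκr hx.2⟩ : x ∈ D ∩ Metric.ball ξ (2 * r))
  have hy' := (⟨hy.1, Metric.ball_subset_ball hκr hy.2⟩ : y ∈ D ∩ Metric.ball ξ (2 * r))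
  have hmain := h.mul_le hD hf₁ hf₁0 hf₂ hf₂0 hx hy
  rw [hf₁h x hx' (Or.inl rfl), hf₂h y hy' (Or.inr rfl), hf₁h y hy' (Or.inr rfl),
    hf₂h x hx' (Or.inl rfl), ← ENNReal.ofReal_mul (h₁0 x), ← ENNReal.ofReal_mul (h₁0 y),
    ← ENNReal.ofReal_coe_nnreal, ← ENNReal.ofReal_mul (NNReal.coe_nonneg _)] at hmain
  exact (ENNReal.ofReal_le_ofReal_iff
    (mul_nonneg (NNReal.coe_nonneg _) (mul_nonneg (h₁0 y) (h₂0 x)))).1 hmain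

end BoundaryHarnack

/-- The jump estimates, and hence the factorisation of harmonic functions, hold at all locations and
all admissible scales with parameters that depend only on the constants in the assumptions. -/
theorem exists_factorizationData {κ : ℝ} (hκ : κ < 2) (M : ℝ≥0) (γ : ℕ)
    {l C a b c₁ : ℝ≥0} (c₂ cEP : ℝ≥0) (hl : 1 < l) (hC : 1 < C) (ha : 1 < a) (hb : 1 < b)
    (hc₁ : 0 < c₁) :
    ∃ Θ Δ₁ Δ : ℝ≥0, ∀ (𝒳 : Type*) [MetricSpace 𝒳] [LocallyCompactSpace 𝒳]
      [SecondCountableTopology 𝒳] [MeasurableSpace 𝒳] [BorelSpace 𝒳] (m : Measure 𝒳) (φ : ℝ → ℝ)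
      (Ω : Type*) [MeasurableSpace Ω] (Z : HuntProcess 𝒳 Ω) (r₀ : ℝ≥0∞),
      PolynomialGrowth m φ M γ → ReverseVolumeDoubling m l C → ScaleReverseDoubling φ a b →
      JumpKernelBounds Z m φ c₁ c₂ → ExitProbabilityBound Z φ r₀ cEP →
      ∀ (ξ : 𝒳) (r : ℝ), 0 < r →
        ENNReal.ofReal r < min (Metric.ediam (univ : Set 𝒳) / (2 * ENNReal.ofReal l)) r₀ →
        FactorizationData Z (fun ρ => (ENNReal.ofReal (φ ρ))⁻¹) (refMeasure m φ)
          (jumpConst M γ l C a b c₁ c₂ cEP) Θ Δ₁ Δ (2 * γ) ξ r κ := by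
  set K := jumpConst M γ l C a b c₁ c₂ cEP with hK
  have hMK : M ≤ K := by
    rw [hK, jumpConst]
    exact le_add_right le_add_self
  obtain ⟨Θ, hΘ, hΘK⟩ := exists_stayConst_mul_pow_lt_one K (2 * γ)
  obtain ⟨Δ₁, hΔ₁, hΔ₁κ⟩ := exists_two_le_mul (show (κ + 2) / 2 < 2 by linarith) hΘ
  obtain ⟨k₁, hk₁⟩ := pow_unbounded_of_one_lt
    (2 * carlesonConst K Θ Δ₁ (2 * γ) * (M * 3 ^ γ)) hC
  obtain ⟨k₂, hk₂⟩ := pow_unbounded_of_one_lt (4 / (2 - κ)) (show (1 : ℝ) < l from hl)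
  set k := max k₁ k₂ with hk
  refine ⟨Θ, Δ₁, l ^ k, ?_⟩
  intro 𝒳 _ _ _ _ _ m φ Ω _ Z r₀ hG hrvd hab hJ hEP ξ r hr hr₀
  have hl1 : (1 : ℝ) ≤ l := hl.le
  have hΔ1 : (1 : ℝ≥0) ≤ l ^ k := one_le_pow₀ hl.le
  have hΔ0 : (0 : ℝ) < (l ^ k : ℝ≥0) := one_pos.trans_le (show (1 : ℝ) ≤ (l ^ k : ℝ≥0) from hΔ1)
  have hrΔ : 0 < r / (l ^ k : ℝ≥0) := by positivity
  refine ⟨hr, fun z ρ hρ hρr => ?_, ?_, hκ, hΘ, hΘK, hΔ₁, hΔ₁κ, hΔ1, ?_, fun x hx => ?_⟩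
  · exact jumpEstimates_of_bounds hG hrvd hab hJ hEP hl.le hC ha hb hc₁ z hρ
      ((ENNReal.ofReal_le_ofReal hρr).trans_lt hr₀)
  · have h1 := hG.scale_mul_le _ hrΔ _ hΔ1
    rw [mul_div_cancel₀ _ hΔ0.ne'] at h1
    refine (inv_le_mul_inv h1 (hG.ofReal_scale_ne_zero hr) ENNReal.ofReal_ne_top
      (hG.ofReal_scale_ne_zero hrΔ) ENNReal.ofReal_ne_top).trans (mul_le_mul' ?_ le_rfl)
    rw [← ENNReal.coe_pow, ← ENNReal.coe_mul]
    exact ENNReal.coe_le_coe.2 (mul_le_mul' hMK (pow_le_pow_right₀ hΔ1 (by omega)))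
  · have h1 : 4 / (2 - κ) ≤ (l : ℝ) ^ k :=
      hk₂.le.trans (pow_le_pow_right₀ hl1 (le_max_right _ _))
    rw [div_le_iff₀ (by linarith)] at h1
    simpa using h1
  · have h1 := hG.pow_mul_refMeasure_ball_le (C := C) hl.le (fun s hs hsr => by
      have h2 : ENNReal.ofReal s ≤ Metric.ediam (univ : Set 𝒳) / ENNReal.ofReal l :=
        le_trans (le_trans (ENNReal.ofReal_le_ofReal hsr) (le_mul_of_one_le_left zero_le one_le_two))
          (two_mul_le_div (lt_min_iff.1 hr₀).1.le)
      have h3 := hrvd x s hs h2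
      rwa [ENNReal.ofReal_coe_nnreal] at h3) hx k
    have hCk : ((C : ℝ≥0∞) ^ k) ≠ 0 := pow_ne_zero _ (by exact_mod_cast (one_pos.trans hC).ne')
    refine (ENNReal.mul_le_mul_iff_right hCk (ENNReal.pow_ne_top ENNReal.coe_ne_top)).1 ?_
    rw [NNReal.coe_pow]
    calc (C : ℝ≥0∞) ^ k * (2 * carlesonConst K Θ Δ₁ (2 * γ) *
          refMeasure m φ ξ r (Metric.ball x (r / (l : ℝ) ^ k)))
        = 2 * carlesonConst K Θ Δ₁ (2 * γ) *
          (C ^ k * refMeasure m φ ξ r (Metric.ball x (r / (l : ℝ) ^ k))) := by ring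
      _ ≤ 2 * carlesonConst K Θ Δ₁ (2 * γ) * (M * 3 ^ γ : ℝ≥0) := by gcongr
      _ = (2 * carlesonConst K Θ Δ₁ (2 * γ) * (M * 3 ^ γ) : ℝ≥0) := by push_cast; rfl
      _ ≤ (C ^ k : ℝ≥0) := by
          exact ENNReal.coe_le_coe.2 (hk₁.le.trans (pow_le_pow_right₀ hC.le (le_max_left _ _)))
      _ = C ^ k * 1 := by rw [mul_one, ENNReal.coe_pow]

end UniformBHP

end

theorem corollary1p5
    -- `κ`, and the parameters in VD, in RVD, in the growth bound and the reverse doubling of `φ`,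
    -- in `J_φ` and in `(EP)_{φ, r₀, ≤}`
    (κ cVD lam₀ cRVD cφ β a b c₁ c₂ cEP : ℝ)
    (hκ₀ : 0 < κ) (hκ₂ : κ < 2) (hcVD : 1 < cVD) (hlam₀ : 2 ≤ lam₀) (hcRVD : 1 < cRVD)
    (hcφ : 1 ≤ cφ) (hβ : 0 < β) (ha : 1 < a) (hb : 1 < b) (hc₁ : 0 < c₁) (hc₂ : 0 < c₂)
    (hcEP : 0 < cEP) :
    ∃ C : ℝ, 1 < C ∧
      ∀ (𝒳 : Type*) [MetricSpace 𝒳] [LocallyCompactSpace 𝒳] [MeasurableSpace 𝒳] [BorelSpace 𝒳]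
        (m : MeasureTheory.Measure 𝒳) [m.Regular] [m.IsOpenPosMeasure]
        (φ : ℝ → ℝ) (Ω : Type*) [MeasurableSpace Ω] (Z : UniformBHP.HuntProcess 𝒳 Ω)
        (r₀ : ENNReal), 0 < r₀ →
        UniformBHP.VolumeDoubling m cVD →
        UniformBHP.ReverseVolumeDoubling m lam₀ cRVD →
        UniformBHP.IsScaleFunction φ cφ β →
        UniformBHP.ScaleReverseDoubling φ a b →
        UniformBHP.JumpKernelBounds Z m φ c₁ c₂ →
        UniformBHP.ExitProbabilityBound Z φ r₀ cEP →
        ∀ (D : Set 𝒳), IsOpen D → D ≠ Set.univ →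
        ∀ r : ℝ, 0 < r →
          ENNReal.ofReal r <
            min (Metric.ediam (Set.univ : Set 𝒳) / (2 * ENNReal.ofReal lam₀)) r₀ →
        ∀ ξ ∈ frontier D, ∀ h₁ h₂ : 𝒳 → ℝ,
          UniformBHP.UniversallyMeasurable h₁ → UniformBHP.UniversallyMeasurable h₂ →
          (∀ x, 0 ≤ h₁ x) → (∀ x, 0 ≤ h₂ x) →
          Z.IsRegularHarmonic h₁ (D ∩ Metric.ball ξ (2 * r)) →
          Z.IsRegularHarmonic h₂ (D ∩ Metric.ball ξ (2 * r)) →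
          (∀ x ∈ Metric.ball ξ (2 * r) \ D, h₁ x = 0) →
          (∀ x ∈ Metric.ball ξ (2 * r) \ D, h₂ x = 0) →
          ∀ x ∈ D ∩ Metric.ball ξ (κ * r), ∀ y ∈ D ∩ Metric.ball ξ (κ * r),
            h₁ x * h₂ y ≤ C * (h₁ y * h₂ x) := by
  obtain ⟨α, hα⟩ := pow_unbounded_of_one_lt cVD one_lt_two
  obtain ⟨β', hβ'⟩ := exists_nat_ge β
  lift lam₀ to ℝ≥0 using by linarith
  lift cRVD to ℝ≥0 using by linarith
  lift a to ℝ≥0 using by linarith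
  lift b to ℝ≥0 using by linarith
  lift c₁ to ℝ≥0 using hc₁.le
  lift c₂ to ℝ≥0 using hc₂.le
  lift cEP to ℝ≥0 using hcEP.le
  have hl : (1 : ℝ≥0) < lam₀ := by
    rw [← NNReal.coe_lt_coe, NNReal.coe_one]
    linarith
  obtain ⟨Θ, Δ₁, Δ, hdata⟩ := UniformBHP.exists_factorizationData hκ₂ (2 ^ α + cφ.toNNReal)
    (α + β') c₂ cEP hl (by exact_mod_cast hcRVD) (by exact_mod_cast ha) (by exact_mod_cast hb)
    (by exact_mod_cast hc₁)
  set C : ℝ≥0 := (UniformBHP.factorConst (UniformBHP.jumpConst (2 ^ α + cφ.toNNReal) (α + β')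
    lam₀ cRVD a b c₁ c₂ cEP) Θ Δ₁ Δ (2 * (α + β')) * (2 * UniformBHP.jumpConst
    (2 ^ α + cφ.toNNReal) (α + β') lam₀ cRVD a b c₁ c₂ cEP)) ^ 2 with hC
  refine ⟨C + 2, by linarith [C.coe_nonneg], ?_⟩
  intro 𝒳 _ _ _ _ m _ _ φ Ω _ Z r₀ _ hVD hRVD hφ hab hJ hEP D hD _ r hr hr₀ ξ _ h₁ h₂ hm₁ hm₂
    h₁0 h₂0 hh₁ hh₂ hv₁ hv₂ x hx y hy
  have : SigmaFinite m := hVD.sigmaFinite ξ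
  have : SecondCountableTopology 𝒳 := UniformBHP.secondCountableTopology_of_sigmaFinite m
  have hG := UniformBHP.polynomialGrowth_of_doubling hVD hα.le hφ (by linarith) hβ'
  have h := hdata 𝒳 m φ Ω Z r₀ hG hRVD hab hJ hEP ξ r hr hr₀
  refine (h.boundary_harnack hD hm₁ hm₂ h₁0 h₂0 hh₁ hh₂ hv₁ hv₂ hx hy).trans ?_
  exact mul_le_mul_of_nonneg_right (by linarith) (mul_nonneg (h₁0 y) (h₂0 x))
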